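/- Let $k$ be a field of characteristic zero. A Poisson algebra over $k$ is a commutative $k$-algebra with a $k$-bilinear Lie bracket $\{-,-\}$ that is a derivation in each variable; a Poisson prime is a prime ideal $P$ with $\{A,P\}\subseteq P$. For a Poisson prime $P$ the bracket of $A$ induces one on $A/P$, which extends uniquely to the field of fractions $\operatorname{Fract} A/P$. For a field $K\supseteq k$ and an antisymmetric matrix $\mu\in M_m(k)$, let $K_\mu(y_1,\dots,y_m)$ denote the rational function field over $K$ with the $K$-bilinear Poisson bracket satisfying $\{y_i,y_j\}=\mu_{ij}y_iy_j$ (similarly for other finite index sets); it is regarded as a Poisson algebra over $k$. Let $n\ge 0$ and let $A$ be one of the following Poisson algebras (semiclassical limits of quantum algebras), each a polynomial algebra over $k$ with the Poisson bracket given on the indeterminates. (i) (Quantum affine spaces) $A=k[x_1,\dots,x_n]$, $\{x_i,x_j\}=q_{ij}x_ix_j$, with $(q_{ij})\in M_n(k)$ antisymmetric. (ii) (Quantum matrices) $A=k[X_{ij}\mid 1\le i,j\le n]$, with $\lambda\in k$, $(p_{ij})\in M_n(k)$ antisymmetric, and $$\{X_{lm},X_{ij}\}=\begin{cases}(p_{li}+p_{jm})X_{ij}X_{lm}+\lambda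 X_{im}X_{lj}&(l>i,\ m>j)\\(\lambda+p_{li}+p_{jm})X_{ij}X_{lm}&(l>i,\ m\le j)\\p_{jm}X_{ij}X_{lm}&(l=i,\ m>j).\end{cases}$$ (iii) (Quantum symplectic and even-dimensional euclidean spaces) $A=k[x_1,y_1,\dots,x_n,y_n]$, with $(\gamma_{ij})\in M_n(k)$ antisymmetric, $p,q\in k^n$ with $p_i\ne q_i$ for all $i$, and $$\begin{aligned}\{y_i,y_j\}&=\gamma_{ij}y_iy_j,\qquad \{x_i,x_j\}=(q_i-p_j+\gamma_{ij})x_ix_j\ (i<j),\\ \{x_i,y_j\}&=(p_j+\gamma_{ji})x_iy_j\ (i<j),\qquad \{x_i,y_j\}=(q_j+\gamma_{ji})x_iy_j\ (i>j),\\ \{x_i,y_i\}&=q_ix_iy_i+\textstyle\sum_{\ell<i}(q_\ell-p_\ell)x_\ell y_\ell.\end{aligned}$$ (iv) (Odd-dimensional quantum euclidean spaces) $A=k[z_0,x_1,y_1,\dots,x_n,y_n]$, with $\gamma,p,q$ as in (iii), $\lambda\in k$, the brackets of (iii) except that $\{x_i,y_i\}=q_ix_iy_i+\sum_{\ell<i}(q_\ell-p_\ell)x_\ell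 y_\ell+\lambda z_0^2$, and $\{z_0,x_i\}=-(p_i/2)z_0x_i$, $\{z_0,y_i\}=(p_i/2)z_0y_i$. (v) (Quantum symmetric matrices) $A=k[y_{ij}\mid 1\le i\le j\le n]$, with $y_{ji}:=y_{ij}$ and $$\{y_{ij},y_{lm}\}=(\operatorname{sign}(l-j)+\operatorname{sign}(m-i))y_{il}y_{jm}+(\operatorname{sign}(l-i)+\operatorname{sign}(m-j))y_{im}y_{jl}.$$ (vi) (Quantum antisymmetric matrices) $A=k[y_{ij}\mid 1\le i<j\le n]$, with $y_{ji}:=-y_{ij}$, $y_{ii}:=0$ and $$\{y_{ij},y_{lm}\}=(\operatorname{sign}(l-j)+\operatorname{sign}(m-i))y_{il}y_{jm}-(\operatorname{sign}(l-i)+\operatorname{sign}(m-j))y_{im}y_{jl}.$$ Then: (1) For every Poisson prime ideal $P$ of $A$ there are a field extension $K\supseteq k$, an integer $m\ge0$ and an antisymmetric matrix $\mu\in M_m(k)$ such that $\operatorname{Fract} A/P\cong K_\mu(y_1,\dots,y_m)$ as Poisson algebras over $k$. (2) For $P=0$ this holds with $K=k$ and $m=\operatorname{tr.deg}_kA$.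 (3) Explicitly, $\operatorname{Fract}A\cong k_\Lambda(Y_s)$ with one variable $Y_s$ for each indeterminate of $A$ and the following brackets. - (i): $\{Y_i,Y_j\}=q_{ij}Y_iY_j$. - (ii): $\{Y_{lm},Y_{ij}\}=(p_{li}+p_{jm})Y_{ij}Y_{lm}$ if $l\ge i$, $m>j$, and $=(\lambda+p_{li}+p_{jm})Y_{ij}Y_{lm}$ if $l>i$, $m\le j$. - (iii): with variables $v_i,w_i$: $\{w_i,w_j\}=\gamma_{ij}w_iw_j$; $\{v_i,w_j\}=(p_j+\gamma_{ji})v_iw_j$ for $i<j$ and $(q_j+\gamma_{ji})v_iw_j$ for $i\ge j$; $\{v_i,v_j\}=(q_i-p_j+\gamma_{ij})v_iv_j$ for $i<j$. - (iv): with variables $u_0,v_i,w_i$: the brackets of (iii), and $\{u_0,v_i\}=-(p_i/2)u_0v_i$, $\{u_0,w_i\}=(p_i/2)u_0w_i$. - (v): for $(i,j)<_{\rm lex}(l,m)$, $\{z_{ij},z_{lm}\}=c\,z_{ij}z_{lm}$, where $c=1$ if $i=l<j<m$ or $i<l<j=m$ or $i<j=l<m$; $c=2$ if $i=j=l<m$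 or $i<j=l=m$; and $c=0$ otherwise. - (vi): for $(i,j)<_{\rm lex}(l,m)$, $\{z_{ij},z_{lm}\}=z_{ij}z_{lm}$ if $|\{i,j\}\cap\{l,m\}|=1$, and $=0$ otherwise. -/

import Mathlib

open MvPolynomial

universe u

/-- A Poisson bracket on a commutative `k`-algebra `A`: a `k`-bilinear Lie bracket
which is a derivation in each variable. -/
structure PoissonBracket (k A : Type*) [CommRing k] [CommRing A] [Algebra k A] where
  bracket : A →ₗ[k] A →ₗ[k] A
  alt : ∀ a, bracket a a = 0
  jacobi : ∀ a b c,
    bracket a (bracket b c) + bracket b (bracket c a) + bracket c (bracket a b) = 0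
  leibniz : ∀ a b c, bracket a (b * c) = bracket a b * c + b * bracket a c

namespace PoissonBracket

section General

variable {k R A : Type*} [CommRing k] [CommRing R] [CommRing A] [Algebra k A] [Algebra R A]

theorem skew (π : PoissonBracket k A) (a b : A) : π.bracket a b = -π.bracket b a := by
  have h := π.alt (a + b)
  simp only [map_add, LinearMap.add_apply, π.alt, zero_add, add_zero] at h
  exact eq_neg_of_add_eq_zero_right h

/-- An ideal `I` is a Poisson ideal if `{A, I} ⊆ I`. -/
def IsPoissonIdeal (π : PoissonBracket k A) (I : Ideal A) : Prop :=
  ∀ a, ∀ b ∈ I, π.bracket a b ∈ I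

/-- The Jacobi expression of a biderivation. -/
def jac (D : Derivation R A (Derivation R A A)) (a b c : A) : A :=
  D a (D b c) + D b (D c a) + D c (D a b)

theorem bider_skew (D : Derivation R A (Derivation R A A)) (alt : ∀ a, D a a = 0) (a b : A) :
    D a b = -D b a := by
  have h := alt (a + b)
  simp only [map_add, Derivation.add_apply, alt, zero_add, add_zero] at h
  exact eq_neg_of_add_eq_zero_right h

theorem jac_eq (D : Derivation R A (Derivation R A A)) (alt : ∀ a, D a a = 0) (a b c : A) :
    jac D a b c = (⁅D a, D b⁆ - D (D a b)) c := by
  rw [Derivation.sub_apply, Derivation.commutator_apply, jac, bider_skew D alt c a,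
    bider_skew D alt c (D a b), map_neg]
  ring

theorem jac_swap (D : Derivation R A (Derivation R A A)) (alt : ∀ a, D a a = 0) (a b c : A) :
    jac D b a c = -jac D a b c := by
  rw [jac, jac, bider_skew D alt b a, bider_skew D alt a c, bider_skew D alt c b]
  simp only [map_neg]
  ring

/-- If `S` is a set on which derivations of `A` are determined, then the Jacobi identity for a
biderivation holds as soon as it holds on `S`. -/
theorem jac_of_set (D : Derivation R A (Derivation R A A)) (alt : ∀ a, D a a = 0) (S : Set A)
    (hS : ∀ d : Derivation R A A, (∀ s ∈ S, d s = 0) → d = 0)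
    (h : ∀ a ∈ S, ∀ b ∈ S, ∀ c ∈ S, jac D a b c = 0) (a b c : A) : jac D a b c = 0 := by
  have cyc : ∀ a b c, jac D a b c = jac D b c a := fun a b c => by simp only [jac]; ring
  have ext : ∀ a b, (∀ c ∈ S, jac D a b c = 0) → ∀ c, jac D a b c = 0 := by
    intro a b hab c
    have := hS (⁅D a, D b⁆ - D (D a b)) fun s hs => by rw [← jac_eq D alt, hab s hs]
    rw [jac_eq D alt, this, Derivation.zero_apply]
  have h1 : ∀ a ∈ S, ∀ b ∈ S, ∀ c, jac D a b c = 0 := fun a ha b hb => ext a b (h a ha b hb)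
  have h2 : ∀ a ∈ S, ∀ b c, jac D a b c = 0 := fun a ha b => ext a b fun c hc => by
    rw [← cyc, h1 c hc a ha]
  exact ext a b (fun c hc => by rw [← cyc, h2 c hc]) c

/-- An alternating biderivation over `R` satisfying the Jacobi identity, as a Poisson bracket over
a subring `k` of scalars. -/
def ofBiderivation [Algebra k R] [IsScalarTower k R A] (D : Derivation R A (Derivation R A A))
    (alt : ∀ a, D a a = 0) (jacobi : ∀ a b c, jac D a b c = 0) : PoissonBracket k A where
  bracket := LinearMap.mk₂ k (fun a b => D a b)
    (fun a b c => by simp) (fun r a b => by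
      rw [← algebraMap_smul R r a, Derivation.map_smul, Derivation.smul_apply, algebraMap_smul])
    (fun a b c => by simp) (fun r a b => by
      rw [← algebraMap_smul R r b, Derivation.map_smul, algebraMap_smul])
  alt := alt
  jacobi := jacobi
  leibniz a b c := by simp [mul_comm, add_comm]

@[simp]
theorem ofBiderivation_bracket [Algebra k R] [IsScalarTower k R A]
    (D : Derivation R A (Derivation R A A))
    (alt : ∀ a, D a a = 0) (jacobi : ∀ a b c, jac D a b c = 0) (a b : A) :
    (ofBiderivation (k := k) D alt jacobi).bracket a b = D a b := rfl

/-- The biderivation underlying a Poisson bracket. -/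
def toBiderivation (π : PoissonBracket k A) : Derivation k A (Derivation k A A) :=
  Derivation.mk'
    { toFun := fun a => Derivation.mk' (π.bracket a) fun b c => by
        rw [π.leibniz, smul_eq_mul, smul_eq_mul]; ring
      map_add' := fun a b => by ext; simp
      map_smul' := fun r a => by ext; simp }
    fun a b => by
      ext c
      simp only [LinearMap.coe_mk, AddHom.coe_mk, Derivation.add_apply,
        Derivation.smul_apply, smul_eq_mul, Derivation.coe_mk']
      rw [π.skew, π.leibniz, π.skew a c, π.skew b c]
      ring

@[simp]
theorem toBiderivation_apply (π : PoissonBracket k A) (a b : A) :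
    π.toBiderivation a b = π.bracket a b := rfl

end General

section Quotient

variable {k A : Type*} [CommRing k] [CommRing A] [Algebra k A]

theorem quotient_wd (π : PoissonBracket k A) (I : Ideal A) (hI : π.IsPoissonIdeal I)
    (a b : A) : Ideal.Quotient.mk I (π.bracket
      (Function.surjInv Ideal.Quotient.mk_surjective (Ideal.Quotient.mk I a))
      (Function.surjInv Ideal.Quotient.mk_surjective (Ideal.Quotient.mk I b))) =
    Ideal.Quotient.mk I (π.bracket a b) := by
  set a' := Function.surjInv Ideal.Quotient.mk_surjective (Ideal.Quotient.mk I a) with ha'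
  set b' := Function.surjInv Ideal.Quotient.mk_surjective (Ideal.Quotient.mk I b) with hb'
  have ha : a' - a ∈ I := Ideal.Quotient.eq.mp (Function.surjInv_eq _ _)
  have hb : b' - b ∈ I := Ideal.Quotient.eq.mp (Function.surjInv_eq _ _)
  rw [Ideal.Quotient.eq]
  have h1 := hI a' _ hb
  have h2 := hI b _ ha
  rw [π.skew] at h2
  have h3 := I.sub_mem h1 h2
  simp only [map_sub, LinearMap.sub_apply, sub_neg_eq_add] at h3 ⊢
  convert h3 using 1
  ring

/-- The Poisson bracket induced on `A / I` by a Poisson ideal `I`. -/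
noncomputable def quotient (π : PoissonBracket k A) (I : Ideal A) (hI : π.IsPoissonIdeal I) :
    PoissonBracket k (A ⧸ I) :=
  let f : A ⧸ I → A ⧸ I → A ⧸ I := fun x y => Ideal.Quotient.mk I
    (π.bracket (Function.surjInv Ideal.Quotient.mk_surjective x)
      (Function.surjInv Ideal.Quotient.mk_surjective y))
  have hf : ∀ a b, f (Ideal.Quotient.mk I a) (Ideal.Quotient.mk I b) =
      Ideal.Quotient.mk I (π.bracket a b) := π.quotient_wd I hI
  have hs : Function.Surjective (Ideal.Quotient.mk I) := Ideal.Quotient.mk_surjective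
  { bracket := LinearMap.mk₂ k f
      (hs.forall₃.mpr fun a b c => by rw [← map_add, hf, hf, hf, ← map_add, map_add,
        LinearMap.add_apply])
      (fun r => hs.forall₂.mpr fun a b => by
        rw [← Ideal.Quotient.mkₐ_eq_mk k, ← map_smul, Ideal.Quotient.mkₐ_eq_mk, hf, hf, map_smul,
          LinearMap.smul_apply, ← Ideal.Quotient.mkₐ_eq_mk k, map_smul])
      (hs.forall₃.mpr fun a b c => by rw [← map_add, hf, hf, hf, ← map_add, map_add])
      (fun r => hs.forall₂.mpr fun a b => by
        rw [← Ideal.Quotient.mkₐ_eq_mk k, ← map_smul, Ideal.Quotient.mkₐ_eq_mk, hf, hf, map_smul,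
          ← Ideal.Quotient.mkₐ_eq_mk k, map_smul])
    alt := hs.forall.mpr fun a => by rw [LinearMap.mk₂_apply, hf, π.alt, map_zero]
    jacobi := hs.forall₃.mpr fun a b c => by
      simp only [LinearMap.mk₂_apply, hf, ← map_add, π.jacobi, map_zero]
    leibniz := hs.forall₃.mpr fun a b c => by
      simp only [LinearMap.mk₂_apply, hf, ← map_add, ← map_mul, π.leibniz] }

@[simp]
theorem quotient_mk (π : PoissonBracket k A) (I : Ideal A) (hI : π.IsPoissonIdeal I) (a b : A) :
    (π.quotient I hI).bracket (Ideal.Quotient.mk I a) (Ideal.Quotient.mk I b) =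
      Ideal.Quotient.mk I (π.bracket a b) :=
  π.quotient_wd I hI a b

end Quotient

section Fraction

variable {k A : Type*} [CommRing k] [CommRing A] [Algebra k A]

/-- The extension of a derivation `A → M` to the ring of fractions `F` of `A`, for an
`F`-module `M`. -/
noncomputable def extendDer (F : Type*) [CommRing F] [Algebra k F] [Algebra A F]
    [IsScalarTower k A F] [IsFractionRing A F] {M : Type*} [AddCommGroup M] [Module k M]
    [Module A M] [Module F M] [IsScalarTower A F M] [IsScalarTower k F M] [IsScalarTower k A M]
    (d : Derivation k A M) : Derivation k F M :=
  haveI := Algebra.FormallyEtale.of_isLocalization (Rₘ := F) (nonZeroDivisors A)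
  ((KaehlerDifferential.isBaseChange_of_formallyEtale k A F).lift
    d.liftKaehlerDifferential).compDer (KaehlerDifferential.D k F)

theorem extendDer_algebraMap (F : Type*) [CommRing F] [Algebra k F] [Algebra A F]
    [IsScalarTower k A F] [IsFractionRing A F] {M : Type*} [AddCommGroup M] [Module k M]
    [Module A M] [Module F M] [IsScalarTower A F M] [IsScalarTower k F M] [IsScalarTower k A M]
    (d : Derivation k A M) (a : A) : extendDer F d (algebraMap A F a) = d a := by
  have := Algebra.FormallyEtale.of_isLocalization (Rₘ := F) (nonZeroDivisors A)
  have h := (KaehlerDifferential.isBaseChange_of_formallyEtale k A F).lift_eq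
    d.liftKaehlerDifferential (KaehlerDifferential.D k A a)
  rw [KaehlerDifferential.map_D, Derivation.liftKaehlerDifferential_comp_D] at h
  exact h

/-- Derivations on a ring of fractions are determined on the base ring. -/
theorem der_ext_fraction {k A : Type*} [CommRing k] [CommRing A] (F : Type*) [CommRing F] [Algebra k F] [Algebra A F]
    [IsFractionRing A F] {M : Type*} [AddCommGroup M] [Module k M]
    [Module F M] (d : Derivation k F M)
    (h : ∀ a : A, d (algebraMap A F a) = 0) : d = 0 := by
  ext f
  obtain ⟨a, s, rfl⟩ := IsLocalization.exists_mk'_eq (nonZeroDivisors A) f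
  have hs : IsUnit (algebraMap A F s) := IsLocalization.map_units F s
  have := congrArg d (IsLocalization.mk'_spec F a s)
  rw [Derivation.leibniz, h, h, smul_zero, zero_add] at this
  exact (hs.smul_eq_zero).mp this

/-- For fixed `a`, the derivation `{a, -} : A → F`, as a derivation in `a`. -/
noncomputable def extendFst (π : PoissonBracket k A) (F : Type*) [CommRing F] [Algebra k F]
    [Algebra A F] [IsScalarTower k A F] [IsFractionRing A F] :
    Derivation k A (Derivation k F F) :=
  have key : ∀ (d e : Derivation k F F), (∀ a : A, d (algebraMap A F a) = e (algebraMap A F a)) →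
      d = e := fun d e h => sub_eq_zero.mp <| der_ext_fraction F (d - e) fun a => by
        rw [Derivation.sub_apply, h a, sub_self]
  Derivation.mk'
    { toFun := fun a => extendDer F
        ((Algebra.linearMap A F).compDer (π.toBiderivation a))
      map_add' := fun a b => key _ _ fun c => by simp [extendDer_algebraMap]
      map_smul' := fun r a => key _ _ fun c => by
        simp [extendDer_algebraMap] }
    fun a b => key _ _ fun c => by
      simp [extendDer_algebraMap, Algebra.smul_def]

theorem extendFst_algebraMap (π : PoissonBracket k A) (F : Type*) [CommRing F] [Algebra k F]
    [Algebra A F] [IsScalarTower k A F] [IsFractionRing A F] (a b : A) :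
    π.extendFst F a (algebraMap A F b) = algebraMap A F (π.bracket a b) := by
  change extendDer F ((Algebra.linearMap A F).compDer (π.toBiderivation a)) _ = _
  rw [extendDer_algebraMap]
  rfl

/-- The biderivation on `Fract A` extending a Poisson bracket on `A`. -/
noncomputable def fractionBider (π : PoissonBracket k A) :
    Derivation k (FractionRing A) (Derivation k (FractionRing A) (FractionRing A)) :=
  extendDer (FractionRing A) (π.extendFst (FractionRing A))

theorem fractionBider_algebraMap (π : PoissonBracket k A) (a b : A) :
    π.fractionBider (algebraMap A (FractionRing A) a) (algebraMap A (FractionRing A) b) =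
      algebraMap A (FractionRing A) (π.bracket a b) := by
  rw [fractionBider, extendDer_algebraMap, extendFst_algebraMap]

theorem fractionBider_alt (π : PoissonBracket k A) (f : FractionRing A) :
    π.fractionBider f f = 0 := by
  have h1 : ∀ (f : FractionRing A) (b : A), π.fractionBider f (algebraMap A _ b) =
      -π.fractionBider (algebraMap A _ b) f := by
    intro f b
    obtain ⟨a, s, rfl⟩ := IsLocalization.exists_mk'_eq (nonZeroDivisors A) f
    have hs : IsUnit (algebraMap A (FractionRing A) s) := IsLocalization.map_units _ s
    have e := IsLocalization.mk'_spec (FractionRing A) a s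
    set f := IsLocalization.mk' (FractionRing A) a s
    have e1 := congrArg (fun x => π.fractionBider x (algebraMap A _ b)) e
    have e2 := congrArg (fun x => π.fractionBider (algebraMap A _ b) x) e
    simp only [Derivation.leibniz, Derivation.add_apply, Derivation.smul_apply, smul_eq_mul,
      fractionBider_algebraMap] at e1 e2
    rw [π.skew (s : A) b, π.skew a b, map_neg, map_neg] at e1
    refine hs.mul_left_cancel ?_
    linear_combination e1 + e2
  obtain ⟨a, s, hf⟩ := IsLocalization.exists_mk'_eq (nonZeroDivisors A) f
  have hs : IsUnit (algebraMap A (FractionRing A) s) := IsLocalization.map_units _ s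
  have e := IsLocalization.mk'_spec (FractionRing A) a s
  rw [hf] at e
  have e1 := congrArg (fun x => π.fractionBider x x) e
  simp only [Derivation.leibniz, Derivation.add_apply, Derivation.smul_apply, smul_eq_mul,
      fractionBider_algebraMap, π.alt, map_zero, h1 f s] at e1
  refine hs.mul_left_cancel (hs.mul_left_cancel ?_)
  linear_combination e1

/-- The extension of a Poisson bracket on `A` to `Fract A`; it is unique because derivations of
`Fract A` are determined on `A`. -/
noncomputable def fraction (π : PoissonBracket k A) : PoissonBracket k (FractionRing A) :=
  ofBiderivation π.fractionBider π.fractionBider_alt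
    (jac_of_set _ π.fractionBider_alt (Set.range (algebraMap A (FractionRing A)))
      (fun d hd => der_ext_fraction (A := A) _ d fun a => hd _ ⟨a, rfl⟩) (by
        rintro _ ⟨a, rfl⟩ _ ⟨b, rfl⟩ _ ⟨c, rfl⟩
        simp only [jac, fractionBider_algebraMap, ← map_add, π.jacobi, map_zero]))

@[simp]
theorem fraction_algebraMap (π : PoissonBracket k A) (a b : A) :
    π.fraction.bracket (algebraMap A (FractionRing A) a) (algebraMap A (FractionRing A) b) =
      algebraMap A (FractionRing A) (π.bracket a b) :=
  π.fractionBider_algebraMap a b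

end Fraction

section Polynomial

variable {R σ : Type*} [CommRing R]

/-- The biderivation of `R[X_s : s ∈ σ]` with `{X_s, X_t} = B s t`. -/
noncomputable def polyBider (B : σ → σ → MvPolynomial σ R) :
    Derivation R (MvPolynomial σ R) (Derivation R (MvPolynomial σ R) (MvPolynomial σ R)) :=
  mkDerivation R fun s => mkDerivation R fun t => B s t

@[simp]
theorem polyBider_X (B : σ → σ → MvPolynomial σ R) (s t : σ) :
    polyBider B (X s) (X t) = B s t := by
  rw [polyBider, mkDerivation_X, mkDerivation_X]

theorem polyBider_alt (B : σ → σ → MvPolynomial σ R) (h0 : ∀ s, B s s = 0)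
    (h1 : ∀ s t, B s t = -B t s) (f : MvPolynomial σ R) : polyBider B f f = 0 := by
  have hX : ∀ s f, polyBider B (X s) f = -polyBider B f (X s) := by
    intro s f
    induction f using MvPolynomial.induction_on with
    | C a => simp [MvPolynomial.derivation_C]
    | add p q hp hq => simp [hp, hq]; ring
    | mul_X p t hp =>
      simp only [Derivation.leibniz, Derivation.add_apply, Derivation.smul_apply, hp, polyBider_X,
        smul_eq_mul, h1 s t]
      ring
  have hsk : ∀ f g, polyBider B f g = -polyBider B g f := by
    intro f g
    induction f using MvPolynomial.induction_on with
    | C a => simp [MvPolynomial.derivation_C]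
    | add p q hp hq => simp [hp, hq]; ring
    | mul_X p t hp =>
      simp only [Derivation.leibniz, Derivation.add_apply, Derivation.smul_apply, hp, hX,
        smul_eq_mul]
      ring
  induction f using MvPolynomial.induction_on with
  | C a => simp [MvPolynomial.derivation_C]
  | add p q hp hq => simp [hp, hq, hsk p q]
  | mul_X p t hp =>
    simp only [Derivation.leibniz, Derivation.add_apply, Derivation.smul_apply, hp, polyBider_X,
      smul_eq_mul, h0, hX t p]
    ring

/-- The Poisson bracket on `R[X_s : s ∈ σ]` with `{X_s, X_t} = B s t`, provided that `B` is
alternating and that the Jacobi identity holds on the indeterminates. -/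
noncomputable def poly (k : Type*) [CommRing k] [Algebra k R]
    (B : σ → σ → MvPolynomial σ R) (h0 : ∀ s, B s s = 0) (h1 : ∀ s t, B s t = -B t s)
    (h2 : ∀ r s t, jac (polyBider B) (X r) (X s) (X t) = 0) :
    PoissonBracket k (MvPolynomial σ R) :=
  ofBiderivation (polyBider B) (polyBider_alt B h0 h1)
    (jac_of_set _ (polyBider_alt B h0 h1) (Set.range X)
      (fun d hd => MvPolynomial.derivation_ext fun i => hd _ ⟨i, rfl⟩)
      (by rintro _ ⟨r, rfl⟩ _ ⟨s, rfl⟩ _ ⟨t, rfl⟩; exact h2 r s t))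

@[simp]
theorem poly_X (k : Type*) [CommRing k] [Algebra k R]
    (B : σ → σ → MvPolynomial σ R) (h0 : ∀ s, B s s = 0) (h1 : ∀ s t, B s t = -B t s)
    (h2 : ∀ r s t, jac (polyBider B) (X r) (X s) (X t) = 0) (s t : σ) :
    (poly k B h0 h1 h2).bracket (X s) (X t) = B s t :=
  polyBider_X B s t

end Polynomial

section Families

variable {k : Type*} [Field k] [CharZero k]

theorem diag_zero {σ : Type*} {μ : Matrix σ σ k} (h : μ.transpose = -μ) (s : σ) : μ s s = 0 := by
  have := congrFun (congrFun h s) s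
  rw [Matrix.transpose_apply, Matrix.neg_apply] at this
  exact self_eq_neg.mp this

theorem skew_apply {k : Type*} [Field k] {σ : Type*} {μ : Matrix σ σ k} (h : μ.transpose = -μ) (s t : σ) :
    μ s t = -μ t s := congrFun (congrFun h t) s

/-- The Poisson algebra `K_μ[y_s : s ∈ σ]`, where `{y_s, y_t} = μ_{st} y_s y_t`, for an
antisymmetric matrix `μ` over `k` and a field extension `K` of `k`. -/
noncomputable def quadratic (K : Type*) [Field K] [Algebra k K] {σ : Type*} (μ : Matrix σ σ k)
    (hμ : μ.transpose = -μ) : PoissonBracket k (MvPolynomial σ K) :=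
  poly k (fun s t => C (algebraMap k K (μ s t)) * X s * X t)
    (fun s => by simp [diag_zero hμ])
    (fun s t => by rw [skew_apply hμ, map_neg, C_neg]; ring)
    (fun r s t => by
      simp only [jac, polyBider_X, Derivation.leibniz, MvPolynomial.derivation_C, smul_eq_mul,
        mul_zero, add_zero]
      rw [skew_apply hμ r t, skew_apply hμ s r, skew_apply hμ t s]
      simp only [map_neg]
      ring)

/-- `sign (a - b)` for indices `a`, `b`, as an element of a ring. -/
def sg (R : Type*) [Ring R] {n : ℕ} (a b : Fin n) : R :=
  if b < a then 1 else if a < b then -1 else 0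

theorem sg_skew (R : Type*) [Ring R] {n : ℕ} (a b : Fin n) : sg R a b = -sg R b a := by
  unfold sg
  rcases lt_trichotomy a b with h | h | h
  · simp [h, h.not_gt]
  · simp [h]
  · simp [h, h.not_gt]

theorem der_sg {R A : Type*} [CommRing R] [CommRing A] [Algebra R A] (d : Derivation R A A) {n : ℕ}
    (a b : Fin n) : d (sg A a b) = 0 := by
  unfold sg
  split_ifs <;> simp

theorem sg_cyc {R : Type*} [CommRing R] {n : ℕ} (a b c : Fin n) (P : R)
    (hP : a = b → b = c → P = 0) :
    (sg R a b * sg R b c + sg R b c * sg R c a + sg R c a * sg R a b + 1) * P = 0 := by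
  by_cases h : a = b ∧ b = c
  · rw [hP h.1 h.2, mul_zero]
  · suffices sg R a b * sg R b c + sg R b c * sg R c a + sg R c a * sg R a b + 1 = 0 by
      rw [this, zero_mul]
    unfold sg
    split_ifs <;> first | (exfalso; omega) | ring

/-- The alternating extension of a function prescribed on the pairs with `r a b`. -/
def skewExtend {σ G : Type*} [Neg G] [Zero G] (r : σ → σ → Prop) [DecidableRel r]
    (c : σ → σ → G) (a b : σ) : G :=
  if r a b then c a b else if r b a then -c b a else 0

theorem skewExtend_self {σ G : Type*} [Neg G] [Zero G] (r : σ → σ → Prop) [DecidableRel r]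
    (hr : ∀ a b, r a b → ¬ r b a) (c : σ → σ → G) (a : σ) : skewExtend r c a a = 0 := by
  have : ¬ r a a := fun h => hr a a h h
  simp [skewExtend, this]

theorem skewExtend_skew {σ G : Type*} [AddGroup G] (r : σ → σ → Prop) [DecidableRel r]
    (hr : ∀ a b, r a b → ¬ r b a) (c : σ → σ → G) (a b : σ) :
    skewExtend r c a b = -skewExtend r c b a := by
  unfold skewExtend
  by_cases h1 : r a b
  · simp [h1, hr a b h1]
  · by_cases h2 : r b a <;> simp [h1, h2]

/-- The lexicographic order on pairs of indices. -/
def LexLT {n : ℕ} (a b : Fin n × Fin n) : Prop :=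
  a.1 < b.1 ∨ (a.1 = b.1 ∧ a.2 < b.2)

instance {n : ℕ} : DecidableRel (LexLT (n := n)) := fun _ _ => inferInstanceAs (Decidable (_ ∨ _))

theorem LexLT.asymm {n : ℕ} (a b : Fin n × Fin n) (h : LexLT a b) : ¬ LexLT b a := by
  unfold LexLT at *
  omega

/-- The bracket `{X_{lm}, X_{ij}}` of the semiclassical limit of quantum `n × n` matrices with
parameters `lam` and `p`; it is prescribed for `(i,j) <_lex (l,m)`. -/
noncomputable def matricesGen {n : ℕ} (lam : k) (p : Matrix (Fin n) (Fin n) k) :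
    Fin n × Fin n → Fin n × Fin n → MvPolynomial (Fin n × Fin n) k :=
  skewExtend (fun a b => LexLT b a) fun (l, m) (i, j) =>
    if i < l ∧ j < m then
      C (p l i + p j m) * X (i, j) * X (l, m) + C lam * X (i, m) * X (l, j)
    else if i < l then
      C (lam + p l i + p j m) * X (i, j) * X (l, m)
    else
      C (p j m) * X (i, j) * X (l, m)

theorem matricesGen_self {k : Type*} [Field k] {n : ℕ} (lam : k) (p : Matrix (Fin n) (Fin n) k)
    (a : Fin n × Fin n) : matricesGen lam p a a = 0 :=
  skewExtend_self _ (fun a b h => LexLT.asymm b a h) _ a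

theorem matricesGen_skew {k : Type*} [Field k] {n : ℕ} (lam : k) (p : Matrix (Fin n) (Fin n) k)
    (a b : Fin n × Fin n) : matricesGen lam p a b = -matricesGen lam p b a :=
  skewExtend_skew _ (fun a b h => LexLT.asymm b a h) _ a b

theorem matricesGen_eq {n : ℕ} (h : k) (p : Matrix (Fin n) (Fin n) k)
    (hp : p.transpose = -p) (l m i j : Fin n) :
    matricesGen (h + h) p (l, m) (i, j) =
      (C (p l i) + C (p j m) + C h * (sg _ l i - sg _ m j)) * X (l, m) * X (i, j) +
        C h * (sg _ l i + sg _ m j) * X (i, m) * X (l, j) := by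
  have e1 := skew_apply hp i l
  have e2 := skew_apply hp m j
  have e3 := diag_zero hp
  unfold matricesGen skewExtend LexLT sg
  dsimp only
  rcases lt_trichotomy l i with h1 | rfl | h1 <;> rcases lt_trichotomy m j with h2 | rfl | h2 <;>
    simp [*, not_lt_of_gt, LT.lt.ne'] <;> ring

theorem matricesGen_jac {n : ℕ} (lam : k) (p : Matrix (Fin n) (Fin n) k)
    (hp : p.transpose = -p) (a b c : Fin n × Fin n) :
    jac (polyBider (matricesGen lam p)) (X a) (X b) (X c) = 0 := by
  obtain ⟨h, rfl⟩ : ∃ h, lam = h + h := ⟨lam / 2, (add_halves lam).symm⟩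
  obtain ⟨l, m⟩ := a
  obtain ⟨i, j⟩ := b
  obtain ⟨r, s⟩ := c
  simp only [jac, polyBider_X, matricesGen_eq h p hp, Derivation.leibniz, map_add, map_sub,
    MvPolynomial.derivation_C, der_sg, smul_eq_mul, mul_zero, add_zero, sub_zero]
  have h1 := sg_cyc l i r (C h ^ 2 * (X (l, j) * X (i, s) * X (r, m) -
    X (l, s) * X (i, m) * X (r, j)) : MvPolynomial (Fin n × Fin n) k)
    (by rintro rfl rfl; ring)
  have h2 := sg_cyc m j s (C h ^ 2 * (X (l, j) * X (i, s) * X (r, m) -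
    X (l, s) * X (i, m) * X (r, j)) : MvPolynomial (Fin n × Fin n) k)
    (by rintro rfl rfl; ring)
  rw [sg_skew _ i l, sg_skew _ r i, sg_skew _ r l, sg_skew _ j m, sg_skew _ s j, sg_skew _ s m,
    skew_apply hp i l, skew_apply hp r i, skew_apply hp r l, skew_apply hp j m, skew_apply hp s j,
    skew_apply hp s m] at *
  simp only [map_neg]
  linear_combination h2 - h1

/-- The indeterminates `y_{ij}`, `i ≤ j`, of symmetric `n × n` matrices, with `y_{ji} = y_{ij}`. -/
noncomputable def symY (k : Type*) [Field k] {n : ℕ} (i j : Fin n) :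
    MvPolynomial {a : Fin n × Fin n // a.1 ≤ a.2} k :=
  X ⟨(min i j, max i j), min_le_max⟩

theorem symY_comm (k : Type*) [Field k] {n : ℕ} (i j : Fin n) : symY k i j = symY k j i := by
  simp only [symY, min_comm, max_comm]

theorem symY_of_le (k : Type*) [Field k] (n : ℕ) (a : {a : Fin n × Fin n // a.1 ≤ a.2}) :
    symY k a.1.1 a.1.2 = X a := by
  simp only [symY, min_eq_left a.2, max_eq_right a.2]

/-- The bracket `{y_{ij}, y_{lm}}` of the semiclassical limit of quantum symmetric matrices. -/
noncomputable def symGen (k : Type*) [Field k] (n : ℕ) (a b : {a : Fin n × Fin n // a.1 ≤ a.2}) :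
    MvPolynomial {a : Fin n × Fin n // a.1 ≤ a.2} k :=
  let i := a.1.1
  let j := a.1.2
  let l := b.1.1
  let m := b.1.2
  (sg _ l j + sg _ m i) * symY k i l * symY k j m + (sg _ l i + sg _ m j) * symY k i m * symY k j l

theorem symGen_eq (k : Type*) [Field k] {n : ℕ} (i j l m : Fin n) :
    polyBider (symGen k n) (symY k i j) (symY k l m) =
      (sg _ l j + sg _ m i) * symY k i l * symY k j m +
        (sg _ l i + sg _ m j) * symY k i m * symY k j l := by
  have key : ∀ i j l m : Fin n, i ≤ j → l ≤ m →
      polyBider (symGen k n) (symY k i j) (symY k l m) =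
      (sg _ l j + sg _ m i) * symY k i l * symY k j m +
        (sg _ l i + sg _ m j) * symY k i m * symY k j l := by
    intro i j l m h1 h2
    have := polyBider_X (symGen k n) ⟨(i, j), h1⟩ ⟨(l, m), h2⟩
    rwa [← symY_of_le, ← symY_of_le] at this
  rcases le_total i j with h1 | h1 <;> rcases le_total l m with h2 | h2
  · exact key i j l m h1 h2
  · rw [symY_comm k l m, key i j m l h1 h2]; ring
  · rw [symY_comm k i j, key j i l m h1 h2]; ring
  · rw [symY_comm k i j, symY_comm k l m, key j i m l h1 h2]; ring

theorem symGen_skew (k : Type*) [Field k] {n : ℕ} (a b : {a : Fin n × Fin n // a.1 ≤ a.2}) :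
    symGen k n a b = -symGen k n b a := by
  obtain ⟨⟨i, j⟩, h1⟩ := a
  obtain ⟨⟨l, m⟩, h2⟩ := b
  simp only [symGen]
  rw [sg_skew _ l j, sg_skew _ m i, sg_skew _ l i, sg_skew _ m j, symY_comm k l i, symY_comm k m j,
    symY_comm k l j, symY_comm k m i]
  ring

theorem symGen_jac (k : Type*) [Field k] {n : ℕ} (a b c : {a : Fin n × Fin n // a.1 ≤ a.2}) :
    jac (polyBider (symGen k n)) (X a) (X b) (X c) = 0 := by
  rw [← symY_of_le k n a, ← symY_of_le k n b, ← symY_of_le k n c]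
  obtain ⟨⟨i, j⟩, h1⟩ := a
  obtain ⟨⟨l, m⟩, h2⟩ := b
  obtain ⟨⟨r, s⟩, h3⟩ := c
  have cert : ∀ x x' y y' z z' : Fin n, _ := fun x x' y y' z z' => sg_cyc x y z
    (symY k x y' * symY k y z' * symY k z x' - symY k x z' * symY k y x' * symY k z y')
    (by rintro rfl rfl; ring)
  have c1 := cert i j l m r s
  have c2 := cert i j l m s r
  have c3 := cert i j m l r s
  have c4 := cert i j m l s r
  have c5 := cert j i l m r s
  have c6 := cert j i l m s r
  have c7 := cert j i m l r s
  have c8 := cert j i m l s r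
  simp only [jac, symGen_eq, Derivation.leibniz, map_add, der_sg, smul_eq_mul, mul_zero, add_zero]
  rw [sg_skew _ l i, sg_skew _ l j, sg_skew _ m i, sg_skew _ m j, sg_skew _ r i, sg_skew _ r j,
    sg_skew _ s i, sg_skew _ s j, sg_skew _ r l, sg_skew _ r m, sg_skew _ s l, sg_skew _ s m,
    symY_comm k l i, symY_comm k l j, symY_comm k m i, symY_comm k m j, symY_comm k r i,
    symY_comm k r j, symY_comm k s i, symY_comm k s j, symY_comm k r l, symY_comm k r m,
    symY_comm k s l, symY_comm k s m] at *
  linear_combination -(c1 + c2 + c3 + c4 + c5 + c6 + c7 + c8)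

/-- The indeterminates `y_{ij}`, `i < j`, of antisymmetric `n × n` matrices, with
`y_{ji} = -y_{ij}` and `y_{ii} = 0`. -/
noncomputable def altY (k : Type*) [Field k] {n : ℕ} (i j : Fin n) :
    MvPolynomial {a : Fin n × Fin n // a.1 < a.2} k :=
  if h : i < j then X ⟨(i, j), h⟩ else if h : j < i then -X ⟨(j, i), h⟩ else 0

theorem altY_comm (k : Type*) [Field k] {n : ℕ} (i j : Fin n) : altY k i j = -altY k j i := by
  unfold altY
  rcases lt_trichotomy i j with h | h | h
  · simp [h, h.not_gt]
  · simp [h]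
  · simp [h, h.not_gt]

theorem altY_of_lt (k : Type*) [Field k] (n : ℕ) (a : {a : Fin n × Fin n // a.1 < a.2}) :
    altY k a.1.1 a.1.2 = X a := by
  rw [altY, dif_pos a.2]

theorem altY_self (k : Type*) [Field k] {n : ℕ} (i : Fin n) : altY k i i = 0 := by
  simp [altY]

/-- The bracket `{y_{ij}, y_{lm}}` of the semiclassical limit of quantum antisymmetric matrices. -/
noncomputable def altGen (k : Type*) [Field k] (n : ℕ) (a b : {a : Fin n × Fin n // a.1 < a.2}) :
    MvPolynomial {a : Fin n × Fin n // a.1 < a.2} k :=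
  let i := a.1.1
  let j := a.1.2
  let l := b.1.1
  let m := b.1.2
  (sg _ l j + sg _ m i) * altY k i l * altY k j m - (sg _ l i + sg _ m j) * altY k i m * altY k j l

theorem altGen_eq (k : Type*) [Field k] {n : ℕ} (i j l m : Fin n) :
    polyBider (altGen k n) (altY k i j) (altY k l m) =
      (sg _ l j + sg _ m i) * altY k i l * altY k j m -
        (sg _ l i + sg _ m j) * altY k i m * altY k j l := by
  have key : ∀ i j l m : Fin n, i < j → l < m →
      polyBider (altGen k n) (altY k i j) (altY k l m) =
      (sg _ l j + sg _ m i) * altY k i l * altY k j m -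
        (sg _ l i + sg _ m j) * altY k i m * altY k j l := by
    intro i j l m h1 h2
    have := polyBider_X (altGen k n) ⟨(i, j), h1⟩ ⟨(l, m), h2⟩
    rwa [← altY_of_lt, ← altY_of_lt] at this
  rcases lt_trichotomy i j with h1 | rfl | h1
  · rcases lt_trichotomy l m with h2 | rfl | h2
    · exact key i j l m h1 h2
    · rw [altY_self k l, map_zero]; ring
    · rw [altY_comm k l m, map_neg, key i j m l h1 h2]; ring
  · rw [altY_self k i, map_zero, Derivation.zero_apply]; ring
  · rcases lt_trichotomy l m with h2 | rfl | h2
    · rw [altY_comm k i j, map_neg, Derivation.neg_apply, key j i l m h1 h2]; ring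
    · rw [altY_self k l, map_zero]; ring
    · rw [altY_comm k i j, altY_comm k l m, map_neg, map_neg, Derivation.neg_apply,
        key j i m l h1 h2]
      ring

theorem altGen_skew (k : Type*) [Field k] {n : ℕ} (a b : {a : Fin n × Fin n // a.1 < a.2}) :
    altGen k n a b = -altGen k n b a := by
  obtain ⟨⟨i, j⟩, h1⟩ := a
  obtain ⟨⟨l, m⟩, h2⟩ := b
  simp only [altGen]
  rw [sg_skew _ l j, sg_skew _ m i, sg_skew _ l i, sg_skew _ m j, altY_comm k l i, altY_comm k m j,
    altY_comm k l j, altY_comm k m i]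
  ring

theorem altGen_jac (k : Type*) [Field k] {n : ℕ} (a b c : {a : Fin n × Fin n // a.1 < a.2}) :
    jac (polyBider (altGen k n)) (X a) (X b) (X c) = 0 := by
  rw [← altY_of_lt k n a, ← altY_of_lt k n b, ← altY_of_lt k n c]
  obtain ⟨⟨i, j⟩, h1⟩ := a
  obtain ⟨⟨l, m⟩, h2⟩ := b
  obtain ⟨⟨r, s⟩, h3⟩ := c
  have cert : ∀ x x' y y' z z' : Fin n, _ := fun x x' y y' z z' => sg_cyc x y z
    (altY k x y' * altY k y z' * altY k z x' - altY k x z' * altY k y x' * altY k z y')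
    (by rintro rfl rfl; ring)
  have c1 := cert i j l m r s
  have c2 := cert i j l m s r
  have c3 := cert i j m l r s
  have c4 := cert i j m l s r
  have c5 := cert j i l m r s
  have c6 := cert j i l m s r
  have c7 := cert j i m l r s
  have c8 := cert j i m l s r
  simp only [jac, altGen_eq, Derivation.leibniz, map_add, map_sub, der_sg, smul_eq_mul, mul_zero,
    add_zero]
  rw [sg_skew _ l i, sg_skew _ l j, sg_skew _ m i, sg_skew _ m j, sg_skew _ r i, sg_skew _ r j,
    sg_skew _ s i, sg_skew _ s j, sg_skew _ r l, sg_skew _ r m, sg_skew _ s l, sg_skew _ s m,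
    altY_comm k l i, altY_comm k l j, altY_comm k m i, altY_comm k m j, altY_comm k r i,
    altY_comm k r j, altY_comm k s i, altY_comm k s j, altY_comm k r l, altY_comm k r m,
    altY_comm k s l, altY_comm k s m] at *
  linear_combination -(c1 - c2 - c3 + c4 - c5 + c6 + c7 - c8)

theorem jac_self {R A : Type*} [CommRing R] [CommRing A] [Algebra R A]
    (D : Derivation R A (Derivation R A A)) (alt : ∀ a, D a a = 0) (a c : A) :
    jac D a a c = 0 := by
  rw [jac, alt, bider_skew D alt c a]
  simp

theorem jac_cyc {R A : Type*} [CommRing R] [CommRing A] [Algebra R A]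
    (D : Derivation R A (Derivation R A A)) (a b c : A) : jac D a b c = jac D b c a := by
  simp only [jac]; ring

/-- The Jacobi identity on generators for the brackets of quantum euclidean type. -/
theorem euclid_jac {A : Type*} [CommRing A] [Algebra k A] (D : Derivation k A (Derivation k A A))
    (alt : ∀ a, D a a = 0) {n : ℕ} (Γ : Matrix (Fin n) (Fin n) k) (hΓ : Γ.transpose = -Γ)
    (p q : Fin n → k) (lam : k) (x y : Fin n → A) (z : A)
    (hzx : ∀ i, D z (x i) = algebraMap k A (-(p i / 2)) * z * x i)
    (hzy : ∀ i, D z (y i) = algebraMap k A (p i / 2) * z * y i)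
    (hyy : ∀ i j, D (y i) (y j) = algebraMap k A (Γ i j) * y i * y j)
    (hlt : ∀ i j, i < j → D (x i) (y j) = algebraMap k A (p j + Γ j i) * x i * y j)
    (hgt : ∀ i j, j < i → D (x i) (y j) = algebraMap k A (q j + Γ j i) * x i * y j)
    (hxx : ∀ i j, i < j → D (x i) (x j) = algebraMap k A (q i - p j + Γ i j) * x i * x j)
    (hxy : ∀ i, D (x i) (y i) = algebraMap k A (q i) * x i * y i +
      (∑ l with l < i, algebraMap k A (q l - p l) * x l * y l) + algebraMap k A lam * z ^ 2)
    (a b c : A) (ha : a = z ∨ a ∈ Set.range x ∨ a ∈ Set.range y)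
    (hb : b = z ∨ b ∈ Set.range x ∨ b ∈ Set.range y)
    (hc : c = z ∨ c ∈ Set.range x ∨ c ∈ Set.range y) : jac D a b c = 0 := by
  have sk := bider_skew D alt
  set Om : ℕ → A := fun i => (∑ l : Fin n with l.val < i, algebraMap k A (q l - p l) * x l * y l) +
    algebraMap k A lam * z ^ 2 with hOm
  have Om0 : Om 0 = algebraMap k A lam * z ^ 2 := by simp [hOm]
  have OmS : ∀ i : Fin n, Om (i.val + 1) = Om i.val + algebraMap k A (q i - p i) * x i * y i := by
    intro i
    have : (Finset.univ.filter fun l : Fin n => l.val < i.val + 1) =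
        insert i (Finset.univ.filter fun l : Fin n => l.val < i.val) := by
      ext l
      simp only [Finset.mem_filter, Finset.mem_univ, true_and, Finset.mem_insert, Fin.ext_iff]
      omega
    simp only [hOm]
    rw [this, Finset.sum_insert (by simp)]
    ring
  have hxy' : ∀ i, D (x i) (y i) = algebraMap k A (q i) * x i * y i + Om i.val := by
    intro i
    rw [hxy, add_assoc]
    rfl
  have hgΓ : ∀ i j, algebraMap k A (Γ i j) = -algebraMap k A (Γ j i) := fun i j => by
    rw [skew_apply hΓ i j, map_neg]
  have hh : ∀ i, algebraMap k A (p i) = 2 * algebraMap k A (p i / 2) := fun i => by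
    rw [← map_ofNat (algebraMap k A) 2, ← map_mul]; congr 1; ring
  have hxz : ∀ i, D (x i) z = algebraMap k A (p i / 2) * z * x i := fun i => by
    rw [sk, hzx, map_neg]; ring
  have hyz : ∀ i, D (y i) z = -algebraMap k A (p i / 2) * z * y i := fun i => by
    rw [sk, hzy]; ring
  have hyx : ∀ i, D (y i) (x i) = -(algebraMap k A (q i) * x i * y i + Om i.val) := fun i => by
    rw [sk, hxy']
  -- brackets with the sums
  have zOm : ∀ i, i ≤ n → D z (Om i) = 0 := by
    intro i
    induction i with
    | zero => intro _; simp [Om0, alt, pow_two]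
    | succ i ih =>
      intro hi
      have := OmS ⟨i, hi⟩
      simp only at this
      rw [this, map_add, ih (by omega)]
      simp only [Derivation.leibniz, Derivation.map_algebraMap, hzx, hzy, smul_eq_mul, map_neg]
      ring
  have xOm : ∀ (j : Fin n) (i : ℕ), i ≤ n → D (x j) (Om i) =
      algebraMap k A (if i ≤ j.val then p j else q j) * Om i * x j := by
    intro j i
    induction i with
    | zero =>
      intro _
      simp only [Om0, zero_le, if_true, Derivation.leibniz, Derivation.map_algebraMap, pow_two,
        hxz, smul_eq_mul, hh]
      ring
    | succ i ih =>
      intro hi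
      have := OmS ⟨i, hi⟩
      simp only at this
      rw [this, map_add, ih (by omega)]
      simp only [Derivation.leibniz, Derivation.map_algebraMap, smul_eq_mul]
      rcases lt_trichotomy i j.val with h | h | h
      · have h' : (⟨i, hi⟩ : Fin n) < j := h
        rw [hgt j ⟨i, hi⟩ h', sk (x j), hxx ⟨i, hi⟩ j h', if_pos h.le, if_pos (by omega)]
        simp only [map_add, map_sub]
        ring
      · obtain rfl : j = ⟨i, hi⟩ := Fin.ext h.symm
        rw [hxy', alt, if_pos (by simp), if_neg (by simp)]
        simp only [map_sub]
        ring
      · have h' : j < (⟨i, hi⟩ : Fin n) := h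
        rw [hlt j ⟨i, hi⟩ h', hxx j ⟨i, hi⟩ h', if_neg (by omega), if_neg (by omega)]
        simp only [map_add, map_sub]
        rw [hgΓ j ⟨i, hi⟩]
        ring
  have yOm : ∀ (j : Fin n) (i : ℕ), i ≤ n → D (y j) (Om i) =
      -algebraMap k A (if i ≤ j.val then p j else q j) * Om i * y j := by
    intro j i
    induction i with
    | zero =>
      intro _
      simp only [Om0, zero_le, if_true, Derivation.leibniz, Derivation.map_algebraMap, pow_two,
        hyz, smul_eq_mul, hh]
      ring
    | succ i ih =>
      intro hi
      have := OmS ⟨i, hi⟩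
      simp only at this
      rw [this, map_add, ih (by omega)]
      simp only [Derivation.leibniz, Derivation.map_algebraMap, smul_eq_mul]
      rcases lt_trichotomy i j.val with h | h | h
      · have h' : (⟨i, hi⟩ : Fin n) < j := h
        rw [hyy, sk (y j), hlt ⟨i, hi⟩ j h', if_pos h.le, if_pos (by omega)]
        simp only [map_add]
        ring
      · obtain rfl : j = ⟨i, hi⟩ := Fin.ext h.symm
        rw [hyx, alt, if_pos (by simp), if_neg (by simp)]
        simp only [map_sub]
        ring
      · have h' : j < (⟨i, hi⟩ : Fin n) := h
        rw [hyy, sk (y j) (x _), hgt ⟨i, hi⟩ j h', if_neg (by omega), if_neg (by omega)]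
        simp only [map_add]
        ring
  -- uniform form of the quadratic brackets
  obtain ⟨ξ, m, hξ, hξs, hξ1, hm, hm1, r1, r2⟩ : ∃ ξ m : Fin n → Fin n → A,
      (∀ i j, D (x i) (x j) = ξ i j * x i * x j) ∧ (∀ i j, ξ i j = -ξ j i) ∧
      (∀ i j, ∃ c : k, ξ i j = algebraMap k A c) ∧
      (∀ i j, i ≠ j → D (x i) (y j) = m i j * x i * y j) ∧
      (∀ i j, ∃ c : k, m i j = algebraMap k A c) ∧
      (∀ i j, i ≠ j → algebraMap k A (if i.val ≤ j.val then p j else q j) = m j i - ξ i j) ∧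
      (∀ i j, i ≠ j → algebraMap k A (if i.val ≤ j.val then p j else q j) =
        m i j + algebraMap k A (Γ i j)) := by
    refine ⟨fun i j => algebraMap k A (if i < j then q i - p j + Γ i j else
      if j < i then -(q j - p i + Γ j i) else 0),
      fun i j => algebraMap k A (if i < j then p j + Γ j i else q j + Γ j i),
      ?_, ?_, fun i j => ⟨_, rfl⟩, ?_, fun i j => ⟨_, rfl⟩, ?_, ?_⟩
    · intro i j
      rcases lt_trichotomy i j with h | rfl | h
      · simp only [h, if_true, hxx i j h]
      · simp [alt]
      · simp only [h, h.not_gt, if_true, if_false, sk (x i), hxx j i h, map_neg]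
        ring
    · intro i j
      rcases lt_trichotomy i j with h | rfl | h
      · simp [h, h.not_gt]
      · simp
      · simp [h, h.not_gt]
    · intro i j hij
      rcases lt_or_gt_of_ne hij with h | h
      · simp only [h, if_true, hlt i j h]
      · simp only [h.not_gt, if_false, hgt i j h]
    · intro i j hij
      rcases lt_or_gt_of_ne hij with h | h
      · simp only [h, h.not_gt, if_true, if_false, Fin.val_fin_le.mpr h.le, map_add, map_sub]
        ring
      · have : ¬ i.val ≤ j.val := by simpa using h
        simp only [h, h.not_gt, if_true, if_false, this, map_add, map_sub, map_neg, hgΓ i j]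
        ring
    · intro i j hij
      rcases lt_or_gt_of_ne hij with h | h
      · simp only [h, if_true, Fin.val_fin_le.mpr h.le, map_add, hgΓ i j]
        ring
      · have : ¬ i.val ≤ j.val := by simpa using h
        simp only [h.not_gt, if_false, this, map_add, hgΓ i j]
        ring
  have ξd : ∀ (d : Derivation k A A) i j, d (ξ i j) = 0 := fun d i j => by
    obtain ⟨c, hc⟩ := hξ1 i j
    rw [hc, Derivation.map_algebraMap]
  have md : ∀ (d : Derivation k A A) i j, d (m i j) = 0 := fun d i j => by
    obtain ⟨c, hc⟩ := hm1 i j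
    rw [hc, Derivation.map_algebraMap]
  have hm' : ∀ i j, i ≠ j → D (y j) (x i) = -(m i j * x i * y j) := fun i j h => by
    rw [sk, hm i j h]
  have cyc := jac_cyc D
  have sw := jac_swap D alt
  have sf := jac_self D alt
  have xxx : ∀ i j r, jac D (x i) (x j) (x r) = 0 := fun i j r => by
    simp only [jac, hξ, Derivation.leibniz, ξd, smul_eq_mul]
    rw [hξs j i, hξs r j, hξs r i]
    ring
  have yyy : ∀ i j r, jac D (y i) (y j) (y r) = 0 := fun i j r => by
    simp only [jac, hyy, Derivation.leibniz, Derivation.map_algebraMap, smul_eq_mul]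
    rw [hgΓ j i, hgΓ r j, hgΓ r i]
    ring
  have xxy0 : ∀ i j, i ≠ j → jac D (x i) (x j) (y i) = 0 := fun i j h => by
    simp only [jac, hm j i h.symm, hyx, hξ, Derivation.leibniz, ξd, md, Derivation.map_algebraMap,
      smul_eq_mul, map_neg, map_add, hxy', hm' j i h.symm, xOm j i.val i.2.le]
    rw [r1 i j h, hξs j i]
    ring
  have yyx0 : ∀ i j, i ≠ j → jac D (y i) (y j) (x i) = 0 := fun i j h => by
    simp only [jac, hm i j h, hm' i j h, hxy', hyx, hyy, Derivation.leibniz, md,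
      Derivation.map_algebraMap, smul_eq_mul, map_neg, map_add, yOm j i.val i.2.le]
    rw [r2 i j h, hgΓ j i]
    ring
  have xxy : ∀ i j r, jac D (x i) (x j) (y r) = 0 := fun i j r => by
    by_cases h : i = j
    · rw [h, sf]
    by_cases h1 : i = r
    · rw [← h1, xxy0 i j h]
    by_cases h2 : j = r
    · rw [← h2, sw, xxy0 j i (Ne.symm h), neg_zero]
    simp only [jac, hm j r h2, hm i r h1, hm' j r h2, hm' i r h1, hξ, Derivation.leibniz, ξd, md,
      smul_eq_mul, map_neg]
    rw [hξs j i]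
    ring
  have yyx : ∀ i j r, jac D (y i) (y j) (x r) = 0 := fun i j r => by
    by_cases h : i = j
    · rw [h, sf]
    by_cases h1 : i = r
    · rw [← h1, yyx0 i j h]
    by_cases h2 : j = r
    · rw [← h2, sw, yyx0 j i (Ne.symm h), neg_zero]
    have h1' := Ne.symm h1
    have h2' := Ne.symm h2
    simp only [jac, hm r j h2', hm r i h1', hm' r j h2', hm' r i h1', hyy, Derivation.leibniz, md,
      Derivation.map_algebraMap, smul_eq_mul, map_neg]
    rw [hgΓ j i]
    ring
  have zxx : ∀ i j, jac D z (x i) (x j) = 0 := fun i j => by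
    simp only [jac, hξ, hzx, hxz, Derivation.leibniz, ξd, Derivation.map_algebraMap, smul_eq_mul,
      map_neg]
    rw [hξs j i]
    ring
  have zyy : ∀ i j, jac D z (y i) (y j) = 0 := fun i j => by
    simp only [jac, hyy, hzy, hyz, Derivation.leibniz, Derivation.map_algebraMap, smul_eq_mul,
      map_neg]
    rw [hgΓ j i]
    ring
  have zxy : ∀ i j, jac D z (x i) (y j) = 0 := fun i j => by
    by_cases h : i = j
    · subst h
      simp only [jac, hxy', hyx, hzx, hzy, hxz, hyz, Derivation.leibniz, Derivation.map_algebraMap,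
        smul_eq_mul, map_neg, map_add, zOm i.val i.2.le]
      ring
    · simp only [jac, hm i j h, hm' i j h, hzx, hzy, hxz, hyz, Derivation.leibniz, md,
        Derivation.map_algebraMap, smul_eq_mul, map_neg]
      ring
  rcases ha with rfl | ⟨i, rfl⟩ | ⟨i, rfl⟩ <;> rcases hb with rfl | ⟨j, rfl⟩ | ⟨j, rfl⟩ <;>
    rcases hc with rfl | ⟨r, rfl⟩ | ⟨r, rfl⟩
  · exact sf _ _
  · exact sf _ _
  · exact sf _ _
  · rw [cyc, cyc, sf]
  · exact zxx _ _
  · exact zxy _ _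
  · rw [cyc, cyc, sf]
  · rw [cyc, sw, cyc, cyc, zxy, neg_zero]
  · exact zyy _ _
  · rw [cyc, sf]
  · rw [cyc, zxx]
  · rw [sw, zxy, neg_zero]
  · rw [cyc, cyc, zxx]
  · exact xxx _ _ _
  · exact xxy _ _ _
  · rw [cyc, cyc, zxy]
  · rw [cyc, cyc, xxy]
  · rw [cyc, yyx]
  · rw [cyc, sf]
  · rw [cyc, zxy]
  · rw [cyc, zyy]
  · rw [sw, cyc, cyc, zxy, neg_zero]
  · rw [cyc, xxy]
  · rw [cyc, cyc, yyx]
  · rw [cyc, cyc, zyy]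
  · exact yyx _ _ _
  · exact yyy _ _ _

/-- The bracket on the generators `x_i = inl i`, `y_i = inr i` of the Horton-Oh algebra
`A^{P,Q}_{n,Γ}(k)`. -/
noncomputable def evenGen {n : ℕ} (Γ : Matrix (Fin n) (Fin n) k) (p q : Fin n → k) :
    Fin n ⊕ Fin n → Fin n ⊕ Fin n → MvPolynomial (Fin n ⊕ Fin n) k :=
  let x : Fin n → MvPolynomial (Fin n ⊕ Fin n) k := fun i => X (.inl i)
  let y : Fin n → MvPolynomial (Fin n ⊕ Fin n) k := fun i => X (.inr i)
  let xy : Fin n → Fin n → MvPolynomial (Fin n ⊕ Fin n) k := fun i j =>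
    if i < j then C (p j + Γ j i) * x i * y j
    else if j < i then C (q j + Γ j i) * x i * y j
    else C (q i) * x i * y i + ∑ l with l < i, C (q l - p l) * x l * y l
  fun
  | .inr i, .inr j => C (Γ i j) * y i * y j
  | .inl i, .inr j => xy i j
  | .inr j, .inl i => -xy i j
  | .inl i, .inl j => skewExtend (· < ·) (fun i j => C (q i - p j + Γ i j) * x i * x j) i j

theorem evenGen_self {n : ℕ} {Γ : Matrix (Fin n) (Fin n) k} (hΓ : Γ.transpose = -Γ)
    (p q : Fin n → k) (a : Fin n ⊕ Fin n) : evenGen Γ p q a a = 0 := by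
  rcases a with i | i
  · simp only [evenGen]
    exact skewExtend_self (G := MvPolynomial _ k) (fun i j : Fin n => i < j) (fun _ _ => lt_asymm) _ i
  · simp [evenGen, diag_zero hΓ]

theorem evenGen_skew {k : Type*} [Field k] {n : ℕ} {Γ : Matrix (Fin n) (Fin n) k} (hΓ : Γ.transpose = -Γ)
    (p q : Fin n → k) (a b : Fin n ⊕ Fin n) : evenGen Γ p q a b = -evenGen Γ p q b a := by
  rcases a with i | i <;> rcases b with j | j
  · simp only [evenGen]
    exact skewExtend_skew (G := MvPolynomial _ k) (fun i j : Fin n => i < j) (fun _ _ => lt_asymm) _ i j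
  · exact (neg_neg _).symm
  · rfl
  · simp only [evenGen, skew_apply hΓ i j, map_neg]
    ring

theorem evenGen_jac {n : ℕ} {Γ : Matrix (Fin n) (Fin n) k} (hΓ : Γ.transpose = -Γ)
    (p q : Fin n → k) (a b c : Fin n ⊕ Fin n) :
    jac (polyBider (evenGen Γ p q)) (X a) (X b) (X c) = 0 := by
  have mem : ∀ a : Fin n ⊕ Fin n, (X a : MvPolynomial (Fin n ⊕ Fin n) k) = 0 ∨
      (X a : MvPolynomial (Fin n ⊕ Fin n) k) ∈
        Set.range (fun i : Fin n => (X (.inl i) : MvPolynomial (Fin n ⊕ Fin n) k)) ∨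
      (X a : MvPolynomial (Fin n ⊕ Fin n) k) ∈
        Set.range (fun i : Fin n => (X (.inr i) : MvPolynomial (Fin n ⊕ Fin n) k)) := by
    rintro (i | i)
    · exact .inr (.inl ⟨i, rfl⟩)
    · exact .inr (.inr ⟨i, rfl⟩)
  refine euclid_jac (polyBider (evenGen Γ p q))
    (polyBider_alt _ (evenGen_self hΓ p q) (evenGen_skew hΓ p q)) Γ hΓ p q 0
    (fun i => X (.inl i)) (fun i => X (.inr i)) 0 (by simp) (by simp) ?_ ?_ ?_ ?_ ?_ _ _ _
    (mem a) (mem b) (mem c)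
  · intro i j; rw [polyBider_X]; rfl
  · intro i j h; rw [polyBider_X]; simp [evenGen, h]
  · intro i j h; rw [polyBider_X]; simp [evenGen, h, h.not_gt]
  · intro i j h; rw [polyBider_X]; simp [evenGen, skewExtend, h]
  · intro i; rw [polyBider_X]; simp [evenGen]

/-- The bracket on the generators `z_0 = none`, `x_i = some (inl i)`, `y_i = some (inr i)` of the
semiclassical limit of odd-dimensional quantum euclidean spaces. -/
noncomputable def oddGen {n : ℕ} (Γ : Matrix (Fin n) (Fin n) k) (p q : Fin n → k) (lam : k) :
    Option (Fin n ⊕ Fin n) → Option (Fin n ⊕ Fin n) → MvPolynomial (Option (Fin n ⊕ Fin n)) k :=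
  let z : MvPolynomial (Option (Fin n ⊕ Fin n)) k := X none
  let x : Fin n → MvPolynomial (Option (Fin n ⊕ Fin n)) k := fun i => X (some (.inl i))
  let y : Fin n → MvPolynomial (Option (Fin n ⊕ Fin n)) k := fun i => X (some (.inr i))
  let xy : Fin n → Fin n → MvPolynomial (Option (Fin n ⊕ Fin n)) k := fun i j =>
    if i < j then C (p j + Γ j i) * x i * y j
    else if j < i then C (q j + Γ j i) * x i * y j
    else C (q i) * x i * y i + (∑ l with l < i, C (q l - p l) * x l * y l) + C lam * z ^ 2
  fun
  | none, none => 0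
  | none, some (.inl i) => C (-(p i / 2)) * z * x i
  | none, some (.inr i) => C (p i / 2) * z * y i
  | some (.inl i), none => -(C (-(p i / 2)) * z * x i)
  | some (.inr i), none => -(C (p i / 2) * z * y i)
  | some (.inr i), some (.inr j) => C (Γ i j) * y i * y j
  | some (.inl i), some (.inr j) => xy i j
  | some (.inr j), some (.inl i) => -xy i j
  | some (.inl i), some (.inl j) =>
    skewExtend (· < ·) (fun i j => C (q i - p j + Γ i j) * x i * x j) i j

theorem oddGen_self {n : ℕ} {Γ : Matrix (Fin n) (Fin n) k} (hΓ : Γ.transpose = -Γ)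
    (p q : Fin n → k) (lam : k) (a : Option (Fin n ⊕ Fin n)) : oddGen Γ p q lam a a = 0 := by
  rcases a with _ | i | i
  · rfl
  · simp only [oddGen]
    exact skewExtend_self (G := MvPolynomial _ k) (fun i j : Fin n => i < j) (fun _ _ => lt_asymm) _ i
  · simp [oddGen, diag_zero hΓ]

theorem oddGen_skew {k : Type*} [Field k] {n : ℕ} {Γ : Matrix (Fin n) (Fin n) k} (hΓ : Γ.transpose = -Γ)
    (p q : Fin n → k) (lam : k) (a b : Option (Fin n ⊕ Fin n)) :
    oddGen Γ p q lam a b = -oddGen Γ p q lam b a := by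
  rcases a with _ | i | i <;> rcases b with _ | j | j
  · exact neg_zero.symm
  · exact (neg_neg _).symm
  · exact (neg_neg _).symm
  · rfl
  · simp only [oddGen]
    exact skewExtend_skew (G := MvPolynomial _ k) (fun i j : Fin n => i < j) (fun _ _ => lt_asymm) _ i j
  · exact (neg_neg _).symm
  · rfl
  · rfl
  · simp only [oddGen, skew_apply hΓ i j, map_neg]
    ring

theorem oddGen_jac {n : ℕ} {Γ : Matrix (Fin n) (Fin n) k} (hΓ : Γ.transpose = -Γ)
    (p q : Fin n → k) (lam : k) (a b c : Option (Fin n ⊕ Fin n)) :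
    jac (polyBider (oddGen Γ p q lam)) (X a) (X b) (X c) = 0 := by
  have mem : ∀ a : Option (Fin n ⊕ Fin n),
      (X a : MvPolynomial (Option (Fin n ⊕ Fin n)) k) = X none ∨
      (X a : MvPolynomial (Option (Fin n ⊕ Fin n)) k) ∈ Set.range
        (fun i : Fin n => (X (some (.inl i)) : MvPolynomial (Option (Fin n ⊕ Fin n)) k)) ∨
      (X a : MvPolynomial (Option (Fin n ⊕ Fin n)) k) ∈ Set.range
        (fun i : Fin n => (X (some (.inr i)) : MvPolynomial (Option (Fin n ⊕ Fin n)) k)) := by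
    rintro (_ | i | i)
    · exact .inl rfl
    · exact .inr (.inl ⟨i, rfl⟩)
    · exact .inr (.inr ⟨i, rfl⟩)
  refine euclid_jac (polyBider (oddGen Γ p q lam))
    (polyBider_alt _ (oddGen_self hΓ p q lam) (oddGen_skew hΓ p q lam)) Γ hΓ p q lam
    (fun i => X (some (.inl i))) (fun i => X (some (.inr i))) (X none) ?_ ?_ ?_ ?_ ?_ ?_ ?_ _ _ _
    (mem a) (mem b) (mem c)
  · intro i; rw [polyBider_X]; rfl
  · intro i; rw [polyBider_X]; rfl
  · intro i j; rw [polyBider_X]; rfl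
  · intro i j h; rw [polyBider_X]; simp [oddGen, h]
  · intro i j h; rw [polyBider_X]; simp [oddGen, h, h.not_gt]
  · intro i j h; rw [polyBider_X]; simp [oddGen, skewExtend, h]
  · intro i; rw [polyBider_X]; simp [oddGen]

/-- The Poisson algebra `O(M_n(k))`, semiclassical limit of multiparameter quantum matrices. -/
noncomputable def matrices {n : ℕ} (lam : k) (p : Matrix (Fin n) (Fin n) k)
    (hp : p.transpose = -p) : PoissonBracket k (MvPolynomial (Fin n × Fin n) k) :=
  poly k (matricesGen lam p) (matricesGen_self lam p) (matricesGen_skew lam p)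
    (matricesGen_jac lam p hp)

/-- The Poisson algebra `A^{P,Q}_{n,Γ}(k)` on `k[x_1, y_1, …, x_n, y_n]`, semiclassical limit of
quantum symplectic and even-dimensional euclidean spaces. -/
noncomputable def evenEuclidean {n : ℕ} (Γ : Matrix (Fin n) (Fin n) k) (hΓ : Γ.transpose = -Γ)
    (p q : Fin n → k) : PoissonBracket k (MvPolynomial (Fin n ⊕ Fin n) k) :=
  poly k (evenGen Γ p q) (evenGen_self hΓ p q) (evenGen_skew hΓ p q) (evenGen_jac hΓ p q)

/-- The Poisson algebra on `k[z_0, x_1, y_1, …, x_n, y_n]`, semiclassical limit of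
odd-dimensional quantum euclidean spaces. -/
noncomputable def oddEuclidean {n : ℕ} (Γ : Matrix (Fin n) (Fin n) k) (hΓ : Γ.transpose = -Γ)
    (p q : Fin n → k) (lam : k) : PoissonBracket k (MvPolynomial (Option (Fin n ⊕ Fin n)) k) :=
  poly k (oddGen Γ p q lam) (oddGen_self hΓ p q lam) (oddGen_skew hΓ p q lam)
    (oddGen_jac hΓ p q lam)

/-- The Poisson algebra on `k[y_{ij} : i ≤ j]`, semiclassical limit of quantum symmetric
matrices. -/
noncomputable def symmetric (k : Type*) [Field k] [CharZero k] (n : ℕ) :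
    PoissonBracket k (MvPolynomial {a : Fin n × Fin n // a.1 ≤ a.2} k) :=
  poly k (symGen k n) (fun a => self_eq_neg.mp (symGen_skew k a a)) (symGen_skew k) (symGen_jac k)

/-- The Poisson algebra on `k[y_{ij} : i < j]`, semiclassical limit of quantum antisymmetric
matrices. -/
noncomputable def antisymmetric (k : Type*) [Field k] [CharZero k] (n : ℕ) :
    PoissonBracket k (MvPolynomial {a : Fin n × Fin n // a.1 < a.2} k) :=
  poly k (altGen k n) (fun a => self_eq_neg.mp (altGen_skew k a a)) (altGen_skew k) (altGen_jac k)

/-! The antisymmetric matrices `Λ` of the quadratic Poisson fields isomorphic to `Fract A`: the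
entry at `(s, t)` is the scalar with `{Y_s, Y_t} = Λ_{st} Y_s Y_t`. -/

def matricesField {n : ℕ} (lam : k) (p : Matrix (Fin n) (Fin n) k) :
    Matrix (Fin n × Fin n) (Fin n × Fin n) k :=
  Matrix.of <| skewExtend (fun a b => LexLT b a) fun (l, m) (i, j) =>
    if i ≤ l ∧ j < m then p l i + p j m else lam + p l i + p j m

theorem matricesField_skew {k : Type*} [Field k] {n : ℕ} (lam : k) (p : Matrix (Fin n) (Fin n) k) :
    (matricesField lam p).transpose = -matricesField lam p := by
  ext a b
  simp only [matricesField, Matrix.transpose_apply, Matrix.neg_apply, Matrix.of_apply]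
  exact skewExtend_skew (G := k) _ (fun a b h => LexLT.asymm b a h) _ b a

def evenField {n : ℕ} (Γ : Matrix (Fin n) (Fin n) k) (p q : Fin n → k) :
    Matrix (Fin n ⊕ Fin n) (Fin n ⊕ Fin n) k :=
  let vw : Fin n → Fin n → k := fun i j => if i < j then p j + Γ j i else q j + Γ j i
  Matrix.of fun
  | .inr i, .inr j => Γ i j
  | .inl i, .inr j => vw i j
  | .inr j, .inl i => -vw i j
  | .inl i, .inl j => skewExtend (· < ·) (fun i j => q i - p j + Γ i j) i j

theorem evenField_skew {k : Type*} [Field k] {n : ℕ} {Γ : Matrix (Fin n) (Fin n) k} (hΓ : Γ.transpose = -Γ)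
    (p q : Fin n → k) : (evenField Γ p q).transpose = -evenField Γ p q := by
  ext a b
  rcases a with i | i <;> rcases b with j | j
  · simp only [evenField, Matrix.transpose_apply, Matrix.neg_apply, Matrix.of_apply]
    exact skewExtend_skew (G := k) (fun i j : Fin n => i < j) (fun _ _ => lt_asymm) _ j i
  · rfl
  · exact (neg_neg _).symm
  · exact skew_apply hΓ j i

def oddField {n : ℕ} (Γ : Matrix (Fin n) (Fin n) k) (p q : Fin n → k) :
    Matrix (Option (Fin n ⊕ Fin n)) (Option (Fin n ⊕ Fin n)) k :=
  Matrix.of fun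
  | none, none => 0
  | none, some (.inl i) => -(p i / 2)
  | none, some (.inr i) => p i / 2
  | some (.inl i), none => p i / 2
  | some (.inr i), none => -(p i / 2)
  | some a, some b => evenField Γ p q a b

theorem oddField_skew {k : Type*} [Field k] {n : ℕ} {Γ : Matrix (Fin n) (Fin n) k} (hΓ : Γ.transpose = -Γ)
    (p q : Fin n → k) : (oddField Γ p q).transpose = -oddField Γ p q := by
  ext a b
  rcases a with _ | a <;> rcases b with _ | b
  · exact neg_zero.symm
  · rcases b with i | i
    · exact (neg_neg _).symm
    · rfl
  · rcases a with i | i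
    · rfl
    · exact (neg_neg _).symm
  · have := skew_apply (evenField_skew hΓ p q) b a
    rcases a with i | i <;> rcases b with j | j <;> exact this

def symmetricField (k : Type*) [Field k] (n : ℕ) :
    Matrix {a : Fin n × Fin n // a.1 ≤ a.2} {a : Fin n × Fin n // a.1 ≤ a.2} k :=
  Matrix.of <| skewExtend (fun a b => LexLT a.1 b.1) fun ⟨(i, j), _⟩ ⟨(l, m), _⟩ =>
    if (i = l ∧ l < j ∧ j < m) ∨ (i < l ∧ l < j ∧ j = m) ∨ (i < j ∧ j = l ∧ l < m) then 1
    else if (i = j ∧ j = l ∧ l < m) ∨ (i < j ∧ j = l ∧ l = m) then 2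
    else 0

theorem symmetricField_skew (k : Type*) [Field k] (n : ℕ) :
    (symmetricField k n).transpose = -symmetricField k n := by
  ext a b
  simp only [symmetricField, Matrix.transpose_apply, Matrix.neg_apply, Matrix.of_apply]
  exact skewExtend_skew (G := k) _ (fun a b h => LexLT.asymm a.1 b.1 h) _ b a

def antisymmetricField (k : Type*) [Field k] (n : ℕ) :
    Matrix {a : Fin n × Fin n // a.1 < a.2} {a : Fin n × Fin n // a.1 < a.2} k :=
  Matrix.of <| skewExtend (fun a b => LexLT a.1 b.1) fun ⟨(i, j), _⟩ ⟨(l, m), _⟩ =>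
    if (({i, j} : Finset (Fin n)) ∩ {l, m}).card = 1 then 1 else 0

theorem antisymmetricField_skew (k : Type*) [Field k] (n : ℕ) :
    (antisymmetricField k n).transpose = -antisymmetricField k n := by
  ext a b
  simp only [antisymmetricField, Matrix.transpose_apply, Matrix.neg_apply, Matrix.of_apply]
  exact skewExtend_skew (G := k) _ (fun a b h => LexLT.asymm a.1 b.1 h) _ b a

end Families

/-- Isomorphism of Poisson `k`-algebras. -/
def Isomorphic {k A B : Type*} [CommRing k] [CommRing A] [CommRing B] [Algebra k A] [Algebra k B]
    (π : PoissonBracket k A) (ρ : PoissonBracket k B) : Prop :=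
  ∃ e : A ≃ₐ[k] B, ∀ a b, e (π.bracket a b) = ρ.bracket (e a) (e b)

theorem isPoissonIdeal_bot {k A : Type*} [CommRing k] [CommRing A] [Algebra k A]
    (π : PoissonBracket k A) : π.IsPoissonIdeal ⊥ := by
  intro a b hb
  rw [Ideal.mem_bot] at hb ⊢
  rw [hb, map_zero]

/-- For every Poisson prime `P` of `A`, the Poisson field `Fract (A/P)` is isomorphic to
`K_μ(y_1, …, y_m)` for some field extension `K` of `k` and some antisymmetric `μ` over `k`; for
`P = 0` this holds with `K = k` and `m = tr.deg A`; and `Fract A` is isomorphic to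
`k_Λ(y_s : s ∈ σ)`. -/
def QuadraticGelfandKirillov {k A : Type u} [Field k] [CharZero k] [CommRing A] [Algebra k A]
    (π : PoissonBracket k A) {σ : Type} (Λ : Matrix σ σ k) (hΛ : Λ.transpose = -Λ) : Prop :=
  (∀ (P : Ideal A) (_ : P.IsPrime) (hP : π.IsPoissonIdeal P),
    ∃ (K : Type u) (_ : Field K) (_ : Algebra k K) (m : ℕ) (μ : Matrix (Fin m) (Fin m) k)
      (hμ : μ.transpose = -μ),
      Isomorphic (π.quotient P hP).fraction (quadratic K μ hμ).fraction) ∧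
  (∃ (m : ℕ) (μ : Matrix (Fin m) (Fin m) k) (hμ : μ.transpose = -μ),
    Algebra.trdeg k A = m ∧
    Isomorphic (π.quotient ⊥ π.isPoissonIdeal_bot).fraction (quadratic k μ hμ).fraction) ∧
  Isomorphic π.fraction (quadratic k Λ hΛ).fraction

end PoissonBracket

/-! Each of these algebras is an iterated Poisson-Ore extension: in a suitable order of the
indeterminates, {X_t, X_i} = Λ_{ti} X_t X_i + δ_t(X_i) whenever X_i precedes X_t, where δ_t is a
locally nilpotent derivation of the polynomial ring in the indeterminates before X_t. Moreover δ_t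
is homogeneous: if D_t is the derivation X_i ↦ Λ_{ti} X_i, then [D_t, δ_t] = s_t δ_t on that ring,
with s_t ≠ 0 unless δ_t = 0. Once x = X_t is inverted, the exponential θ(f) = ∑_l (1/l!) (-1/(s_t
x))^l δ_t^l(f) is multiplicative, preserves brackets and satisfies {x, θ(X_i)} = Λ_{ti} x θ(X_i).
Replacing the earlier X_i by θ(X_i) therefore removes δ_t; this is the Poisson form of Cauchon's
deletion of derivations. Treating the indeterminates from the last to the first leaves log-canonical
elements, {y_s, y_t} = Λ_{st} y_s y_t, whose field still contains the original generators
(`IsDeletable.hasLogCanonicalImages`; the invariance of brackets is `bracket_expSum_expSum`).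

The procedure is run on a Poisson homomorphism φ into an arbitrary Poisson field, not inside Fract
A. There φ(X_t) is either invertible, so that δ_t can be deleted, or zero, and then it is
log-canonical for trivial reasons. Thus all Poisson primes are treated alike: Fract A/P is generated
by log-canonical elements with the same matrix Λ, some of which may vanish.

Log-canonical generators suffice (`isomorphic_quadratic_of_units`). The Laurent monomials in the
nonzero y_i are simultaneous eigenvectors of the operators y_i⁻¹{y_i, -}, and the eigenvalues define
a homomorphism Φ from the group of exponents to a power of k. Monomials with exponent in ker Φ are
central and generate K. The image of Φ is free because k has characteristic zero; monomials lifting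
a basis of it are algebraically independent over K, since their distinct products have distinct
eigenvalues. For P = 0 the transcendence degree forces the y_s themselves to be algebraically
independent, so that K = k and the matrix is Λ. -/

namespace PoissonBracket

/-! ### Elementary identities for Poisson brackets -/

section Basic

variable {k A : Type*} [CommRing k] [CommRing A] [Algebra k A]

theorem bracket_mul_left (π : PoissonBracket k A) (a b c : A) :
    π.bracket (a * b) c = a * π.bracket b c + b * π.bracket a c := by
  rw [π.skew, π.leibniz, π.skew c a, π.skew c b]
  ring

theorem bracket_algebraMap_right (π : PoissonBracket k A) (a : A) (c : k) :
    π.bracket a (algebraMap k A c) = 0 :=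
  (π.toBiderivation a).map_algebraMap c

theorem bracket_algebraMap_left (π : PoissonBracket k A) (a : A) (c : k) :
    π.bracket (algebraMap k A c) a = 0 := by
  rw [π.skew, bracket_algebraMap_right, neg_zero]

/-- The Jacobi identity in Leibniz form. -/
theorem bracket_bracket (π : PoissonBracket k A) (a b c : A) :
    π.bracket a (π.bracket b c) = π.bracket (π.bracket a b) c + π.bracket b (π.bracket a c) := by
  have h := π.jacobi a b c
  rw [π.skew c a, map_neg, π.skew c (π.bracket a b)] at h
  linear_combination h

end Basic

/-! ### Poisson brackets on fields -/

section Field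

variable {k F : Type*} [Field k] [Field F] [Algebra k F]

theorem bracket_inv_right (π : PoissonBracket k F) (a b : F) :
    π.bracket a b⁻¹ = -(b⁻¹ ^ 2 * π.bracket a b) := by
  have := (π.toBiderivation a).leibniz_inv b
  simpa using this

theorem bracket_inv_left (π : PoissonBracket k F) (a b : F) :
    π.bracket a⁻¹ b = -(a⁻¹ ^ 2 * π.bracket a b) := by
  rw [π.skew, bracket_inv_right, π.skew b a]
  ring

/-- A homomorphism of fields which is compatible with Poisson brackets on a set of generators is
compatible with them everywhere. -/
theorem map_bracket_of_adjoin_eq_top {L : Type*} [Field L] [Algebra k L] (π : PoissonBracket k F)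
    (ρ : PoissonBracket k L) (e : F →ₐ[k] L) {S : Set F}
    (hS : IntermediateField.adjoin k S = ⊤)
    (h : ∀ a ∈ S, ∀ b ∈ S, e (π.bracket a b) = ρ.bracket (e a) (e b)) (a b : F) :
    e (π.bracket a b) = ρ.bracket (e a) (e b) := by
  -- For fixed `a` both sides are derivations along `e` in `b`, so agreement passes from `S` to the
  -- generated field. Skew-symmetry then exchanges the two variables.
  have ext : ∀ a, (∀ b ∈ S, e (π.bracket a b) = ρ.bracket (e a) (e b)) →
      ∀ b, e (π.bracket a b) = ρ.bracket (e a) (e b) := by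
    intro a ha b
    have hb : b ∈ IntermediateField.adjoin k S := hS ▸ IntermediateField.mem_top
    induction hb using IntermediateField.adjoin_induction with
    | mem x hx => exact ha x hx
    | algebraMap x => rw [bracket_algebraMap_right, map_zero, e.commutes, bracket_algebraMap_right]
    | add x y _ _ hx hy => simp only [map_add, hx, hy]
    | inv x _ hx => simp only [bracket_inv_right, map_neg, map_mul, map_pow, map_inv₀, hx]
    | mul x y _ _ hx hy => simp only [π.leibniz, ρ.leibniz, map_add, map_mul, hx, hy]
  refine ext a (fun b hb => ?_) b
  rw [π.skew, ρ.skew, map_neg, ext b (h b hb) a]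

end Field

/-! ### Recognition of quadratic Poisson fields -/

section QuadraticField

variable {k : Type*} [Field k] [CharZero k]

theorem quadratic_X (K : Type*) [Field K] [Algebra k K] {σ : Type*} (μ : Matrix σ σ k)
    (hμ : μ.transpose = -μ) (s t : σ) :
    (quadratic K μ hμ).bracket (X s) (X t) = C (algebraMap k K (μ s t)) * X s * X t :=
  poly_X _ _ _ _ _ s t

theorem quadratic_C_left (K : Type*) [Field K] [Algebra k K] {σ : Type*} (μ : Matrix σ σ k)
    (hμ : μ.transpose = -μ) (c : K) (f : MvPolynomial σ K) :
    (quadratic K μ hμ).bracket (C c) f = 0 := by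
  change polyBider _ (C c) f = 0
  rw [MvPolynomial.derivation_C, Derivation.zero_apply]

/-- The generation is over `k`, with the constants from `K` among the generators, because a Poisson
bracket over `k` on the target is not known to be `K`-bilinear beforehand. -/
theorem adjoin_fractionRing_eq_top (k : Type*) [Field k] (K : Type*) [Field K] [Algebra k K]
    (σ : Type*) :
    IntermediateField.adjoin k (Set.range (fun c : K => algebraMap (MvPolynomial σ K)
      (FractionRing (MvPolynomial σ K)) (C c)) ∪ Set.range (fun s : σ =>
        algebraMap (MvPolynomial σ K) (FractionRing (MvPolynomial σ K)) (X s))) = ⊤ := by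
  set E := IntermediateField.adjoin k (Set.range (fun c : K => algebraMap (MvPolynomial σ K)
      (FractionRing (MvPolynomial σ K)) (C c)) ∪ Set.range (fun s : σ =>
        algebraMap (MvPolynomial σ K) (FractionRing (MvPolynomial σ K)) (X s))) with hE
  have hp : ∀ p : MvPolynomial σ K, algebraMap _ (FractionRing (MvPolynomial σ K)) p ∈ E := by
    intro p
    induction p using MvPolynomial.induction_on with
    | C a => exact IntermediateField.subset_adjoin _ _ (.inl ⟨a, rfl⟩)
    | add p q hp hq => rw [map_add]; exact add_mem hp hq
    | mul_X p s hp =>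
      rw [map_mul]
      exact mul_mem hp (IntermediateField.subset_adjoin _ _ (.inr ⟨s, rfl⟩))
  refine eq_top_iff.mpr fun f _ => ?_
  obtain ⟨a, b, -, rfl⟩ := IsFractionRing.div_surjective (MvPolynomial σ K) f
  exact div_mem (hp a) (hp b)

/-- A Poisson field generated over a central subfield `K` by algebraically independent elements
`z_s` with `{z_s, z_t} = μ_{st} z_s z_t` is isomorphic to `K_μ(y_s)`. -/
theorem isomorphic_quadratic {F : Type*} [Field F] [Algebra k F] (ρ : PoissonBracket k F)
    (K : Type*) [Field K] [Algebra k K] [Algebra K F] [IsScalarTower k K F]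
    {σ : Type*} (μ : Matrix σ σ k) (hμ : μ.transpose = -μ) (z : σ → F)
    (hz : AlgebraicIndependent K z) (htop : IntermediateField.adjoin K (Set.range z) = ⊤)
    (hK : ∀ (c : K) (f : F), ρ.bracket (algebraMap K F c) f = 0)
    (hzz : ∀ s t, ρ.bracket (z s) (z t) = algebraMap k F (μ s t) * z s * z t) :
    Isomorphic ρ (quadratic K μ hμ).fraction := by
  let g : FractionRing (MvPolynomial σ K) →ₐ[K] F :=
    IsFractionRing.liftAlgHom (g := aeval z) hz
  have hg : ∀ p : MvPolynomial σ K, g (algebraMap _ _ p) = aeval z p := fun p =>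
    IsFractionRing.lift_algebraMap (g := (aeval z : MvPolynomial σ K →ₐ[K] F).toRingHom) hz p
  have hsurj : Function.Surjective g := by
    have : IntermediateField.adjoin K (Set.range z) ≤ g.fieldRange := by
      rw [IntermediateField.adjoin_le_iff]
      rintro _ ⟨s, rfl⟩
      exact ⟨algebraMap _ _ (X s), (hg _).trans (aeval_X _ _)⟩
    intro f
    exact this (htop ▸ IntermediateField.mem_top)
  let e : FractionRing (MvPolynomial σ K) ≃ₐ[k] F :=
    (AlgEquiv.ofBijective g ⟨g.injective, hsurj⟩).restrictScalars k
  have he : ∀ p : MvPolynomial σ K,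
      (e : FractionRing (MvPolynomial σ K) →ₐ[k] F) (algebraMap _ _ p) = aeval z p := hg
  have key : ∀ a b, e ((quadratic K μ hμ).fraction.bracket a b) = ρ.bracket (e a) (e b) := by
    refine map_bracket_of_adjoin_eq_top _ ρ (e : _ →ₐ[k] F) (adjoin_fractionRing_eq_top k K σ) ?_
    have hC : ∀ (c : K) f, (quadratic K μ hμ).bracket f (C c) = 0 := fun c f => by
      rw [skew, quadratic_C_left, neg_zero]
    have hK' : ∀ (c : K) (f : F), ρ.bracket f (algebraMap K F c) = 0 := fun c f => by
      rw [skew, hK, neg_zero]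
    rintro _ (⟨c, rfl⟩ | ⟨s, rfl⟩) _ (⟨d, rfl⟩ | ⟨t, rfl⟩)
    all_goals
      simp only [fraction_algebraMap, he, quadratic_C_left, hC, quadratic_X,
        map_zero, map_mul, aeval_C, aeval_X, hK, hK', hzz, ← IsScalarTower.algebraMap_apply]
  refine ⟨e.symm, fun a b => ?_⟩
  rw [AlgEquiv.symm_apply_eq, key, e.apply_symm_apply, e.apply_symm_apply]

end QuadraticField

/-! ### Eigenvectors and Laurent monomials -/

section LogCanonical

variable {k F : Type*} [Field k] [Field F] [Algebra k F]

/-- Vectors on which sufficiently many endomorphisms act with distinct eigenvalues are linearly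
independent. -/
theorem linearIndependent_of_separating_eigenvalues {K V ι : Type*} [Field K] [AddCommGroup V]
    [Module K V] (v : ι → V) (hv : ∀ i, v i ≠ 0)
    (h : ∀ i j, i ≠ j → ∃ (f : V →ₗ[K] V) (c : ι → K), (∀ l, f (v l) = c l • v l) ∧ c i ≠ c j) :
    LinearIndependent K v := by
  classical
  rw [linearIndependent_iff']
  intro s
  induction s using Finset.induction_on with
  | empty => simp
  | insert i s his ih =>
    intro g hg
    have hs : ∀ j ∈ s, g j = 0 := by
      intro j hj
      obtain ⟨f, c, hf, hc⟩ := h j i (by rintro rfl; exact his hj)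
      have h1 := congrArg f hg
      rw [map_sum, map_zero] at h1
      -- Applying `f - c i` to the relation removes the term of `i` and leaves a relation over `s`,
      -- to which the induction hypothesis applies.
      have h2 : ∑ l ∈ s, (g l * (c l - c i)) • v l = 0 := by
        have : ∑ l ∈ insert i s, (g l * (c l - c i)) • v l = 0 := by
          calc _ = ∑ l ∈ insert i s, f (g l • v l) - c i • ∑ l ∈ insert i s, g l • v l := by
                rw [Finset.smul_sum, ← Finset.sum_sub_distrib]
                refine Finset.sum_congr rfl fun l _ => ?_
                rw [map_smul, hf, smul_smul, smul_smul, ← sub_smul]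
                congr 1
                ring
            _ = 0 := by rw [h1, hg, smul_zero, sub_zero]
        rwa [Finset.sum_insert his, sub_self, mul_zero, zero_smul, zero_add] at this
      have := ih _ h2 j hj
      exact (mul_eq_zero.mp this).resolve_right (sub_ne_zero.mpr hc)
    rw [Finset.sum_insert his, Finset.sum_eq_zero fun j hj => by rw [hs j hj, zero_smul],
      add_zero] at hg
    intro j hj
    rcases Finset.mem_insert.mp hj with rfl | hj
    · exact (smul_eq_zero.mp hg).resolve_right (hv j)
    · exact hs j hj

/-- The Laurent monomials in a finite family of units. -/
def laurentMonomial {G ι : Type*} [CommGroup G] [Fintype ι] (y : ι → G) :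
    Multiplicative (ι → ℤ) →* G where
  toFun a := ∏ i, y i ^ a.toAdd i
  map_one' := by simp
  map_mul' a b := by simp [zpow_add, Finset.prod_mul_distrib]

theorem laurentMonomial_single {G ι : Type*} [CommGroup G] [Fintype ι] [DecidableEq ι] (y : ι → G)
    (i : ι) : laurentMonomial y (Multiplicative.ofAdd (Pi.single i 1)) = y i := by
  change ∏ j, y j ^ (Pi.single i 1 : ι → ℤ) j = y i
  rw [Finset.prod_eq_single i (fun j _ hj => by simp [hj]) (by simp)]
  simp

/-- The logarithmic derivative turns products into sums. The coefficients `c i` lie in `F`, not in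
`k`, since for the derivation {y_j, -} they contain the factor y_j. -/
theorem derivation_laurentMonomial {ι : Type*} [Fintype ι] (D : Derivation k F F) (y : ι → Fˣ)
    (c : ι → F) (hc : ∀ i, D (y i) = c i * y i) (a : ι → ℤ) :
    D (laurentMonomial y (Multiplicative.ofAdd a) : Fˣ) =
      (∑ i, a i * c i) * (laurentMonomial y (Multiplicative.ofAdd a) : Fˣ) := by
  classical
  have key : ∀ s : Finset ι, D (∏ i ∈ s, (y i : F) ^ a i) =
      (∑ i ∈ s, a i * c i) * ∏ i ∈ s, (y i : F) ^ a i := by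
    intro s
    induction s using Finset.induction_on with
    | empty => simp
    | insert i s his ih =>
      rw [Finset.prod_insert his, Finset.sum_insert his, Derivation.leibniz, ih,
        Derivation.leibniz_zpow, hc, zpow_sub_one₀ (y i).ne_zero]
      have := (y i).ne_zero
      simp only [smul_eq_mul, zsmul_eq_mul]
      field_simp
      ring
  have e : ((laurentMonomial y (Multiplicative.ofAdd a) : Fˣ) : F) = ∏ i, (y i : F) ^ a i := by
    simp [laurentMonomial]
  rw [e, key]

end LogCanonical

/-! ### Poisson fields generated by log-canonical elements -/

section LogCanonicalField

variable {k F : Type u} [Field k] [CharZero k] [Field F] [Algebra k F]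

/-- A Poisson field generated by finitely many units `y_i` with `{y_i, y_j} = Λ_{ij} y_i y_j` is
a quadratic Poisson field over the subfield generated by the central Laurent monomials. -/
theorem isomorphic_quadratic_of_units (ρ : PoissonBracket k F) {ι : Type*} [Fintype ι]
    (Λ : Matrix ι ι k) (y : ι → Fˣ)
    (hy : ∀ i j, ρ.bracket (y i : F) (y j) = algebraMap k F (Λ i j) * y i * y j)
    (htop : IntermediateField.adjoin k (Set.range fun i => (y i : F)) = ⊤) :
    ∃ (K : Type u) (_ : Field K) (_ : Algebra k K) (m : ℕ) (μ : Matrix (Fin m) (Fin m) k)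
      (hμ : μ.transpose = -μ), Isomorphic ρ (quadratic K μ hμ).fraction := by
  classical
  -- `Φ a i` is the eigenvalue of y_i⁻¹{y_i, -} on the monomial with exponent `a`; so `Φ a = 0`
  -- means that this monomial is central.
  let Φ : (ι → ℤ) →ₗ[ℤ] (ι → k) := Fintype.linearCombination ℤ fun j i => Λ i j
  have hΦ : ∀ a i, Φ a i = ∑ j, (a j : k) * Λ i j := fun a i => by
    simp [Φ, Fintype.linearCombination_apply, Finset.sum_apply]
  let Y : (ι → ℤ) → Fˣ := fun a => laurentMonomial y (Multiplicative.ofAdd a)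
  have Yadd : ∀ a b, Y (a + b) = Y a * Y b := fun a b => by
    simp only [Y, ofAdd_add, map_mul]
  have Ysum : ∀ {m : ℕ} (d : Fin m → ℤ) (c : Fin m → ι → ℤ),
      Y (∑ j, d j • c j) = ∏ j, Y (c j) ^ d j := fun d c => by
    simp only [Y, ofAdd_sum, map_prod, ofAdd_zsmul, map_zpow]
  have Ysingle : ∀ i, Y (Pi.single i 1) = y i := laurentMonomial_single y
  have yY : ∀ i a, ρ.bracket (y i : F) (Y a) = algebraMap k F (Φ a i) * y i * Y a := by
    intro i a
    have := derivation_laurentMonomial (ρ.toBiderivation (y i : F)) y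
      (fun j => algebraMap k F (Λ i j) * y i) (fun j => hy i j) a
    rw [toBiderivation_apply] at this
    rw [this, hΦ, map_sum, Finset.sum_mul, Finset.sum_mul, Finset.sum_mul]
    refine Finset.sum_congr rfl fun j _ => ?_
    rw [map_mul, map_intCast]
    ring
  have YY : ∀ b a, ρ.bracket (Y b : F) (Y a) =
      algebraMap k F (∑ i, (b i : k) * Φ a i) * Y b * Y a := by
    intro b a
    have := derivation_laurentMonomial (ρ.toBiderivation (Y a : F)) y
      (fun j => -(algebraMap k F (Φ a j) * Y a)) (fun j => by
        rw [toBiderivation_apply, skew, yY]; ring) b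
    rw [toBiderivation_apply] at this
    rw [skew, this, map_sum, Finset.sum_mul, Finset.sum_mul, Finset.sum_mul, ← Finset.sum_neg_distrib]
    refine Finset.sum_congr rfl fun j _ => ?_
    rw [map_mul, map_intCast]
    ring
  -- The range is a finitely generated subgroup of a power of `k`, torsion-free in characteristic
  -- zero, hence free. The lifts `c j` of a basis span a complement of the kernel in the group of
  -- exponents.
  let b := Module.finBasis ℤ (LinearMap.range Φ)
  set m := Module.finrank ℤ (LinearMap.range Φ)
  have hb : ∀ j, ∃ c, Φ c = b j := fun j => (b j).2
  choose c hc using hb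
  let K : IntermediateField k F :=
    IntermediateField.adjoin k {u | ∃ a, Φ a = 0 ∧ (Y a : F) = u}
  have hK : ∀ (x : K) (f : F), ρ.bracket (algebraMap K F x) f = 0 := by
    have h1 : ∀ x ∈ K, ∀ i, ρ.bracket (y i : F) x = 0 := by
      intro x hx i
      induction hx using IntermediateField.adjoin_induction with
      | mem x hx =>
        obtain ⟨a, ha, rfl⟩ := hx
        rw [yY, ha]
        simp
      | algebraMap x => rw [bracket_algebraMap_right]
      | add x y _ _ hx hy => rw [map_add, hx, hy, add_zero]
      | inv x _ hx => rw [bracket_inv_right, hx, mul_zero, neg_zero]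
      | mul x y _ _ hx hy => rw [leibniz, hx, hy, zero_mul, mul_zero, add_zero]
    intro x f
    have hf : f ∈ IntermediateField.adjoin k (Set.range fun i => (y i : F)) :=
      htop ▸ IntermediateField.mem_top
    induction hf using IntermediateField.adjoin_induction with
    | mem f hf =>
      obtain ⟨i, rfl⟩ := hf
      rw [skew]
      exact neg_eq_zero.mpr (h1 _ x.2 i)
    | algebraMap x => rw [bracket_algebraMap_right]
    | add x y _ _ hx hy => rw [map_add, hx, hy, add_zero]
    | inv x _ hx => rw [bracket_inv_right, hx, mul_zero, neg_zero]
    | mul x y _ _ hx hy => rw [leibniz, hx, hy, zero_mul, mul_zero, add_zero]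
  let z : Fin m → F := fun j => Y (c j)
  let μ : Matrix (Fin m) (Fin m) k := Matrix.of fun s t => ∑ i, (c s i : k) * Φ (c t) i
  have hzz : ∀ s t, ρ.bracket (z s) (z t) = algebraMap k F (μ s t) * z s * z t :=
    fun s t => YY _ _
  -- `Λ` is not assumed antisymmetric; the property of `μ` is read off from the bracket, because the
  -- `z s` are units.
  have hμ : μ.transpose = -μ := by
    ext s t
    have h := ρ.skew (z t) (z s)
    rw [hzz, hzz] at h
    have hz : z s * z t ≠ 0 := mul_ne_zero (Y (c s)).ne_zero (Y (c t)).ne_zero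
    apply (algebraMap k F).injective
    rw [Matrix.transpose_apply, Matrix.neg_apply, map_neg]
    apply mul_right_cancel₀ hz
    linear_combination h
  have hind : AlgebraicIndependent K z := by
    have hmon : ∀ d : Fin m →₀ ℕ, ∏ j, z j ^ d j = (Y (∑ j, (d j : ℤ) • c j) : F) := by
      intro d
      rw [Ysum]
      simp [z]
    have hli : LinearIndependent K fun d : Fin m →₀ ℕ => ∏ j, z j ^ d j := by
      refine linearIndependent_of_separating_eigenvalues _
        (fun d => by rw [hmon]; exact Units.ne_zero _) fun d d' hd => ?_
      -- `Φ` maps the exponent of the monomial of `d` to ∑ d_j b_j. The `b j` form a basis, so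
      -- different `d` give different tuples of eigenvalues, and some y_i separates the two
      -- monomials.
      have hne : Φ (∑ j, (d j : ℤ) • c j) ≠ Φ (∑ j, (d' j : ℤ) • c j) := by
        intro h
        apply hd
        simp only [map_sum, map_smul, hc] at h
        have h' : ∑ j, (d j : ℤ) • b j = ∑ j, (d' j : ℤ) • b j := by
          apply Subtype.ext
          simpa using h
        have h2 := fun j => congrArg (fun v => b.repr v j) h'
        ext j
        have h3 := h2 j
        simp only [map_sum, map_smul, Module.Basis.repr_self] at h3
        simpa [Finsupp.finsetSum_apply, Finsupp.single_apply] using h3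
      obtain ⟨i, hi⟩ := Function.ne_iff.mp hne
      -- Linearity over `K`, and not just over `k`, holds because `K` is central.
      let D : F →ₗ[K] F :=
        { toFun := fun f => (y i : F)⁻¹ * ρ.bracket (y i : F) f
          map_add' := fun f g => by rw [map_add, mul_add]
          map_smul' := fun x f => by
            rw [Algebra.smul_def, leibniz, skew _ _ (algebraMap K F x), hK, RingHom.id_apply,
              Algebra.smul_def]
            ring }
      refine ⟨D, fun d => algebraMap k K (Φ (∑ j, (d j : ℤ) • c j) i), fun d => ?_,
        fun h => hi ((algebraMap k K).injective h)⟩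
      change (y i : F)⁻¹ * ρ.bracket (y i : F) _ = _
      rw [hmon, yY, Algebra.smul_def, ← IsScalarTower.algebraMap_apply]
      have := (y i).ne_zero
      field_simp
    rw [algebraicIndependent_iff]
    intro p hp
    rw [aeval_def, eval₂_eq'] at hp
    simp only [← Algebra.smul_def] at hp
    ext d
    by_cases hd : d ∈ p.support
    · rw [linearIndependent_iff'.mp hli p.support (fun d => coeff d p) hp d hd, coeff_zero]
    · rw [notMem_support_iff.mp hd, coeff_zero]
  have hgen : IntermediateField.adjoin K (Set.range z) = ⊤ := by
    have h1 : ∀ i, (y i : F) ∈ IntermediateField.adjoin K (Set.range z) := by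
      intro i
      let v : LinearMap.range Φ := ⟨Φ (Pi.single i 1), _, rfl⟩
      have hv := b.sum_repr v
      let a := ∑ j, b.repr v j • c j
      have ha : Φ (Pi.single i 1 - a) = 0 := by
        rw [map_sub, sub_eq_zero]
        have hv' := congrArg Subtype.val hv
        rw [Submodule.coe_sum] at hv'
        simp only [a, map_sum, map_smul, hc]
        exact hv'.symm
      -- The first factor has exponent in the kernel, so it lies in `K`; the second is a Laurent
      -- monomial in the `z j`.
      have e : (y i : F) = Y (Pi.single i 1 - a) * Y a := by
        rw [← Units.val_mul, ← Yadd, sub_add_cancel, Ysingle]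
      rw [e]
      refine mul_mem ?_ ?_
      · exact (IntermediateField.adjoin K (Set.range z)).algebraMap_mem
          ⟨_, IntermediateField.subset_adjoin _ _ ⟨_, ha, rfl⟩⟩
      · simp only [a, Ysum, Units.coe_prod, Units.val_zpow_eq_zpow_val]
        exact prod_mem fun j _ => zpow_mem (IntermediateField.subset_adjoin _ _ (Set.mem_range_self j)) _
    have h2 : IntermediateField.adjoin k (Set.range fun i => (y i : F)) ≤
        (IntermediateField.adjoin K (Set.range z)).restrictScalars k := by
      rw [IntermediateField.adjoin_le_iff]
      rintro _ ⟨i, rfl⟩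
      exact h1 i
    refine eq_top_iff.mpr fun f _ => h2 ?_
    rw [htop]
    exact IntermediateField.mem_top
  exact ⟨K, inferInstance, inferInstance, m, μ, hμ,
    isomorphic_quadratic ρ K μ hμ z hind hgen hK hzz⟩

/-- A Poisson field generated by finitely many elements `y_i` with `{y_i, y_j} = Λ_{ij} y_i y_j` is
a quadratic Poisson field over some extension of the base field. -/
theorem isomorphic_quadratic_of_logCanonical (ρ : PoissonBracket k F) {ι : Type*} [Finite ι]
    (Λ : Matrix ι ι k) (y : ι → F)
    (hy : ∀ i j, ρ.bracket (y i) (y j) = algebraMap k F (Λ i j) * y i * y j)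
    (htop : IntermediateField.adjoin k (Set.range y) = ⊤) :
    ∃ (K : Type u) (_ : Field K) (_ : Algebra k K) (m : ℕ) (μ : Matrix (Fin m) (Fin m) k)
      (hμ : μ.transpose = -μ), Isomorphic ρ (quadratic K μ hμ).fraction := by
  -- Generators equal to zero contribute nothing to the field and are discarded, which leaves units.
  have := Fintype.ofFinite {i // y i ≠ 0}
  refine isomorphic_quadratic_of_units ρ (Λ.submatrix Subtype.val Subtype.val)
    (fun i : {i // y i ≠ 0} => Units.mk0 (y i) i.2) (fun i j => hy i j) ?_
  rw [eq_top_iff, ← htop, IntermediateField.adjoin_le_iff]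
  rintro _ ⟨i, rfl⟩
  by_cases hi : y i = 0
  · rw [hi]
    exact zero_mem _
  · exact IntermediateField.subset_adjoin _ _ ⟨⟨i, hi⟩, rfl⟩

end LogCanonicalField

/-! ### Reduction to Poisson homomorphisms into Poisson fields -/

section Reduction

variable {k : Type u} [Field k]

/-- Every Poisson homomorphism from `k[X_s]` to a Poisson field `F` takes values in a subfield
generated by elements `y_s` with `{y_s, y_t} = Λ_{st} y_s y_t`. -/
def HasLogCanonicalImages {σ : Type} (π : PoissonBracket k (MvPolynomial σ k))
    (Λ : Matrix σ σ k) : Prop :=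
  ∀ (F : Type u) [Field F] [Algebra k F] (ρ : PoissonBracket k F) (φ : MvPolynomial σ k →ₐ[k] F),
    (∀ a b, φ (π.bracket a b) = ρ.bracket (φ a) (φ b)) →
    ∃ y : σ → F, (∀ s t, ρ.bracket (y s) (y t) = algebraMap k F (Λ s t) * y s * y t) ∧
      ∀ s, φ (X s) ∈ IntermediateField.adjoin k (Set.range y)

/-- The composite k[X_s] → B → Fract B is a Poisson homomorphism, and by surjectivity the images of
the X_s generate Fract B. A subfield containing these images is therefore everything. -/
theorem HasLogCanonicalImages.exists_generators {σ : Type}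
    {π : PoissonBracket k (MvPolynomial σ k)} {Λ : Matrix σ σ k} (h : HasLogCanonicalImages π Λ)
    {B : Type u} [CommRing B] [IsDomain B] [Algebra k B] (ρ : PoissonBracket k B)
    (g : MvPolynomial σ k →ₐ[k] B) (hg : Function.Surjective g)
    (hgb : ∀ a b, g (π.bracket a b) = ρ.bracket (g a) (g b)) :
    ∃ y : σ → FractionRing B, (∀ s t, ρ.fraction.bracket (y s) (y t) =
      algebraMap k (FractionRing B) (Λ s t) * y s * y t) ∧
      IntermediateField.adjoin k (Set.range y) = ⊤ := by
  let φ : MvPolynomial σ k →ₐ[k] FractionRing B :=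
    (IsScalarTower.toAlgHom k B (FractionRing B)).comp g
  obtain ⟨y, hy, hmem⟩ := h (FractionRing B) ρ.fraction φ fun a b => by
    change algebraMap B _ (g _) = ρ.fraction.bracket (algebraMap B _ (g a)) (algebraMap B _ (g b))
    rw [fraction_algebraMap, hgb]
  refine ⟨y, hy, eq_top_iff.mpr fun f _ => ?_⟩
  have hp : ∀ p, φ p ∈ IntermediateField.adjoin k (Set.range y) := by
    intro p
    induction p using MvPolynomial.induction_on with
    | C a =>
      rw [← MvPolynomial.algebraMap_eq, φ.commutes]
      exact IntermediateField.algebraMap_mem _ a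
    | add p q hp hq => rw [map_add]; exact add_mem hp hq
    | mul_X p s hp => rw [map_mul]; exact mul_mem hp (hmem s)
  obtain ⟨a, b, -, rfl⟩ := IsFractionRing.div_surjective B f
  obtain ⟨a, rfl⟩ := hg a
  obtain ⟨b, rfl⟩ := hg b
  exact div_mem (hp a) (hp b)

/-- When `g` is bijective, the field has transcendence degree at least the number of indices, while
the y_s generate it. As many generators as the transcendence degree must be algebraically
independent. -/
theorem HasLogCanonicalImages.exists_basis {σ : Type} [Finite σ]
    {π : PoissonBracket k (MvPolynomial σ k)} {Λ : Matrix σ σ k} (h : HasLogCanonicalImages π Λ)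
    {B : Type u} [CommRing B] [IsDomain B] [Algebra k B] (ρ : PoissonBracket k B)
    (g : MvPolynomial σ k →ₐ[k] B) (hg : Function.Bijective g)
    (hgb : ∀ a b, g (π.bracket a b) = ρ.bracket (g a) (g b)) :
    ∃ y : σ → FractionRing B, (∀ s t, ρ.fraction.bracket (y s) (y t) =
      algebraMap k (FractionRing B) (Λ s t) * y s * y t) ∧
      IntermediateField.adjoin k (Set.range y) = ⊤ ∧ AlgebraicIndependent k y := by
  obtain ⟨y, hy, htop⟩ := h.exists_generators ρ g hg.2 hgb
  refine ⟨y, hy, htop, ?_⟩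
  have hX : AlgebraicIndependent k fun s => algebraMap B (FractionRing B) (g (X s)) := by
    have := (MvPolynomial.algebraicIndependent_X σ k).map'
      (f := (IsScalarTower.toAlgHom k B (FractionRing B)).comp g)
      ((IsFractionRing.injective B (FractionRing B)).comp hg.1)
    exact this
  have halg : Algebra.IsAlgebraic (Algebra.adjoin k (Set.range y)) (FractionRing B) := by
    refine ⟨fun f => IntermediateField.isAlgebraic_adjoin_iff.mp ?_⟩
    have hf : f ∈ IntermediateField.adjoin k (Set.range y) := htop ▸ IntermediateField.mem_top
    exact isAlgebraic_algebraMap (⟨f, hf⟩ : IntermediateField.adjoin k (Set.range y))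
  exact (Algebra.IsAlgebraic.isTranscendenceBasis_of_lift_le_trdeg_of_finite k y hX.lift_cardinalMk_le_trdeg).1

variable [CharZero k]

theorem HasLogCanonicalImages.quadraticGelfandKirillov {σ : Type} [Finite σ]
    {π : PoissonBracket k (MvPolynomial σ k)} {Λ : Matrix σ σ k} (h : HasLogCanonicalImages π Λ)
    (hΛ : Λ.transpose = -Λ) : π.QuadraticGelfandKirillov Λ hΛ := by
  have hK : ∀ {F : Type u} [Field F] [Algebra k F] (ρ : PoissonBracket k F) (c : k) (f : F),
      ρ.bracket (algebraMap k F c) f = 0 := fun ρ c f => ρ.bracket_algebraMap_left f c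
  refine ⟨fun P _ hP => ?_, ?_, ?_⟩
  · obtain ⟨y, hy, htop⟩ := h.exists_generators (π.quotient P hP) (Ideal.Quotient.mkₐ k P)
      Ideal.Quotient.mk_surjective fun a b => (π.quotient_mk P hP a b).symm
    exact isomorphic_quadratic_of_logCanonical _ Λ y hy htop
  · have : (⊥ : Ideal (MvPolynomial σ k)).IsPrime := Ideal.isPrime_bot
    obtain ⟨y, hy, htop, hind⟩ := h.exists_basis (π.quotient ⊥ π.isPoissonIdeal_bot)
      (Ideal.Quotient.mkₐ k ⊥)
      ⟨(RingHom.injective_iff_ker_eq_bot _).mpr Ideal.mk_ker, Ideal.Quotient.mk_surjective⟩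
      fun a b => (π.quotient_mk ⊥ π.isPoissonIdeal_bot a b).symm
    let e : Fin (Nat.card σ) ≃ σ := (Finite.equivFin σ).symm
    have hμ : (Λ.submatrix e e).transpose = -Λ.submatrix e e := by
      ext s t
      -- The base field is central, so in this case K = k. The numbering `e` of the indices serves
      -- only to give a matrix indexed by `Fin m`.
      exact skew_apply hΛ (e t) (e s)
    refine ⟨Nat.card σ, Λ.submatrix e e, hμ, ?_,
      isomorphic_quadratic _ k _ hμ (y ∘ e) (hind.comp e e.injective) ?_ (hK _)
        fun s t => hy _ _⟩
    · rw [MvPolynomial.trdeg_of_isDomain, ← Nat.cast_card, Cardinal.lift_natCast]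
    · rw [e.surjective.range_comp, htop]
  · obtain ⟨y, hy, htop, hind⟩ := h.exists_basis π (AlgHom.id k _) Function.bijective_id
      fun a b => rfl
    exact isomorphic_quadratic _ k Λ hΛ y hind htop (hK _) hy

end Reduction

/-! ### Exponential sums and their brackets -/

section ExponentialSum

variable {k F : Type*} [Field k] [Field F] [Algebra k F]

/-- The element `∑_l (1 / l!) (-1 / s)^l a_l x^{-l}`, truncated after the fourth power. -/
noncomputable def expSum (s : k) (x : F) (a : ℕ → F) : F :=
  -- In all applications the derivation has vanishing third power on the indeterminates. A product
  -- of two indeterminates may still have a nonzero fourth derivative, but not a fifth, so five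
  -- terms suffice for quadratic elements.
  ∑ l ∈ Finset.range 5, algebraMap k F (1 / (l.factorial : k)) *
    (a l * (-(algebraMap k F s * x)⁻¹) ^ l)

theorem expSum_eq (s : k) (x : F) (a : ℕ → F) :
    expSum s x a = a 0 + a 1 * (-(algebraMap k F s * x)⁻¹) +
      algebraMap k F (1 / 2) * (a 2 * (-(algebraMap k F s * x)⁻¹) ^ 2) +
      algebraMap k F (1 / 6) * (a 3 * (-(algebraMap k F s * x)⁻¹) ^ 3) +
      algebraMap k F (1 / 24) * (a 4 * (-(algebraMap k F s * x)⁻¹) ^ 4) := by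
  simp [expSum, Finset.sum_range_succ, Nat.factorial, map_ofNat]

variable [CharZero k]

/-- The bracket of `x` with an exponential sum of eigenvectors. -/
theorem bracket_expSum (ρ : PoissonBracket k F) {x : F} (hx : x ≠ 0) {s w : k} (hs : s ≠ 0)
    {a : ℕ → F} (a3 : a 3 = 0) (a4 : a 4 = 0)
    (ha : ∀ l : ℕ, ρ.bracket x (a l) = algebraMap k F (w + l * s) * a l * x + a (l + 1)) :
    ρ.bracket x (expSum s x a) = algebraMap k F w * x * expSum s x a := by
  have hs' : algebraMap k F s ≠ 0 := (map_ne_zero _).mpr hs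
  set y := -(algebraMap k F s * x)⁻¹ with hy
  have hyx : algebraMap k F s * x * y = -1 := by rw [hy]; field_simp
  have hxy : ρ.bracket x y = 0 := by
    rw [hy, map_neg, bracket_inv_right, leibniz, bracket_algebraMap_right, ρ.alt]
    ring
  have h0 := ha 0
  have h1 := ha 1
  have h2 := ha 2
  simp only [Nat.cast_zero, Nat.cast_one, Nat.cast_ofNat, zero_mul, one_mul, add_zero, map_add,
    map_mul, map_ofNat, zero_add, Nat.reduceAdd, a3] at h0 h1 h2
  have half : algebraMap k F (1 / 2) * 2 = 1 := by
    rw [← map_ofNat (algebraMap k F) 2, ← map_mul]; simp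
  rw [expSum_eq, ← hy, a3, a4]
  simp only [map_add, leibniz, bracket_algebraMap_right, pow_two, hxy, h0, h1, h2, zero_mul,
    mul_zero, add_zero, zero_add]
  -- With s x y = -1 the sum telescopes: the part l s x a_l y^l / l! of the eigenvalue equals -a_l
  -- y^(l-1) / (l-1)!, which cancels the term `a l` produced by the bracket of `x` with `a (l - 1)`.
  linear_combination (a 1 + a 2 * y * (algebraMap k F (1 / 2) * 2)) * hyx - a 2 * y * half

/-- The exponential sum of the derivatives of a product. -/
theorem expSum_mul (s : k) (x : F) {a b c : ℕ → F} (a3 : a 3 = 0) (a4 : a 4 = 0) (b3 : b 3 = 0)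
    (b4 : b 4 = 0) (c0 : c 0 = a 0 * b 0) (c1 : c 1 = a 0 * b 1 + a 1 * b 0)
    (c2 : c 2 = a 0 * b 2 + 2 * (a 1 * b 1) + a 2 * b 0)
    (c3 : c 3 = 3 * (a 1 * b 2) + 3 * (a 2 * b 1)) (c4 : c 4 = 6 * (a 2 * b 2)) :
    expSum s x c = expSum s x a * expSum s x b := by
  -- The Leibniz coefficients divided by l! split as 1 / (i! j!): here 2/2! = 1, 3/3! = 1/2 and 6/4!
  -- = 1/2 · 1/2.
  have half : algebraMap k F (1 / 2) * 2 = 1 := by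
    rw [← map_ofNat (algebraMap k F) 2, ← map_mul]; simp
  have h6 : algebraMap k F (1 / 6) * 3 = algebraMap k F (1 / 2) := by
    rw [← map_ofNat (algebraMap k F) 3, ← map_mul]; norm_num
  have h24 : algebraMap k F (1 / 24) * 6 = algebraMap k F (1 / 2) * algebraMap k F (1 / 2) := by
    rw [← map_ofNat (algebraMap k F) 6, ← map_mul, ← map_mul]; norm_num
  rw [expSum_eq, expSum_eq, expSum_eq, a3, a4, b3, b4, c0, c1, c2, c3, c4]
  generalize -(algebraMap k F s * x)⁻¹ = y
  linear_combination a 1 * b 1 * y ^ 2 * half + (a 1 * b 2 + a 2 * b 1) * y ^ 3 * h6 +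
    a 2 * b 2 * y ^ 4 * h24

/-- The bracket of the exponential sums of two sequences of eigenvectors is the exponential sum of
the sequence started by the bracket of their initial terms. -/
theorem bracket_expSum_expSum (ρ : PoissonBracket k F) {x : F} (hx : x ≠ 0) {s w v : k}
    (hs : s ≠ 0) {a b c : ℕ → F} (a3 : a 3 = 0) (a4 : a 4 = 0) (b3 : b 3 = 0) (b4 : b 4 = 0)
    (ha : ∀ l : ℕ, ρ.bracket x (a l) = algebraMap k F (w + l * s) * a l * x + a (l + 1))
    (hb : ∀ l : ℕ, ρ.bracket x (b l) = algebraMap k F (v + l * s) * b l * x + b (l + 1))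
    (hc : ∀ l : ℕ, ρ.bracket x (c l) = algebraMap k F (w + v + l * s) * c l * x + c (l + 1))
    (c0 : c 0 = ρ.bracket (a 0) (b 0)) :
    ρ.bracket (expSum s x a) (expSum s x b) = expSum s x c := by
  have hs' : algebraMap k F s ≠ 0 := (map_ne_zero _).mpr hs
  -- The Jacobi identity with `x` yields the twisted Leibniz rule δ{a,b} = {δa,b} + {a,δb} + w a
  -- δ(b) - v δ(a) b for eigenvectors of weights w and v. The correction in `T i j` accumulates
  -- these twists, so that c_l = ∑ binom(l,i) T(i, l-i). In passing from l to l + 1 the remaining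
  -- terms with factor `s` in `hT` cancel between neighbours, as binom(l,i) i = binom(l,i-1)
  -- (l-i+1).
  let T : ℕ → ℕ → F := fun i j => ρ.bracket (a i) (b j) +
    (j * algebraMap k F (w + i * s) - i * algebraMap k F (v + j * s)) * a i * b j
  have hT : ∀ i j, ρ.bracket x (T i j) = algebraMap k F (w + i * s + (v + j * s)) * T i j * x +
      T (i + 1) j + T i (j + 1) + algebraMap k F s * (i * a i * b (j + 1) - j * a (i + 1) * b j) := by
    intro i j
    have e1 := ha i
    have e2 := hb j
    have e3 : ρ.bracket (a i) x = -(algebraMap k F (w + i * s) * a i * x + a (i + 1)) := by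
      rw [skew, e1]
    have n : ∀ (f : F) (i : ℕ), ρ.bracket f (i : F) = 0 := fun f i => by
      rw [← map_natCast (algebraMap k F), bracket_algebraMap_right]
    have n' : ∀ (f : F) (i : ℕ), ρ.bracket (i : F) f = 0 := fun f i => by
      rw [skew, n, neg_zero]
    simp only [T, map_add, map_sub, leibniz, bracket_bracket, e1, e2, e3, n, n', bracket_mul_left,
      LinearMap.add_apply, bracket_algebraMap_left, bracket_algebraMap_right, map_mul,
      map_natCast, Nat.cast_add, Nat.cast_one]
    ring
  have T0 : c 0 = T 0 0 := by simp [T, c0]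
  have Ta : ∀ j, T 3 j = 0 := fun j => by simp [T, a3]
  have Tb : ∀ i, T i 3 = 0 := fun i => by simp [T, b3]
  -- Each `c (l + 1)` is determined by `hc l`: it is the part of {x, c_l} left after its eigenvalue
  -- term. From l = 3 on, the terms with an index at least 3 vanish, since `a 3` and `b 3` do.
  have T1 : c 1 = T 1 0 + T 0 1 := by
    have h := hc 0
    rw [T0, hT] at h
    simp only [Nat.cast_zero, zero_mul, add_zero, sub_self, mul_zero, zero_add] at h
    linear_combination -h
  have T2 : c 2 = T 2 0 + 2 * T 1 1 + T 0 2 := by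
    have h := hc 1
    rw [T1, map_add, hT, hT] at h
    simp only [Nat.cast_zero, Nat.cast_one, zero_mul, one_mul, add_zero, zero_add, map_add,
      Nat.reduceAdd] at h
    linear_combination -h
  have T3 : c 3 = 3 * T 2 1 + 3 * T 1 2 := by
    have h := hc 2
    have two : ρ.bracket x 2 = 0 := by
      rw [← map_ofNat (algebraMap k F) 2, bracket_algebraMap_right]
    rw [T2, map_add, map_add, leibniz, two, hT, hT, hT] at h
    simp only [Nat.cast_zero, Nat.cast_one, Nat.cast_ofNat, zero_mul, one_mul, add_zero, zero_add,
      map_add, map_mul, map_ofNat, Nat.reduceAdd, Ta, Tb] at h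
    linear_combination -h
  have T4 : c 4 = 6 * T 2 2 := by
    have h := hc 3
    have three : ρ.bracket x 3 = 0 := by
      rw [← map_ofNat (algebraMap k F) 3, bracket_algebraMap_right]
    rw [T3, map_add, leibniz, leibniz, three, hT, hT] at h
    simp only [Nat.cast_one, Nat.cast_ofNat, zero_mul, one_mul, zero_add,
      map_add, map_mul, map_ofNat, Nat.reduceAdd, Ta, Tb, a3, b3] at h
    linear_combination -h
  set y := -(algebraMap k F s * x)⁻¹ with hy
  have hyx : algebraMap k F s * x * y = -1 := by rw [hy]; field_simp
  -- As y = -1/(s x), its derivative with respect to x is 1/(s x²) = s y².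
  have hyl : ∀ f, ρ.bracket y f = algebraMap k F s * y ^ 2 * ρ.bracket x f := by
    intro f
    rw [hy, map_neg, LinearMap.neg_apply, bracket_inv_left, bracket_mul_left,
      bracket_algebraMap_left]
    field_simp
    ring
  have ya : ∀ l : ℕ, ρ.bracket y (a l) = -algebraMap k F (w + l * s) * a l * y +
      algebraMap k F s * y ^ 2 * a (l + 1) := fun l => by
    rw [hyl, ha]
    linear_combination y * algebraMap k F (w + l * s) * a l * hyx
  have yb : ∀ l : ℕ, ρ.bracket y (b l) = -algebraMap k F (v + l * s) * b l * y +
      algebraMap k F s * y ^ 2 * b (l + 1) := fun l => by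
    rw [hyl, hb]
    linear_combination y * algebraMap k F (v + l * s) * b l * hyx
  have ay : ∀ l : ℕ, ρ.bracket (a l) y = algebraMap k F (w + l * s) * a l * y -
      algebraMap k F s * y ^ 2 * a (l + 1) := fun l => by
    rw [skew, ya]
    ring
  have half : algebraMap k F (1 / 2) * 2 = 1 := by
    rw [← map_ofNat (algebraMap k F) 2, ← map_mul]; simp
  have h6 : algebraMap k F (1 / 6) * 3 = algebraMap k F (1 / 2) := by
    rw [← map_ofNat (algebraMap k F) 3, ← map_mul]; norm_num
  have h24 : algebraMap k F (1 / 24) * 6 = algebraMap k F (1 / 2) * algebraMap k F (1 / 2) := by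
    rw [← map_ofNat (algebraMap k F) 6, ← map_mul, ← map_mul]; norm_num
  rw [expSum_eq, expSum_eq, expSum_eq, ← hy, a3, a4, b3, b4, T0, T1, T2, T3, T4]
  simp only [T, zero_mul, mul_zero, add_zero, map_add, leibniz, bracket_mul_left,
    bracket_algebraMap_right, bracket_algebraMap_left, pow_two, yb, ay, ρ.alt,
    LinearMap.add_apply, zero_add, Nat.cast_zero, Nat.cast_one, Nat.cast_ofNat, one_mul,
    map_mul, map_ofNat, map_natCast, a3, b3, Nat.reduceAdd]
  clear_value y
  generalize algebraMap k F (1 / 2) = p at *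
  generalize algebraMap k F (1 / 6) = p6 at *
  generalize algebraMap k F (1 / 24) = p24 at *
  generalize algebraMap k F w = w at *
  generalize algebraMap k F v = v at *
  generalize algebraMap k F s = s at *
  generalize ρ.bracket (a 1) (b 1) = g11
  generalize ρ.bracket (a 1) (b 2) = g12
  generalize ρ.bracket (a 2) (b 1) = g21
  generalize ρ.bracket (a 2) (b 2) = g22
  linear_combination (-(g11 + (w + s - (v + s)) * a 1 * b 1) * y ^ 2 -
      s * y ^ 3 * (a 1 * b 2 - a 2 * b 1)) * half -
    (g12 + (2 * (w + s) - (v + 2 * s)) * a 1 * b 2 + (g21 + ((w + 2 * s) - 2 * (v + s)) *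
      a 2 * b 1)) * y ^ 3 * h6 -
    (g22 + (2 * (w + 2 * s) - 2 * (v + 2 * s)) * a 2 * b 2) * y ^ 4 * h24

end ExponentialSum

/-! ### Deletable Poisson brackets on polynomial rings -/

section Deletion

variable {k : Type*} [Field k] {σ : Type*}

/-- The derivation of `k[X_s]` with `X_i ↦ Λ_{ui} X_i`. -/
noncomputable def weightDer (Λ : Matrix σ σ k) (u : σ) :
    Derivation k (MvPolynomial σ k) (MvPolynomial σ k) :=
  mkDerivation k fun i => C (Λ u i) * X i

/-- The difference between the bracket `{X_t, X_i}` and its log-canonical part. -/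
noncomputable def defect (π : PoissonBracket k (MvPolynomial σ k)) (Λ : Matrix σ σ k) (t i : σ) :
    MvPolynomial σ k :=
  π.bracket (X t) (X i) - C (Λ t i) * X t * X i

/-- The derivation of `k[X_s]` which maps `X_i` to the defect of `{X_t, X_i}` if `i` has smaller
rank than `t`, and to zero otherwise. -/
noncomputable def defectDer (π : PoissonBracket k (MvPolynomial σ k)) (Λ : Matrix σ σ k)
    (r : σ → ℕ) (t : σ) : Derivation k (MvPolynomial σ k) (MvPolynomial σ k) :=
  mkDerivation k fun i => if r i < r t then defect π Λ t i else 0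

/-- Conditions on a Poisson bracket on a polynomial algebra under which its indeterminates can
successively be replaced by log-canonical elements. The rank `r` orders the indeterminates as in an
iterated Poisson-Ore extension, `ν t i` bounds the order of nilpotency at `X_i` of the derivation
`defectDer π Λ r t`, and this derivation is homogeneous with respect to the weights given by the
rows of `Λ`, where the weight `Λ_{tt}` is replaced by `s t`. -/
structure IsDeletable (π : PoissonBracket k (MvPolynomial σ k)) (Λ : Matrix σ σ k) (r : σ → ℕ)
    (s : σ → k) (ν : σ → σ → ℕ) : Prop where
  rank_injective : Function.Injective r
  order_le : ∀ t i, ν t i ≤ 2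
  -- The exponential divides by `s t`; a zero eigenvalue is harmless if there is nothing to delete.
  ne_zero_or : ∀ t, s t ≠ 0 ∨ ∀ i, r i < r t → defect π Λ t i = 0
  -- The strict drop of `ν` gives nilpotency and allows the deletion to be inverted. The weight
  -- condition in row `t` is what the exponential sum needs. The conditions in the later rows `u`
  -- say that {X_t, X_i} is homogeneous for them, so that X_u stays log-canonical when δ_t is
  -- deleted.
  defect_mem : ∀ t i, r i < r t → defect π Λ t i ∈ Submodule.span k
    {f | ∃ a b, f = X a * X b ∧ r a < r t ∧ r b < r t ∧ ν t a + ν t b < ν t i ∧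
      Λ t a + Λ t b = Λ t i + s t ∧ ∀ u, r t < r u → Λ u a + Λ u b = Λ u i + Λ u t}

@[simp]
theorem weightDer_X (Λ : Matrix σ σ k) (u i : σ) : weightDer Λ u (X i) = C (Λ u i) * X i :=
  mkDerivation_X _ _ _

theorem defectDer_X_of_lt (π : PoissonBracket k (MvPolynomial σ k)) (Λ : Matrix σ σ k) {r : σ → ℕ}
    {t i : σ} (h : r i < r t) : defectDer π Λ r t (X i) = defect π Λ t i := by
  rw [defectDer, mkDerivation_X, if_pos h]

theorem defectDer_X_of_not_lt (π : PoissonBracket k (MvPolynomial σ k)) (Λ : Matrix σ σ k)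
    {r : σ → ℕ} {t i : σ} (h : ¬ r i < r t) : defectDer π Λ r t (X i) = 0 := by
  rw [defectDer, mkDerivation_X, if_neg h]

/-- A derivation maps a subalgebra generated by indeterminates into itself as soon as it does so
with the indeterminates. -/
theorem derivation_mem_supported (D : Derivation k (MvPolynomial σ k) (MvPolynomial σ k))
    {S : Set σ} (h : ∀ i ∈ S, D (X i) ∈ supported k S) {f : MvPolynomial σ k}
    (hf : f ∈ supported k S) : D f ∈ supported k S := by
  induction hf using Algebra.adjoin_induction with
  | mem x hx =>
    obtain ⟨i, hi, rfl⟩ := hx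
    exact h i hi
  | algebraMap c => rw [Derivation.map_algebraMap]; exact zero_mem _
  | add x y _ _ hx hy => rw [map_add]; exact add_mem hx hy
  | mul x y hx' hy' hx hy =>
    rw [Derivation.leibniz, smul_eq_mul, smul_eq_mul]
    exact add_mem (mul_mem hx' hy) (mul_mem hy' hx)

theorem X_mul_X_mem_supported {S : Set σ} {a b : σ} (ha : a ∈ S) (hb : b ∈ S) :
    (X a * X b : MvPolynomial σ k) ∈ supported k S :=
  mul_mem (Algebra.subset_adjoin ⟨a, ha, rfl⟩) (Algebra.subset_adjoin ⟨b, hb, rfl⟩)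

/-- If `{x, φ X_i} = φ (D X_i) x + φ (E X_i)` for derivations `D` and `E`, then the same holds for
all elements of the subalgebra generated by these `X_i`. -/
theorem bracket_map_supported {F : Type*} [Field F] [Algebra k F] (ρ : PoissonBracket k F)
    (φ : MvPolynomial σ k →ₐ[k] F) (x : F)
    (D E : Derivation k (MvPolynomial σ k) (MvPolynomial σ k)) {S : Set σ}
    (h : ∀ i ∈ S, ρ.bracket x (φ (X i)) = φ (D (X i)) * x + φ (E (X i)))
    {f : MvPolynomial σ k} (hf : f ∈ supported k S) :
    ρ.bracket x (φ f) = φ (D f) * x + φ (E f) := by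
  induction hf using Algebra.adjoin_induction with
  | mem f hf =>
    obtain ⟨i, hi, rfl⟩ := hf
    exact h i hi
  | algebraMap c =>
    rw [Derivation.map_algebraMap, Derivation.map_algebraMap, φ.commutes,
      bracket_algebraMap_right, map_zero, zero_mul, add_zero]
  | add f g _ _ hf hg => simp only [map_add, hf, hg]; ring
  | mul f g _ _ hf hg =>
    simp only [map_mul, ρ.leibniz, hf, hg, Derivation.leibniz, map_add, smul_eq_mul]
    ring

namespace IsDeletable

variable {π : PoissonBracket k (MvPolynomial σ k)} {Λ : Matrix σ σ k} {r : σ → ℕ} {s : σ → k}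
  {ν : σ → σ → ℕ}

theorem defect_mem_supported (h : IsDeletable π Λ r s ν) {t i : σ} (hi : r i < r t) :
    defect π Λ t i ∈ supported k {a | r a < r t} := by
  refine (Submodule.span_le (p := Subalgebra.toSubmodule (supported k {a | r a < r t}))).mpr ?_
    (h.defect_mem t i hi)
  rintro _ ⟨a, b, rfl, ha, hb, -⟩
  exact X_mul_X_mem_supported ha hb

theorem defectDer_mem_supported (h : IsDeletable π Λ r s ν) {t : σ} {f : MvPolynomial σ k}
    (hf : f ∈ supported k {a | r a < r t}) :
    defectDer π Λ r t f ∈ supported k {a | r a < r t} :=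
  derivation_mem_supported _ (fun i hi => by
    rw [defectDer_X_of_lt π Λ hi]
    exact h.defect_mem_supported hi) hf

theorem iterate_defectDer_mem_supported (h : IsDeletable π Λ r s ν) {t : σ} {f : MvPolynomial σ k}
    (hf : f ∈ supported k {a | r a < r t}) (l : ℕ) :
    (defectDer π Λ r t)^[l] f ∈ supported k {a | r a < r t} := by
  induction l with
  | zero => exact hf
  | succ l ih => rw [Function.iterate_succ_apply']; exact h.defectDer_mem_supported ih

theorem weightDer_of_mem_span {u : σ} {c : k} {f : MvPolynomial σ k}
    (hf : f ∈ Submodule.span k {f | ∃ a b, f = X a * X b ∧ Λ u a + Λ u b = c}) :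
    weightDer Λ u f = c • f := by
  induction hf using Submodule.span_induction with
  | mem f hf =>
    obtain ⟨a, b, rfl, h⟩ := hf
    rw [Derivation.leibniz, weightDer_X, weightDer_X, ← h, MvPolynomial.smul_eq_C_mul, C_add]
    simp only [smul_eq_mul]
    ring
  | zero => simp
  | add f g _ _ hf hg => rw [map_add, hf, hg, smul_add]
  | smul d f _ hf => rw [Derivation.map_smul, hf, smul_comm]

/-- The weight of the derivation `defectDer π Λ r t` with respect to `weightDer Λ u`. -/
theorem weightDer_defectDer (h : IsDeletable π Λ r s ν) {t u : σ} {c : k}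
    (hc : (u = t ∧ c = s t) ∨ (r t < r u ∧ c = Λ u t)) (f : MvPolynomial σ k) :
    weightDer Λ u (defectDer π Λ r t f) =
      defectDer π Λ r t (weightDer Λ u f) + c • defectDer π Λ r t f := by
  -- The commutator is again a derivation, so the claim needs checking only on the indeterminates,
  -- where it is the weight condition in `defect_mem`.
  have key : ⁅weightDer Λ u, defectDer π Λ r t⁆ = c • defectDer π Λ r t := by
    refine MvPolynomial.derivation_ext fun i => ?_
    rw [Derivation.commutator_apply, weightDer_X, Derivation.leibniz, MvPolynomial.derivation_C,
      Derivation.smul_apply, smul_zero, add_zero]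
    by_cases hi : r i < r t
    · rw [defectDer_X_of_lt π Λ hi, weightDer_of_mem_span (c := Λ u i + c)
        (Submodule.span_mono ?_ (h.defect_mem t i hi)), add_smul, MvPolynomial.smul_eq_C_mul,
        smul_eq_mul, add_sub_cancel_left]
      rintro _ ⟨a, b, rfl, -, -, -, h1, h2⟩
      refine ⟨a, b, rfl, ?_⟩
      rcases hc with ⟨rfl, rfl⟩ | ⟨hu, rfl⟩
      · exact h1
      · exact h2 u hu
    · rw [defectDer_X_of_not_lt π Λ hi]
      simp
  have := congrArg (fun d => d f) key
  rw [Derivation.commutator_apply, Derivation.smul_apply] at this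
  rw [← this]
  ring

/-- Each application of δ_t raises the weight by `c`. This produces the eigenvalues `w + l * c`
required of the sequences in exponential sums: `c = s t` for the row of X_t itself, `c = Λ u t` for
the later rows. -/
theorem weightDer_iterate_defectDer (h : IsDeletable π Λ r s ν) {t u : σ} {c w : k}
    (hc : (u = t ∧ c = s t) ∨ (r t < r u ∧ c = Λ u t)) {f : MvPolynomial σ k}
    (hf : weightDer Λ u f = w • f) (l : ℕ) :
    weightDer Λ u ((defectDer π Λ r t)^[l] f) = (w + l * c) • (defectDer π Λ r t)^[l] f := by
  induction l with
  | zero => simpa using hf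
  | succ l ih =>
    rw [Function.iterate_succ_apply', h.weightDer_defectDer hc, ih, Derivation.map_smul, ← add_smul]
    congr 1
    push_cast
    ring

/-- By `defect_mem`, δ_t X_i is a combination of products whose total order is smaller than that of
X_i. If ν_a + ν_b < m, the Leibniz rule gives δ^m(X_a X_b) = 0, so an induction on the order works;
only orders up to 2 are needed. -/
theorem iterate_defectDer_X (h : IsDeletable π Λ r s ν) {t : σ} (m : ℕ) :
    ∀ i, ν t i ≤ m → m ≤ 2 → (defectDer π Λ r t)^[m + 1] (X i) = 0 := by
  have key : ∀ (D : Derivation k (MvPolynomial σ k) (MvPolynomial σ k)) (i : σ),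
      D = defectDer π Λ r t → ∀ (m : ℕ) (L : MvPolynomial σ k →ₗ[k] MvPolynomial σ k),
      ν t i ≤ m → (∀ a b, ν t a + ν t b < m → L (X a * X b) = 0) → L (D (X i)) = 0 := by
    rintro D i rfl m L hm hL
    by_cases hi : r i < r t
    · rw [defectDer_X_of_lt π Λ hi]
      refine (Submodule.span_le (p := LinearMap.ker L)).mpr ?_ (h.defect_mem t i hi)
      rintro _ ⟨a, b, rfl, -, -, hab, -⟩
      exact hL a b (hab.trans_le hm)
    · rw [defectDer_X_of_not_lt π Λ hi, map_zero]
  generalize hD : defectDer π Λ r t = D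
  have k0 : ∀ i, ν t i ≤ 0 → D (X i) = 0 := fun i hi =>
    key D i hD.symm 0 LinearMap.id hi fun a b hab => absurd hab (Nat.not_lt_zero _)
  have k1 : ∀ i, ν t i ≤ 1 → D (D (X i)) = 0 := fun i hi =>
    key D i hD.symm 1 D.toLinearMap hi fun a b hab => by
      change D (X a * X b) = 0
      rw [Derivation.leibniz, k0 a (by omega), k0 b (by omega), smul_zero, smul_zero, add_zero]
  have k2 : ∀ i, ν t i ≤ 2 → D (D (D (X i))) = 0 := fun i hi =>
    key D i hD.symm 2 (D.toLinearMap.comp D.toLinearMap) hi fun a b hab => by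
      change D (D (X a * X b)) = 0
      -- Two orders with sum at most 1: one of them is zero, so its factor is a constant for `D`,
      -- and `D²` kills the other factor.
      have : D (X a) = 0 ∨ D (X b) = 0 := by
        rcases Nat.eq_zero_or_pos (ν t a) with ha | ha
        · exact .inl (k0 a ha.le)
        · exact .inr (k0 b (by omega))
      rcases this with h0 | h0 <;>
        simp [Derivation.leibniz, h0, k1 a (by omega), k1 b (by omega)]
  intro i hi hm
  interval_cases m
  · exact k0 i hi
  · exact k1 i hi
  · exact k2 i hi

theorem iterate_three_defectDer_X (h : IsDeletable π Λ r s ν) (t i : σ) :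
    (defectDer π Λ r t)^[3] (X i) = 0 :=
  h.iterate_defectDer_X 2 i (h.order_le t i) le_rfl

theorem iterate_four_defectDer_X (h : IsDeletable π Λ r s ν) (t i : σ) :
    (defectDer π Λ r t)^[4] (X i) = 0 := by
  rw [Function.iterate_succ_apply', h.iterate_three_defectDer_X, map_zero]

/-- The brackets of two indeterminates of smaller rank than `t`. -/
theorem bracket_mem_span (h : IsDeletable π Λ r s ν) {t i j : σ} (hi : r i < r t) (hj : r j < r t) :
    π.bracket (X i) (X j) ∈ Submodule.span k
      {f | ∃ a b, f = X a * X b ∧ r a < r t ∧ r b < r t ∧ Λ t a + Λ t b = Λ t i + Λ t j} := by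
  have key : ∀ i j, r j < r i → r i < r t → π.bracket (X i) (X j) ∈ Submodule.span k
      {f | ∃ a b, f = X a * X b ∧ r a < r t ∧ r b < r t ∧ Λ t a + Λ t b = Λ t i + Λ t j} := by
    intro i j hij hi
    have e : π.bracket (X i) (X j) = Λ i j • (X i * X j) + defect π Λ i j := by
      rw [defect, MvPolynomial.smul_eq_C_mul]
      ring
    rw [e]
    refine add_mem (Submodule.smul_mem _ _ (Submodule.subset_span ⟨i, j, rfl, hi, hij.trans hi, rfl⟩))
      -- The weight in row `t` comes from the last clause of `defect_mem` for the pair i, j, taken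
      -- at `u = t`.
      (Submodule.span_mono ?_ (h.defect_mem i j hij))
    rintro _ ⟨a, b, rfl, ha, hb, -, -, hab⟩
    exact ⟨a, b, rfl, ha.trans hi, hb.trans hi, by rw [hab t hi, add_comm]⟩
  rcases lt_trichotomy (r i) (r j) with hij | hij | hij
  · rw [π.skew, add_comm]
    exact Submodule.neg_mem _ (key j i hij hj)
  · rw [h.rank_injective hij, π.alt]
    exact zero_mem _
  · exact key i j hij hi

end IsDeletable

end Deletion

/-! ### Linearity and weights of exponential sums -/

section ExponentialSumLemmas

variable {k F : Type*} [Field k] [Field F] [Algebra k F]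

theorem expSum_add (s : k) (x : F) (a b : ℕ → F) :
    expSum s x (fun l => a l + b l) = expSum s x a + expSum s x b := by
  simp only [expSum, ← Finset.sum_add_distrib, add_mul, mul_add]

theorem expSum_smul (s : k) (x : F) (c : k) (a : ℕ → F) :
    expSum s x (fun l => c • a l) = c • expSum s x a := by
  simp only [expSum, Finset.smul_sum, smul_mul_assoc, mul_smul_comm]

/-- The bracket of an element with an exponential sum of its eigenvectors. -/
theorem bracket_expSum_of_weight (ρ : PoissonBracket k F) {x v : F} (s : k) {c w : k} {a : ℕ → F}
    (hx : ρ.bracket v x = algebraMap k F c * v * x)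
    (ha : ∀ l : ℕ, ρ.bracket v (a l) = algebraMap k F (w + l * c) * a l * v) :
    ρ.bracket v (expSum s x a) = algebraMap k F w * v * expSum s x a := by
  have hy : ρ.bracket v (-(algebraMap k F s * x)⁻¹) =
      -algebraMap k F c * v * (-(algebraMap k F s * x)⁻¹) := by
    by_cases h : algebraMap k F s * x = 0
    · simp [h]
    · obtain ⟨hs, hx0⟩ := mul_ne_zero_iff.mp h
      rw [map_neg, bracket_inv_right, leibniz, bracket_algebraMap_right, hx]
      field_simp
      ring
  rw [expSum, map_sum, Finset.mul_sum]
  refine Finset.sum_congr rfl fun l hl => ?_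
  clear hl
  generalize -(algebraMap k F s * x)⁻¹ = y at *
  -- The factor y^l has weight -l c for `v`, which compensates the weight `w + l * c` of `a l`; all
  -- terms thus have weight `w`.
  have hyl : ρ.bracket v (y ^ l) = -(l * algebraMap k F c) * v * y ^ l := by
    induction l with
    | zero => rw [pow_zero, ← map_one (algebraMap k F), bracket_algebraMap_right]; simp
    | succ l ih => rw [pow_succ, leibniz, ih, hy]; push_cast; ring
  rw [leibniz, leibniz, hyl, bracket_algebraMap_right, ha]
  simp only [map_add, map_mul, map_natCast]
  ring

end ExponentialSumLemmas

/-! ### Deletion of one derivation -/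

section DeletionStep

variable {k : Type*} [Field k] {σ : Type*}

theorem iterate_derivation_add {A : Type*} [CommRing A] [Algebra k A] (D : Derivation k A A)
    (l : ℕ) (f g : A) : D^[l] (f + g) = D^[l] f + D^[l] g := by
  induction l with
  | zero => rfl
  | succ l ih => simp only [Function.iterate_succ_apply', ih, map_add]

theorem iterate_derivation_smul {A : Type*} [CommRing A] [Algebra k A] (D : Derivation k A A)
    (l : ℕ) (c : k) (f : A) : D^[l] (c • f) = c • D^[l] f := by
  induction l with
  | zero => rfl
  | succ l ih => simp only [Function.iterate_succ_apply', ih, Derivation.map_smul]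

/-- `φ` is compatible with the brackets of the indeterminates of rank below `N`, and the images of
the remaining indeterminates are log-canonical. -/
structure IsLogCanonicalFrom {F : Type*} [Field F] [Algebra k F]
    (π : PoissonBracket k (MvPolynomial σ k)) (Λ : Matrix σ σ k) (r : σ → ℕ)
    (ρ : PoissonBracket k F) (N : ℕ) (φ : MvPolynomial σ k →ₐ[k] F) : Prop where
  map_bracket : ∀ i j, r i < N → r j < N →
    φ (π.bracket (X i) (X j)) = ρ.bracket (φ (X i)) (φ (X j))
  logCanonical : ∀ u i, N ≤ r u →
    ρ.bracket (φ (X u)) (φ (X i)) = algebraMap k F (Λ u i) * φ (X u) * φ (X i)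

namespace IsDeletable

variable {π : PoissonBracket k (MvPolynomial σ k)} {Λ : Matrix σ σ k} {r : σ → ℕ} {s : σ → k}
  {ν : σ → σ → ℕ} {F : Type*} [Field F] [Algebra k F] {ρ : PoissonBracket k F}
  {φ : MvPolynomial σ k →ₐ[k] F}

/-- The homomorphism obtained from `φ` by deleting the derivation attached to `X_t`. -/
noncomputable def deletionHom (π : PoissonBracket k (MvPolynomial σ k)) (Λ : Matrix σ σ k)
    (r : σ → ℕ) (s : σ → k) (φ : MvPolynomial σ k →ₐ[k] F) (t : σ) : MvPolynomial σ k →ₐ[k] F :=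
  aeval fun i => if r i < r t then
    expSum (s t) (φ (X t)) (fun l => φ ((defectDer π Λ r t)^[l] (X i))) else φ (X i)

theorem deletionHom_X_of_lt {t i : σ} (h : r i < r t) :
    deletionHom π Λ r s φ t (X i) =
      expSum (s t) (φ (X t)) (fun l => φ ((defectDer π Λ r t)^[l] (X i))) := by
  rw [deletionHom, aeval_X, if_pos h]

theorem deletionHom_X_of_not_lt {t i : σ} (h : ¬ r i < r t) :
    deletionHom π Λ r s φ t (X i) = φ (X i) := by
  rw [deletionHom, aeval_X, if_neg h]

/-- Deletion is triangular: the new image of X_i differs from φ(X_i) by multiples of φ(δX_i) and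
φ(δ²X_i), which involve only indeterminates of smaller order, while φ(X_t) is unchanged. Induction
on the order recovers the old images. -/
theorem mem_adjoin_deletionHom [CharZero k] (h : IsDeletable π Λ r s ν) (t i : σ) :
    φ (X i) ∈ IntermediateField.adjoin k (Set.range fun j => deletionHom π Λ r s φ t (X j)) := by
  set E := IntermediateField.adjoin k (Set.range fun j => deletionHom π Λ r s φ t (X j))
  have hE : ∀ j, deletionHom π Λ r s φ t (X j) ∈ E := fun j =>
    IntermediateField.subset_adjoin _ _ ⟨j, rfl⟩
  have hge : ∀ j, ¬ r j < r t → φ (X j) ∈ E := fun j hj => by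
    have := hE j
    rwa [deletionHom_X_of_not_lt hj] at this
  suffices ∀ m i, ν t i = m → φ (X i) ∈ E from this _ i rfl
  intro m
  induction m using Nat.strong_induction_on with
  | _ m ih =>
  intro i hm
  by_cases hi : r i < r t
  swap
  · exact hge i hi
  have span_mem : ∀ (L : MvPolynomial σ k →ₗ[k] F) (j : σ),
      (∀ a b, ν t a + ν t b < ν t j → L (X a * X b) ∈ E) →
      L (defectDer π Λ r t (X j)) ∈ E := by
    intro L j hL
    by_cases hj : r j < r t
    · rw [defectDer_X_of_lt π Λ hj]
      refine (Submodule.span_le (p := (Subalgebra.toSubmodule E.toSubalgebra).comap L)).mpr ?_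
        (h.defect_mem t j hj)
      rintro _ ⟨a, b, rfl, -, -, hab, -⟩
      exact hL a b hab
    · rw [defectDer_X_of_not_lt π Λ hj, map_zero]
      exact zero_mem _
  have h1 : ∀ j, ν t j ≤ m → φ (defectDer π Λ r t (X j)) ∈ E := fun j hj =>
    span_mem φ.toLinearMap j fun a b hab => by
      change φ (X a * X b) ∈ E
      rw [map_mul]
      exact mul_mem (ih _ (by omega) a rfl) (ih _ (by omega) b rfl)
  have h2 : φ (defectDer π Λ r t (defectDer π Λ r t (X i))) ∈ E :=
    span_mem (φ.toLinearMap.comp (defectDer π Λ r t).toLinearMap) i fun a b hab => by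
      change φ (defectDer π Λ r t (X a * X b)) ∈ E
      rw [Derivation.leibniz, map_add, smul_eq_mul, smul_eq_mul, map_mul, map_mul]
      exact add_mem (mul_mem (ih _ (by omega) a rfl) (h1 b (by omega)))
        (mul_mem (ih _ (by omega) b rfl) (h1 a (by omega)))
  have hx : -(algebraMap k F (s t) * φ (X t))⁻¹ ∈ E :=
    neg_mem (inv_mem (mul_mem (E.algebraMap_mem _) (hge t (lt_irrefl _))))
  have e := hE i
  rw [deletionHom_X_of_lt hi, expSum_eq, h.iterate_three_defectDer_X, h.iterate_four_defectDer_X,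
    map_zero, zero_mul, zero_mul, mul_zero, mul_zero, add_zero, add_zero] at e
  have e2 : algebraMap k F (1 / 2) * (φ ((defectDer π Λ r t)^[2] (X i)) *
      (-(algebraMap k F (s t) * φ (X t))⁻¹) ^ 2) ∈ E :=
    mul_mem (E.algebraMap_mem _) (mul_mem h2 (pow_mem hx 2))
  have e1 : φ ((defectDer π Λ r t)^[1] (X i)) * (-(algebraMap k F (s t) * φ (X t))⁻¹) ∈ E :=
    mul_mem (h1 i hm.le) hx
  have := sub_mem (sub_mem e e2) e1
  rwa [add_sub_cancel_right, add_sub_cancel_right] at this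

/-- The exponential is multiplicative, so the formula defining the deletion on indeterminates
extends to sums of products of two of them. This covers {X_i, X_j}, and it is as far as the
truncated sum is meant to reach. -/
theorem deletionHom_of_mem_span [CharZero k] (h : IsDeletable π Λ r s ν) {t : σ}
    {f : MvPolynomial σ k}
    (hf : f ∈ Submodule.span k {f | ∃ a b, f = X a * X b ∧ r a < r t ∧ r b < r t}) :
    deletionHom π Λ r s φ t f =
      expSum (s t) (φ (X t)) (fun l => φ ((defectDer π Λ r t)^[l] f)) := by
  induction hf using Submodule.span_induction with
  | mem f hf =>
    obtain ⟨a, b, rfl, ha, hb⟩ := hf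
    have a3 := h.iterate_three_defectDer_X t a
    have b3 := h.iterate_three_defectDer_X t b
    rw [map_mul, deletionHom_X_of_lt ha, deletionHom_X_of_lt hb]
    symm
    apply expSum_mul
    · rw [a3, map_zero]
    · rw [h.iterate_four_defectDer_X, map_zero]
    · rw [b3, map_zero]
    · rw [h.iterate_four_defectDer_X, map_zero]
    all_goals
      simp only [Function.iterate_succ_apply', Function.iterate_zero_apply] at a3 b3 ⊢
      simp only [Derivation.leibniz, map_add, smul_eq_mul, map_mul, a3, b3, mul_zero,
        add_zero, zero_add]
      try ring
  | zero =>
    have := expSum_smul (s t) (φ (X t)) (0 : k) (fun l => φ ((defectDer π Λ r t)^[l] 0))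
    simp only [← map_smul, ← iterate_derivation_smul, zero_smul] at this
    rw [this, map_zero]
  | add f g _ _ hf hg =>
    simp only [map_add, hf, hg, iterate_derivation_add, expSum_add]
  | smul c f _ hf =>
    simp only [map_smul, hf, iterate_derivation_smul, expSum_smul]

/-- On the subalgebra below `t`, φ(X_t) acts by {x, φ f} = φ(D_t f) x + φ(δ_t f), so the iterates
δ_t^l f of an eigenvector f form a sequence as in the lemmas on exponential sums. These give in turn
the brackets of two earlier elements (`bracket_expSum_expSum`), of X_t with an earlier one
(`bracket_expSum`), and of a later X_u with an earlier one (`bracket_expSum_of_weight`). Elements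
from rank `r t` on do not change. -/
theorem isLogCanonicalFrom_deletionHom [CharZero k] (h : IsDeletable π Λ r s ν)
    (hΛ : Λ.transpose = -Λ) {t : σ} (hφ : IsLogCanonicalFrom π Λ r ρ (r t + 1) φ)
    (hx : φ (X t) ≠ 0) (hs : s t ≠ 0) :
    IsLogCanonicalFrom π Λ r ρ (r t) (deletionHom π Λ r s φ t) := by
  have hbr : ∀ {f : MvPolynomial σ k} {w : k}, f ∈ supported k {a | r a < r t} →
      weightDer Λ t f = w • f → ∀ l : ℕ,
      ρ.bracket (φ (X t)) (φ ((defectDer π Λ r t)^[l] f)) =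
        algebraMap k F (w + l * s t) * φ ((defectDer π Λ r t)^[l] f) * φ (X t) +
          φ ((defectDer π Λ r t)^[l + 1] f) := by
    intro f w hf hw l
    rw [bracket_map_supported ρ φ (φ (X t)) (weightDer Λ t) (defectDer π Λ r t)
      (S := {a | r a < r t}) ?_ (h.iterate_defectDer_mem_supported hf l),
      h.weightDer_iterate_defectDer (.inl ⟨rfl, rfl⟩) hw, map_smul, Algebra.smul_def,
      Function.iterate_succ_apply']
    intro i hi
    have hi' : r i < r t := hi
    rw [← hφ.map_bracket t i (Nat.lt_succ_self _) (hi'.trans (Nat.lt_succ_self _)),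
      defectDer_X_of_lt π Λ hi, ← map_mul, ← map_add, weightDer_X, defect]
    congr 1
    ring
  have hX : ∀ {i}, r i < r t → (X i : MvPolynomial σ k) ∈ supported k {a | r a < r t} :=
    fun {i} hi => Algebra.subset_adjoin ⟨i, hi, rfl⟩
  have hwX : ∀ u i, weightDer Λ u (X i) = Λ u i • X i := fun u i => by
    rw [weightDer_X, MvPolynomial.smul_eq_C_mul]
  have z3 : ∀ i, φ ((defectDer π Λ r t)^[3] (X i)) = 0 := fun i => by
    rw [h.iterate_three_defectDer_X, map_zero]
  have z4 : ∀ i, φ ((defectDer π Λ r t)^[4] (X i)) = 0 := fun i => by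
    rw [h.iterate_four_defectDer_X, map_zero]
  refine ⟨fun i j hi hj => ?_, fun u i hu => ?_⟩
  · have hmem := h.bracket_mem_span hi hj
    have hw : weightDer Λ t (π.bracket (X i) (X j)) = (Λ t i + Λ t j) • π.bracket (X i) (X j) := by
      refine weightDer_of_mem_span (Submodule.span_mono ?_ hmem)
      rintro _ ⟨a, b, rfl, -, -, hab⟩
      exact ⟨a, b, rfl, hab⟩
    have hsup : π.bracket (X i) (X j) ∈ supported k {a | r a < r t} := by
      refine (Submodule.span_le
        (p := Subalgebra.toSubmodule (supported k {a | r a < r t}))).mpr ?_ hmem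
      rintro _ ⟨a, b, rfl, ha, hb, -⟩
      exact X_mul_X_mem_supported ha hb
    rw [h.deletionHom_of_mem_span (Submodule.span_mono ?_ hmem), deletionHom_X_of_lt hi,
      deletionHom_X_of_lt hj]
    · exact (bracket_expSum_expSum ρ hx hs (z3 i) (z4 i) (z3 j) (z4 j) (hbr (hX hi) (hwX t i))
        (hbr (hX hj) (hwX t j)) (hbr hsup hw)
        (hφ.map_bracket i j (Nat.lt_succ_of_lt hi) (Nat.lt_succ_of_lt hj))).symm
    · rintro _ ⟨a, b, rfl, ha, hb, -⟩
      exact ⟨a, b, rfl, ha, hb⟩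
  · rw [deletionHom_X_of_not_lt hu.not_gt]
    by_cases hi : r i < r t
    · rw [deletionHom_X_of_lt hi]
      rcases hu.eq_or_lt with hu | hu
      · rw [← h.rank_injective hu]
        exact bracket_expSum ρ hx hs (z3 i) (z4 i) (hbr (hX hi) (hwX t i))
      · refine bracket_expSum_of_weight ρ (s t) (hφ.logCanonical u t hu) fun l => ?_
        -- A later X_u is already log-canonical against every indeterminate, so it acts on all
        -- images through its weight derivation alone.
        rw [bracket_map_supported ρ φ (φ (X u)) (weightDer Λ u) 0 (S := Set.univ) ?_ ?_,
          h.weightDer_iterate_defectDer (.inr ⟨hu, rfl⟩) (hwX u i), map_smul, Algebra.smul_def,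
          Derivation.zero_apply, map_zero, add_zero]
        · intro j _
          rw [hφ.logCanonical u j hu, hwX, map_smul, Algebra.smul_def, Derivation.zero_apply,
            map_zero]
          ring
        · rw [supported_univ]
          exact Algebra.mem_top
    · rw [deletionHom_X_of_not_lt hi]
      rcases hu.eq_or_lt with hu | hu
      · rcases (not_lt.mp hi).eq_or_lt with hi | hi
        · rw [← h.rank_injective hu, ← h.rank_injective hi, ρ.alt, diag_zero hΛ]
          simp
        · rw [ρ.skew, hφ.logCanonical i u hi, skew_apply hΛ u i, map_neg]
          ring
      · exact hφ.logCanonical u i hu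

/-- Passage from rank `N + 1` to rank `N`. -/
theorem exists_isLogCanonicalFrom [CharZero k] (h : IsDeletable π Λ r s ν)
    (hΛ : Λ.transpose = -Λ) {N : ℕ} (hφ : IsLogCanonicalFrom π Λ r ρ (N + 1) φ) :
    ∃ ψ : MvPolynomial σ k →ₐ[k] F, IsLogCanonicalFrom π Λ r ρ N ψ ∧
      ∀ i, φ (X i) ∈ IntermediateField.adjoin k (Set.range fun j => ψ (X j)) := by
  have same : (∀ u i, r u = N →
      ρ.bracket (φ (X u)) (φ (X i)) = algebraMap k F (Λ u i) * φ (X u) * φ (X i)) →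
      ∃ ψ : MvPolynomial σ k →ₐ[k] F, IsLogCanonicalFrom π Λ r ρ N ψ ∧
        ∀ i, φ (X i) ∈ IntermediateField.adjoin k (Set.range fun j => ψ (X j)) := by
    intro hN
    refine ⟨φ, ⟨fun i j hi hj => hφ.map_bracket i j (by omega) (by omega), fun u i hu => ?_⟩,
      fun i => IntermediateField.subset_adjoin _ _ ⟨i, rfl⟩⟩
    rcases hu.eq_or_lt with hu | hu
    · exact hN u i hu.symm
    · exact hφ.logCanonical u i hu
  -- Ranks need not be consecutive; at an unused rank nothing changes.
  by_cases ht : ∃ t, r t = N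
  swap
  · exact same fun u i hu => absurd ⟨u, hu⟩ ht
  obtain ⟨t, rfl⟩ := ht
  -- This occurs when X_t lies in the kernel of φ. All brackets with zero vanish, so X_t is
  -- log-canonical without any deletion.
  by_cases hx : φ (X t) = 0
  · refine same fun u i hu => ?_
    rw [h.rank_injective hu, hx]
    simp
  rcases h.ne_zero_or t with hs | hs
  · exact ⟨_, h.isLogCanonicalFrom_deletionHom hΛ hφ hx hs, h.mem_adjoin_deletionHom t⟩
  · refine same fun u i hu => ?_
    rw [h.rank_injective hu]
    rcases lt_trichotomy (r i) (r t) with hi | hi | hi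
    · rw [← hφ.map_bracket t i (by omega) (by omega), sub_eq_zero.mp (hs i hi), map_mul, map_mul,
        ← MvPolynomial.algebraMap_eq, φ.commutes]
    · rw [h.rank_injective hi, ρ.alt, diag_zero hΛ]
      simp
    · rw [ρ.skew, hφ.logCanonical i t hi, skew_apply hΛ t i, map_neg]
      ring

end IsDeletable

end DeletionStep

/-- Descending induction on the rank. Above the largest rank the log-canonical condition is vacuous
and φ is a Poisson homomorphism; at rank zero every pair of images is log-canonical. The generated
field can only grow along the way. -/
theorem IsDeletable.hasLogCanonicalImages {k : Type u} [Field k] [CharZero k] {σ : Type} [Finite σ]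
    {π : PoissonBracket k (MvPolynomial σ k)} {Λ : Matrix σ σ k} {r : σ → ℕ} {s : σ → k}
    {ν : σ → σ → ℕ} (h : IsDeletable π Λ r s ν) (hΛ : Λ.transpose = -Λ) :
    HasLogCanonicalImages π Λ := by
  intro F _ _ ρ φ hφ
  have key : ∀ (N : ℕ) (φ : MvPolynomial σ k →ₐ[k] F), IsLogCanonicalFrom π Λ r ρ N φ →
      ∃ y : σ → F, (∀ s t, ρ.bracket (y s) (y t) = algebraMap k F (Λ s t) * y s * y t) ∧
        ∀ s, φ (X s) ∈ IntermediateField.adjoin k (Set.range y) := by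
    intro N
    induction N with
    | zero =>
      intro φ hφ
      exact ⟨fun i => φ (X i), fun s t => hφ.logCanonical s t (Nat.zero_le _), fun s =>
        IntermediateField.subset_adjoin _ _ ⟨s, rfl⟩⟩
    | succ N ih =>
      intro φ hφ
      obtain ⟨ψ, hψ, hmem⟩ := h.exists_isLogCanonicalFrom hΛ hφ
      obtain ⟨y, hy, hy'⟩ := ih ψ hψ
      refine ⟨y, hy, fun s => ?_⟩
      have : IntermediateField.adjoin k (Set.range fun j => ψ (X j)) ≤
          IntermediateField.adjoin k (Set.range y) := by
        rw [IntermediateField.adjoin_le_iff]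
        rintro _ ⟨j, rfl⟩
        exact hy' j
      exact this (hmem s)
  obtain ⟨N, hN⟩ := (Set.finite_range r).bddAbove
  refine key (N + 1) φ ⟨fun i j _ _ => hφ _ _, fun u i hu => ?_⟩
  have := hN ⟨u, rfl⟩
  omega

/-! ### Lexicographic ranks and signs -/

section RankAndSign

/-- The rank of a pair of indices in the lexicographic order. -/
def lexRank {n : ℕ} (a : Fin n × Fin n) : ℕ := a.1.val * n + a.2.val

theorem lexRank_lt_of_lexLT {n : ℕ} {a b : Fin n × Fin n} (h : LexLT a b) :
    lexRank a < lexRank b := by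
  unfold lexRank
  rcases h with h | ⟨h1, h2⟩
  · have : (a.1.val + 1) * n ≤ b.1.val * n := Nat.mul_le_mul_right n h
    have := a.2.isLt
    rw [Nat.add_mul] at *
    omega
  · rw [h1]
    exact Nat.add_lt_add_left h2 _

theorem lexLT_trichotomy {n : ℕ} (a b : Fin n × Fin n) : LexLT a b ∨ a = b ∨ LexLT b a := by
  unfold LexLT
  rcases lt_trichotomy a.1 b.1 with h | h | h
  · exact .inl (.inl h)
  · rcases lt_trichotomy a.2 b.2 with h' | h' | h'
    · exact .inl (.inr ⟨h, h'⟩)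
    · exact .inr (.inl (Prod.ext h h'))
    · exact .inr (.inr (.inr ⟨h.symm, h'⟩))
  · exact .inr (.inr (.inl h))

theorem lexRank_lt_iff {n : ℕ} {a b : Fin n × Fin n} : lexRank a < lexRank b ↔ LexLT a b := by
  refine ⟨fun h => ?_, lexRank_lt_of_lexLT⟩
  rcases lexLT_trichotomy a b with h' | rfl | h'
  · exact h'
  · exact absurd h (lt_irrefl _)
  · exact absurd (lexRank_lt_of_lexLT h') h.not_gt

theorem lexRank_injective {n : ℕ} : Function.Injective (lexRank (n := n)) := by
  intro a b h
  rcases lexLT_trichotomy a b with h' | h' | h'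
  · exact absurd h (lexRank_lt_of_lexLT h').ne
  · exact h'
  · exact absurd h (lexRank_lt_of_lexLT h').ne'

theorem sg_of_lt (R : Type*) [Ring R] {n : ℕ} {a b : Fin n} (h : a < b) : sg R a b = -1 := by
  rw [sg, if_neg h.not_gt, if_pos h]

theorem sg_of_gt (R : Type*) [Ring R] {n : ℕ} {a b : Fin n} (h : b < a) : sg R a b = 1 := by
  rw [sg, if_pos h]

theorem sg_self (R : Type*) [Ring R] {n : ℕ} (a : Fin n) : sg R a a = 0 := by
  rw [sg, if_neg (lt_irrefl a), if_neg (lt_irrefl a)]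

end RankAndSign

/-! ### Quantum affine spaces: nothing to delete -/

section AffineSpaces

theorem quadratic_hasLogCanonicalImages {k : Type u} [Field k] [CharZero k] {σ : Type}
    (Λ : Matrix σ σ k) (hΛ : Λ.transpose = -Λ) : HasLogCanonicalImages (quadratic k Λ hΛ) Λ := by
  intro F _ _ ρ φ hφ
  refine ⟨fun s => φ (X s), fun s t => ?_, fun s => IntermediateField.subset_adjoin _ _ ⟨s, rfl⟩⟩
  rw [← hφ, quadratic_X, map_mul, map_mul, ← MvPolynomial.algebraMap_eq, φ.commutes]
  rfl

end AffineSpaces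

/-! ### Quantum matrices -/

section Matrices

variable {k : Type*} [Field k] {n : ℕ}

/-- In this form the entry is a function of the row of `a` plus a function of its column. The
products X_{im} X_{lj} and X_{ij} X_{lm} have the same rows and columns, hence the same weight in
every later row of the matrix. -/
theorem matricesField_of_lexLT (lam : k) (p : Matrix (Fin n) (Fin n) k) {u a : Fin n × Fin n} (h : LexLT a u) :
    matricesField lam p u a = p u.1 a.1 + p a.2 u.2 + if u.2 ≤ a.2 then lam else 0 := by
  simp only [matricesField, Matrix.of_apply, skewExtend, if_pos h]
  have h' : a.1 ≤ u.1 := by unfold LexLT at h; omega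
  by_cases h2 : a.2 < u.2
  · rw [if_pos ⟨h', h2⟩, if_neg h2.not_ge, add_zero]
  · rw [if_neg fun h => h2 h.2, if_pos (not_lt.mp h2)]
    ring

variable [CharZero k]

theorem matrices_defect (lam : k) {p : Matrix (Fin n) (Fin n) k} (hp : p.transpose = -p)
    {t a : Fin n × Fin n} (h : LexLT a t) :
    defect (matrices lam p hp) (matricesField lam p) t a =
      if a.1 < t.1 ∧ a.2 < t.2 then lam • (X (a.1, t.2) * X (t.1, a.2)) else 0 := by
  have e : (matrices lam p hp).bracket (X t) (X a) = matricesGen lam p t a := poly_X _ _ _ _ _ _ _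
  obtain ⟨l, m⟩ := t
  obtain ⟨i, j⟩ := a
  rw [defect, e, matricesField_of_lexLT lam p h]
  simp only [matricesGen, skewExtend, if_pos h, MvPolynomial.smul_eq_C_mul]
  have h' : i < l ∨ i = l ∧ j < m := h
  by_cases h1 : i < l
  · by_cases h2 : j < m
    · simp only [h1, h2, and_self, if_true, h2.not_ge, if_false, add_zero]
      ring
    · simp only [h1, h2, and_false, if_true, not_lt.mp h2, if_false, C_add]
      ring
  · obtain ⟨rfl, h2⟩ := h'.resolve_left h1
    simp only [h1, false_and, if_false, h2.not_ge, diag_zero hp, C_add, C_0]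
    ring

/-- Only the entries strictly above and to the left of X_t have a defect, and its factors lie in the
row and the column of X_t, where there is none; so δ_t² vanishes on the indeterminates. The
eigenvalue `lam` is the value at `a = t` of the formula in `matricesField_of_lexLT`. If it is zero,
so are all defects. -/
theorem matrices_isDeletable (lam : k) {p : Matrix (Fin n) (Fin n) k} (hp : p.transpose = -p) :
    IsDeletable (matrices lam p hp) (matricesField lam p) lexRank (fun _ => lam)
      (fun t a => if a.1 < t.1 ∧ a.2 < t.2 then 1 else 0) where
  rank_injective := lexRank_injective
  order_le t a := by split_ifs <;> omega
  ne_zero_or t := by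
    by_cases h : lam = 0
    · refine .inr fun a ha => ?_
      rw [matrices_defect lam hp (lexRank_lt_iff.mp ha), h, zero_smul, ite_self]
    · exact .inl h
  defect_mem t a ha := by
    rw [lexRank_lt_iff] at ha
    rw [matrices_defect lam hp ha]
    split_ifs with h
    swap
    · exact zero_mem _
    obtain ⟨h1, h2⟩ := h
    obtain ⟨l, m⟩ := t
    obtain ⟨i, j⟩ := a
    simp only at h1 h2
    have e1 : LexLT (i, m) (l, m) := .inl h1
    have e2 : LexLT (l, j) (l, m) := .inr ⟨rfl, h2⟩
    refine Submodule.smul_mem _ _ (Submodule.subset_span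
      ⟨(i, m), (l, j), rfl, lexRank_lt_iff.mpr e1, lexRank_lt_iff.mpr e2, ?_, ?_, fun u hu => ?_⟩)
    · simp
    · rw [matricesField_of_lexLT lam p e1, matricesField_of_lexLT lam p e2,
        matricesField_of_lexLT lam p ha]
      simp only [diag_zero hp, le_refl, if_true, if_neg h2.not_ge]
      ring
    · have e : ∀ {a}, LexLT a (l, m) → LexLT a u := fun {a} h =>
        lexRank_lt_iff.mp ((lexRank_lt_of_lexLT h).trans hu)
      rw [matricesField_of_lexLT lam p (e e1), matricesField_of_lexLT lam p (e e2),
        matricesField_of_lexLT lam p (e ha),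
        matricesField_of_lexLT lam p (lexRank_lt_iff.mp hu)]
      ring

end Matrices

/-! ### Quantum symplectic and euclidean spaces -/

section Euclidean

variable {k : Type*} [Field k] {n : ℕ}

/-- The rank of the indeterminates of even-dimensional euclidean spaces: the `y_i` come first. -/
def evenRank {n : ℕ} : Fin n ⊕ Fin n → ℕ := Sum.elim (fun i => n + i) (fun i => i)

theorem evenRank_injective : Function.Injective (evenRank (n := n)) := by
  rintro (i | i) (j | j) h <;> simp only [evenRank, Sum.elim_inl, Sum.elim_inr] at h
  · exact congrArg _ (Fin.ext (by omega))
  · omega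
  · omega
  · exact congrArg _ (Fin.ext h)

/-- The eigenvalues attached to the indeterminates of even-dimensional euclidean spaces. -/
def evenEigenvalue (p q : Fin n → k) : Fin n ⊕ Fin n → k := Sum.elim (fun i => p i - q i) 0

/-- The order of nilpotency at the indeterminates of even-dimensional euclidean spaces. -/
def evenOrder : Fin n ⊕ Fin n → Fin n ⊕ Fin n → ℕ
  | .inl i, .inr j => if i = j then 1 else 0
  | _, _ => 0

theorem evenOrder_le (t a : Fin n ⊕ Fin n) : evenOrder t a ≤ 2 := by
  rcases t with i | i <;> rcases a with j | j <;> simp only [evenOrder] <;>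
    try split_ifs
  all_goals omega

/-- All products x_l y_l with l < i have the same weight p_i for x_i, which makes the sum in {x_i,
y_i} homogeneous. Since y_i has weight q_i, the eigenvalue is p_i - q_i; this is where p_i ≠ q_i
enters. -/
theorem evenField_inl_add_inr (Γ : Matrix (Fin n) (Fin n) k) (p q : Fin n → k) {i l : Fin n}
    (h : l < i) :
    evenField Γ p q (.inl i) (.inl l) + evenField Γ p q (.inl i) (.inr l) = p i := by
  simp only [evenField, Matrix.of_apply, skewExtend, h, h.not_gt, if_true, if_false]
  ring

theorem oddField_some (Γ : Matrix (Fin n) (Fin n) k) (p q : Fin n → k) (a b : Fin n ⊕ Fin n) :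
    oddField Γ p q (some a) (some b) = evenField Γ p q a b := by
  rcases a with i | i <;> rcases b with j | j <;> rfl

variable [CharZero k]

theorem evenField_inl_inr_self {Γ : Matrix (Fin n) (Fin n) k} (hΓ : Γ.transpose = -Γ)
    (p q : Fin n → k) (i : Fin n) : evenField Γ p q (.inl i) (.inr i) = q i := by
  simp [evenField, diag_zero hΓ]

theorem even_defect_eq_zero {Γ : Matrix (Fin n) (Fin n) k} (hΓ : Γ.transpose = -Γ)
    (p q : Fin n → k) {t a : Fin n ⊕ Fin n} (h : evenRank a < evenRank t)
    (ht : ∀ i, t = .inl i → a ≠ .inr i) :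
    defect (evenEuclidean Γ hΓ p q) (evenField Γ p q) t a = 0 := by
  have e : (evenEuclidean Γ hΓ p q).bracket (X t) (X a) = evenGen Γ p q t a :=
    poly_X _ _ _ _ _ _ _
  rw [defect, e]
  rcases t with i | i <;> rcases a with j | j
  · have hij : j < i := by simpa [evenRank] using h
    simp only [evenGen, evenField, Matrix.of_apply, skewExtend, hij, hij.not_gt, if_true, if_false,
      C_neg]
    ring
  · have hij : i ≠ j := fun h => ht i rfl (by rw [h])
    rcases lt_or_gt_of_ne hij with hij | hij
    · simp only [evenGen, evenField, Matrix.of_apply, hij, if_true]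
      ring
    · simp only [evenGen, evenField, Matrix.of_apply, hij, hij.not_gt, if_true, if_false]
      ring
  · simp only [evenRank, Sum.elim_inl, Sum.elim_inr] at h
    omega
  · simp only [evenGen, evenField, Matrix.of_apply]
    ring

theorem even_defect {Γ : Matrix (Fin n) (Fin n) k} (hΓ : Γ.transpose = -Γ)
    (p q : Fin n → k) (i : Fin n) :
    defect (evenEuclidean Γ hΓ p q) (evenField Γ p q) (.inl i) (.inr i) =
      ∑ l with l < i, (q l - p l) • (X (.inl l) * X (.inr l)) := by
  have e : (evenEuclidean Γ hΓ p q).bracket (X (.inl i)) (X (.inr i)) =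
    evenGen Γ p q (.inl i) (.inr i) := poly_X _ _ _ _ _ _ _
  rw [defect, e, evenField_inl_inr_self hΓ]
  simp only [evenGen, lt_irrefl, if_false, MvPolynomial.smul_eq_C_mul, mul_assoc]
  ring

/-- In the order y_1, …, y_n, x_1, …, x_n the only defects are those of {x_i, y_i}. They involve
x_l, y_l with l < i, on which the derivation attached to x_i vanishes. The indeterminates after x_i
are the x_j with j > i, for which x_l y_l and x_i y_i both have weight p_j. -/
theorem even_isDeletable {Γ : Matrix (Fin n) (Fin n) k} (hΓ : Γ.transpose = -Γ)
    (p q : Fin n → k) (hpq : ∀ i, p i ≠ q i) :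
    IsDeletable (evenEuclidean Γ hΓ p q) (evenField Γ p q) evenRank (evenEigenvalue p q)
      evenOrder where
  rank_injective := evenRank_injective
  order_le := evenOrder_le
  ne_zero_or t := by
    rcases t with i | i
    · exact .inl (sub_ne_zero.mpr (hpq i))
    · exact .inr fun a ha => even_defect_eq_zero hΓ p q ha fun _ h => absurd h Sum.inr_ne_inl
  defect_mem t a ha := by
    by_cases h : ∃ i, t = .inl i ∧ a = .inr i
    swap
    · rw [even_defect_eq_zero hΓ p q ha fun i h1 h2 => h ⟨i, h1, h2⟩]
      exact zero_mem _
    obtain ⟨i, rfl, rfl⟩ := h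
    rw [even_defect hΓ]
    refine sum_mem fun l hl => Submodule.smul_mem _ _ (Submodule.subset_span ?_)
    have hl : l < i := (Finset.mem_filter.mp hl).2
    refine ⟨.inl l, .inr l, rfl, ?_, ?_, ?_, ?_, fun u hu => ?_⟩
    · simpa [evenRank] using hl
    · simp only [evenRank, Sum.elim_inl, Sum.elim_inr]
      omega
    · simp [evenOrder, hl.ne']
    · rw [evenField_inl_add_inr Γ p q hl, evenField_inl_inr_self hΓ]
      simp [evenEigenvalue]
    · rcases u with j | j
      · have hij : i < j := by simpa [evenRank] using hu
        rw [evenField_inl_add_inr Γ p q (hl.trans hij), add_comm, evenField_inl_add_inr Γ p q hij]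
      · simp only [evenRank, Sum.elim_inl, Sum.elim_inr] at hu
        omega

/-- The rank of the indeterminates of odd-dimensional euclidean spaces. -/
def oddRank {n : ℕ} : Option (Fin n ⊕ Fin n) → ℕ
  | none => 0
  | some a => evenRank a + 1

theorem oddRank_injective : Function.Injective (oddRank (n := n)) := by
  rintro (_ | a) (_ | b) h <;> simp only [oddRank] at h
  · rfl
  · omega
  · omega
  · exact congrArg some (evenRank_injective (by omega))

/-- The eigenvalues attached to the indeterminates of odd-dimensional euclidean spaces. -/
def oddEigenvalue (p q : Fin n → k) : Option (Fin n ⊕ Fin n) → k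
  | none => 0
  | some a => evenEigenvalue p q a

/-- The order of nilpotency at the indeterminates of odd-dimensional euclidean spaces. -/
def oddOrder : Option (Fin n ⊕ Fin n) → Option (Fin n ⊕ Fin n) → ℕ
  | some a, some b => evenOrder a b
  | _, _ => 0

theorem odd_defect_eq_zero {Γ : Matrix (Fin n) (Fin n) k} (hΓ : Γ.transpose = -Γ)
    (p q : Fin n → k) (lam : k) {t a : Option (Fin n ⊕ Fin n)} (h : oddRank a < oddRank t)
    (ht : ∀ i, t = some (.inl i) → a ≠ some (.inr i)) :
    defect (oddEuclidean Γ hΓ p q lam) (oddField Γ p q) t a = 0 := by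
  have e : (oddEuclidean Γ hΓ p q lam).bracket (X t) (X a) = oddGen Γ p q lam t a :=
    poly_X _ _ _ _ _ _ _
  rw [defect, e]
  rcases t with _ | i | i
  · exact absurd h (Nat.not_lt_zero _)
  · rcases a with _ | j | j
    · simp only [oddGen, oddField, Matrix.of_apply, C_neg]
      ring
    · have hij : j < i := by simpa [oddRank, evenRank] using h
      rw [oddField_some]
      simp only [oddGen, evenField, Matrix.of_apply, skewExtend, hij, hij.not_gt, if_true,
        if_false, C_neg]
      ring
    · have hij : i ≠ j := fun h => ht i rfl (by rw [h])
      rw [oddField_some]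
      rcases lt_or_gt_of_ne hij with hij | hij
      · simp only [oddGen, evenField, Matrix.of_apply, hij, if_true]
        ring
      · simp only [oddGen, evenField, Matrix.of_apply, hij, hij.not_gt, if_true, if_false]
        ring
  · rcases a with _ | j | j
    · simp only [oddGen, oddField, Matrix.of_apply, C_neg]
      ring
    · simp only [oddRank, evenRank, Sum.elim_inl, Sum.elim_inr] at h
      omega
    · rw [oddField_some]
      simp only [oddGen, evenField, Matrix.of_apply]
      ring

theorem odd_defect {Γ : Matrix (Fin n) (Fin n) k} (hΓ : Γ.transpose = -Γ)
    (p q : Fin n → k) (lam : k) (i : Fin n) :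
    defect (oddEuclidean Γ hΓ p q lam) (oddField Γ p q) (some (.inl i)) (some (.inr i)) =
      (∑ l with l < i, (q l - p l) • (X (some (.inl l)) * X (some (.inr l)))) +
        lam • (X none * X none) := by
  have e : (oddEuclidean Γ hΓ p q lam).bracket (X (some (.inl i))) (X (some (.inr i))) =
    oddGen Γ p q lam (some (.inl i)) (some (.inr i)) := poly_X _ _ _ _ _ _ _
  rw [defect, e, oddField_some, evenField_inl_inr_self hΓ]
  simp only [oddGen, lt_irrefl, if_false, MvPolynomial.smul_eq_C_mul, mul_assoc]
  ring

theorem odd_isDeletable {Γ : Matrix (Fin n) (Fin n) k} (hΓ : Γ.transpose = -Γ)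
    (p q : Fin n → k) (lam : k) (hpq : ∀ i, p i ≠ q i) :
    IsDeletable (oddEuclidean Γ hΓ p q lam) (oddField Γ p q) oddRank (oddEigenvalue p q)
      oddOrder where
  rank_injective := oddRank_injective
  order_le t a := by
    rcases t with _ | t <;> rcases a with _ | a <;>
      first | exact evenOrder_le _ _ | exact Nat.zero_le _
  ne_zero_or t := by
    rcases t with _ | i | i
    · exact .inr fun a ha => absurd ha (Nat.not_lt_zero _)
    · exact .inl (sub_ne_zero.mpr (hpq i))
    · exact .inr fun a ha => odd_defect_eq_zero hΓ p q lam ha fun _ h =>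
        absurd (Option.some.inj h) Sum.inr_ne_inl
  defect_mem t a ha := by
    by_cases h : ∃ i, t = some (.inl i) ∧ a = some (.inr i)
    swap
    · rw [odd_defect_eq_zero hΓ p q lam ha fun i h1 h2 => h ⟨i, h1, h2⟩]
      exact zero_mem _
    obtain ⟨i, rfl, rfl⟩ := h
    have hw : ∀ u, oddRank (some (.inl i)) < oddRank u →
        ∃ j, i < j ∧ u = some (Sum.inl j : Fin n ⊕ Fin n) := by
      rintro (_ | j | j) hu
      · exact absurd hu (Nat.not_lt_zero _)
      · exact ⟨j, by simpa [oddRank, evenRank] using hu, rfl⟩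
      · simp only [oddRank, evenRank, Sum.elim_inl, Sum.elim_inr] at hu
        omega
    rw [odd_defect hΓ]
    refine add_mem (sum_mem fun l hl => Submodule.smul_mem _ _ (Submodule.subset_span ?_))
      (Submodule.smul_mem _ _ (Submodule.subset_span ?_))
    · have hl : l < i := (Finset.mem_filter.mp hl).2
      refine ⟨some (.inl l), some (.inr l), rfl, ?_, ?_, ?_, ?_, fun u hu => ?_⟩
      · simpa [oddRank, evenRank] using hl
      · simp only [oddRank, evenRank, Sum.elim_inl, Sum.elim_inr]
        omega
      · simp [oddOrder, evenOrder, hl.ne']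
      · rw [oddField_some, oddField_some, oddField_some, evenField_inl_add_inr Γ p q hl,
          evenField_inl_inr_self hΓ]
        simp [oddEigenvalue, evenEigenvalue]
      · obtain ⟨j, hij, rfl⟩ := hw u hu
        simp only [oddField_some]
        rw [evenField_inl_add_inr Γ p q (hl.trans hij), add_comm, evenField_inl_add_inr Γ p q hij]
    -- The factor 1/2 in the brackets of z_0 gives z_0² the weight 2 · p_i/2 = p_i, the same as that
    -- of the x_l y_l.
    · refine ⟨none, none, rfl, Nat.succ_pos _, Nat.succ_pos _, ?_, ?_, fun u hu => ?_⟩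
      · simp [oddOrder, evenOrder]
      · rw [oddField_some, evenField_inl_inr_self hΓ]
        simp [oddField, oddEigenvalue, evenEigenvalue]
      · obtain ⟨j, hij, rfl⟩ := hw u hu
        simp only [oddField_some]
        rw [add_comm (evenField Γ p q _ _), evenField_inl_add_inr Γ p q hij]
        simp [oddField]

end Euclidean

/-! ### Quantum symmetric and antisymmetric matrices -/

section Symmetric

variable {k : Type*} [Field k] {n : ℕ}

/-- The multiplicity of the index `x` in the pair `u`. -/
def pairMult (k : Type*) [Field k] {n : ℕ} (u : Fin n × Fin n) (x : Fin n) : k :=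
  (if x = u.1 then 1 else 0) + if x = u.2 then 1 else 0

/-- The case distinction for `c` merely counts coincidences between the indices of the two pairs,
with multiplicity. This makes every row of the matrix, up to its diagonal, a linear function of the
degree ε_i + ε_j of y_{ij}. -/
theorem symmetricField_of_lexLT {u a : {a : Fin n × Fin n // a.1 ≤ a.2}} (h : LexLT a.1 u.1) :
    symmetricField k n u a = -(pairMult k u.1 a.1.1 + pairMult k u.1 a.1.2) := by
  obtain ⟨⟨l, m⟩, h1⟩ := u
  obtain ⟨⟨i, j⟩, h2⟩ := a
  simp only [symmetricField, Matrix.of_apply, skewExtend, if_neg (LexLT.asymm _ _ h), if_pos h,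
    pairMult]
  simp only [LexLT] at h h1 h2
  congr 1
  split_ifs <;> first | (exfalso; omega) | norm_num

theorem antisymmetricField_of_lexLT {u a : {a : Fin n × Fin n // a.1 < a.2}} (h : LexLT a.1 u.1) :
    antisymmetricField k n u a = -(pairMult k u.1 a.1.1 + pairMult k u.1 a.1.2) := by
  obtain ⟨⟨l, m⟩, h1⟩ := u
  obtain ⟨⟨i, j⟩, h2⟩ := a
  simp only [antisymmetricField, Matrix.of_apply, skewExtend, if_neg (LexLT.asymm _ _ h), if_pos h,
    pairMult]
  simp only [LexLT] at h h1 h2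
  -- Two different pairs of distinct ordered indices share at most one index, so the cardinality is
  -- again the number of coincidences.
  have e : (({i, j} : Finset (Fin n)) ∩ {l, m}).card =
      (if i = l ∨ i = m then 1 else 0) + if j = l ∨ j = m then 1 else 0 := by
    rw [← Finset.filter_mem_eq_inter, Finset.card_filter, Finset.sum_pair h2.ne]
    simp
  rw [e]
  congr 1
  split_ifs <;> first | (exfalso; omega) | norm_num

variable [CharZero k]

/-- The eigenvalue attached to the indeterminate `y_{lm}` of (anti)symmetric matrices. -/
def pairEigenvalue (k : Type*) [Field k] {n : ℕ} (t : Fin n × Fin n) : k :=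
  -- The value at `a = t` of the formula for the entries below `t`, in place of the actual diagonal
  -- entry 0.
  -(pairMult k t t.1 + pairMult k t t.2)

theorem pairEigenvalue_ne_zero (t : Fin n × Fin n) : pairEigenvalue k t ≠ 0 := by
  simp only [pairEigenvalue, pairMult, neg_ne_zero]
  split_ifs <;> first | (exfalso; omega) | norm_num

/-- The order of nilpotency at the indeterminates of (anti)symmetric matrices. -/
def pairOrder {n : ℕ} (t a : Fin n × Fin n) : ℕ :=
  -- For t = (l,m) and a = (i,j) with j < l the defect contains y_{il} and y_{jl}, which for l < m
  -- may have a defect in turn; hence order 2. In the antisymmetric case the order 1 given to y_{il}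
  -- is only an upper bound.
  if a.2 < t.1 then 2
  else if (a.1 < t.1 ∧ a.2 = t.1 ∧ t.1 < t.2) ∨ (a.1 < t.1 ∧ t.1 < a.2 ∧ a.2 < t.2) then 1
  else 0

/-- Deletability of brackets on indeterminates indexed by pairs, which are homogeneous with respect
to the grading in which `y_{ij}` has degree `ε_i + ε_j`. -/
theorem isDeletable_of_pairs {P : Fin n × Fin n → Prop}
    {π : PoissonBracket k (MvPolynomial {a // P a} k)} {Λ : Matrix {a // P a} {a // P a} k}
    (hΛ : ∀ u a, LexLT a.1 u.1 → Λ u a = -(pairMult k u.1 a.1.1 + pairMult k u.1 a.1.2))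
    (hπ : ∀ (S : Submodule k (MvPolynomial {a // P a} k)) (t i : {a // P a}), LexLT i.1 t.1 →
      (∀ a b : {a // P a}, LexLT a.1 t.1 → LexLT b.1 t.1 →
        pairOrder t.1 a.1 + pairOrder t.1 b.1 < pairOrder t.1 i.1 →
        -- Equality of the degrees of X_a X_b and X_i X_t, tested by all additive functions of the
        -- degree.
        (∀ f : Fin n → k, f a.1.1 + f a.1.2 + (f b.1.1 + f b.1.2) =
          f i.1.1 + f i.1.2 + (f t.1.1 + f t.1.2)) → X a * X b ∈ S) → defect π Λ t i ∈ S) :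
    IsDeletable π Λ (fun a => lexRank a.1) (fun t => pairEigenvalue k t.1)
      (fun t a => pairOrder t.1 a.1) where
  rank_injective := lexRank_injective.comp Subtype.val_injective
  order_le t a := by
    simp only [pairOrder]
    split_ifs <;> omega
  ne_zero_or t := .inl (pairEigenvalue_ne_zero t.1)
  defect_mem t i hi := by
    rw [lexRank_lt_iff] at hi
    refine hπ _ t i hi fun a b ha hb ho hm => Submodule.subset_span
      ⟨a, b, rfl, lexRank_lt_of_lexLT ha, lexRank_lt_of_lexLT hb, ho, ?_, fun u hu => ?_⟩
    -- Each row of `Λ` is minus the additive function given by the multiplicities in its index, so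
    -- one equality of degrees yields the weight conditions in row `t` and in all later rows.
    · rw [hΛ t a ha, hΛ t b hb, hΛ t i hi, pairEigenvalue]
      linear_combination -hm (pairMult k t.1)
    · have e : ∀ {a}, LexLT a t.1 → LexLT a u.1 := fun {a} h =>
        lexRank_lt_iff.mp ((lexRank_lt_of_lexLT h).trans hu)
      rw [hΛ u a (e ha), hΛ u b (e hb), hΛ u i (e hi), hΛ u t (lexRank_lt_iff.mp hu)]
      linear_combination -hm (pairMult k u.1)

/-- For y_{lm} and an earlier y_{ij} the defect is nonzero only in three positions: -2(y_{il} y_{jm}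
+ y_{im} y_{jl}) if j < l, -2 y_{im} y_{ll} if i < j = l < m, and -2 y_{im} y_{lj} if i < l < j < m.
Elsewhere the signs cancel or leave exactly the log-canonical term. -/
theorem symmetric_isDeletable (k : Type*) [Field k] [CharZero k] (n : ℕ) :
    IsDeletable (symmetric k n) (symmetricField k n) (fun a => lexRank a.1)
      (fun t => pairEigenvalue k t.1) (fun t a => pairOrder t.1 a.1) := by
  refine isDeletable_of_pairs (fun u a h => symmetricField_of_lexLT h) fun S t a ha hS => ?_
  have e : (symmetric k n).bracket (X t) (X a) = symGen k n t a := poly_X _ _ _ _ _ _ _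
  rw [defect, e, symmetricField_of_lexLT ha]
  obtain ⟨⟨l, m⟩, hlm⟩ := t
  obtain ⟨⟨i, j⟩, hij⟩ := a
  have hlm' : l ≤ m := hlm
  have hij' : i ≤ j := hij
  have hX : ∀ {x y : Fin n} (h : x ≤ y), (X ⟨(x, y), h⟩ : MvPolynomial _ k) = symY k x y :=
    fun h => (symY_of_le k n ⟨(_, _), h⟩).symm
  have ha' : i < l ∨ i = l ∧ j < m := ha
  simp only [symGen, hX, pairMult]
  rw [symY_comm k l i, symY_comm k m j, symY_comm k l j, symY_comm k m i]
  rcases ha' with hil | ⟨rfl, hjm⟩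
  · have him : i < m := hil.trans_le hlm
    rcases lt_trichotomy j l with hjl | rfl | hjl
    · have hjm : j < m := hjl.trans_le hlm
      have h1 := hS ⟨(i, l), hil.le⟩ ⟨(j, m), hjm.le⟩ (.inl hil) (.inl hjl)
        (by simp only [pairOrder]; split_ifs <;> omega) (fun f => by ring)
      have h2 := hS ⟨(i, m), him.le⟩ ⟨(j, l), hjl.le⟩ (.inl hil) (.inl hjl)
        (by simp only [pairOrder]; split_ifs <;> omega) (fun f => by ring)
      rw [hX, hX] at h1 h2
      convert add_mem (S.smul_mem (-2) h1) (S.smul_mem (-2) h2) using 1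
      simp only [sg_of_lt _ him, sg_of_lt _ hil, sg_of_lt _ hjl, sg_of_lt _ hjm, hil.ne, him.ne,
        hjl.ne, hjm.ne, if_false, MvPolynomial.smul_eq_C_mul, C_neg, map_ofNat, add_zero,
        neg_zero, C_0]
      ring
    · rcases hlm'.eq_or_lt with rfl | hjm
      · convert zero_mem S using 1
        simp only [sg_of_lt _ hil, sg_self, hil.ne, if_true, if_false, C_neg, C_add, C_0, C_1]
        ring
      · have h1 := hS ⟨(i, m), him.le⟩ ⟨(j, j), le_rfl⟩ (.inl hil) (.inr ⟨rfl, hjm⟩)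
          (by simp [pairOrder, hil, hjm, hjm.not_gt, hjm.ne']) (fun f => by ring)
        rw [hX, hX] at h1
        convert S.smul_mem (-2) h1 using 1
        simp only [sg_of_lt _ him, sg_of_lt _ hil, sg_self, sg_of_lt _ hjm, hil.ne, him.ne,
          hjm.ne, if_true, if_false, MvPolynomial.smul_eq_C_mul, C_neg, map_ofNat, add_zero,
          C_add, C_0, C_1]
        ring
    · rcases lt_trichotomy j m with hjm | rfl | hjm
      · have h1 := hS ⟨(i, m), him.le⟩ ⟨(l, j), hjl.le⟩ (.inl hil) (.inr ⟨rfl, hjm⟩)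
          (by simp only [pairOrder]; split_ifs <;> omega) (fun f => by ring)
        rw [hX, hX, symY_comm k l j] at h1
        convert S.smul_mem (-2) h1 using 1
        simp only [sg_of_lt _ him, sg_of_lt _ hil, sg_of_gt _ hjl, sg_of_lt _ hjm, hil.ne, him.ne,
          hjl.ne', hjm.ne, if_false, MvPolynomial.smul_eq_C_mul, C_neg, map_ofNat, add_zero,
          neg_zero, C_0]
        ring
      · convert zero_mem S using 1
        rw [symY_comm k l j]
        simp only [sg_of_lt _ him, sg_of_lt _ hil, sg_of_gt _ hjl, sg_self, hil.ne, him.ne,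
          hjl.ne', if_true, if_false, C_neg, C_add, C_0, C_1]
        ring
      · convert zero_mem S using 1
        simp only [sg_of_lt _ him, sg_of_lt _ hil, sg_of_gt _ hjl, sg_of_gt _ hjm, hil.ne, him.ne,
          hjl.ne', hjm.ne', if_false, add_zero, neg_zero, C_0]
        ring
  · convert zero_mem S using 1
    have him : i < m := hij'.trans_lt hjm
    rcases hij'.eq_or_lt with rfl | hij2
    · simp only [sg_of_lt _ him, sg_self, him.ne, if_true, if_false, C_neg, C_add, C_0, C_1]
      ring
    · rw [symY_comm k j i]
      simp only [sg_of_lt _ him, sg_self, sg_of_gt _ hij2, sg_of_lt _ hjm, him.ne, hjm.ne,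
        hij2.ne', if_true, if_false, C_neg, C_add, C_0, C_1]
      ring

/-- As for symmetric matrices, with the sign of y_{im} y_{jl} reversed if j < l, and without a
defect if j = l because y_{ll} = 0. -/
theorem antisymmetric_isDeletable (k : Type*) [Field k] [CharZero k] (n : ℕ) :
    IsDeletable (antisymmetric k n) (antisymmetricField k n) (fun a => lexRank a.1)
      (fun t => pairEigenvalue k t.1) (fun t a => pairOrder t.1 a.1) := by
  refine isDeletable_of_pairs (fun u a h => antisymmetricField_of_lexLT h) fun S t a ha hS => ?_
  have e : (antisymmetric k n).bracket (X t) (X a) = altGen k n t a := poly_X _ _ _ _ _ _ _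
  rw [defect, e, antisymmetricField_of_lexLT ha]
  obtain ⟨⟨l, m⟩, hlm⟩ := t
  obtain ⟨⟨i, j⟩, hij⟩ := a
  have hlm' : l < m := hlm
  have hij' : i < j := hij
  have hX : ∀ {x y : Fin n} (h : x < y), (X ⟨(x, y), h⟩ : MvPolynomial _ k) = altY k x y :=
    fun h => (altY_of_lt k n ⟨(_, _), h⟩).symm
  have ha' : i < l ∨ i = l ∧ j < m := ha
  simp only [altGen, hX, pairMult]
  rw [altY_comm k l i, altY_comm k m j, altY_comm k l j, altY_comm k m i]
  rcases ha' with hil | ⟨rfl, hjm⟩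
  · have him : i < m := hil.trans hlm
    rcases lt_trichotomy j l with hjl | rfl | hjl
    · have hjm : j < m := hjl.trans hlm
      have h1 := hS ⟨(i, l), hil⟩ ⟨(j, m), hjm⟩ (.inl hil) (.inl hjl)
        (by simp only [pairOrder]; split_ifs <;> omega) (fun f => by ring)
      have h2 := hS ⟨(i, m), him⟩ ⟨(j, l), hjl⟩ (.inl hil) (.inl hjl)
        (by simp only [pairOrder]; split_ifs <;> omega) (fun f => by ring)
      rw [hX, hX] at h1 h2
      convert add_mem (S.smul_mem (-2) h1) (S.smul_mem 2 h2) using 1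
      simp only [sg_of_lt _ him, sg_of_lt _ hil, sg_of_lt _ hjl, sg_of_lt _ hjm, hil.ne, him.ne,
        hjl.ne, hjm.ne, if_false, MvPolynomial.smul_eq_C_mul, C_neg, map_ofNat, add_zero,
        neg_zero, C_0]
      ring
    · convert zero_mem S using 1
      simp only [sg_of_lt _ him, sg_of_lt _ hil, sg_self, sg_of_lt _ hlm', hil.ne, him.ne,
        hlm'.ne, altY_self, if_true, if_false, C_neg, C_add, C_0, C_1]
      ring
    · rcases lt_trichotomy j m with hjm | rfl | hjm
      · have h1 := hS ⟨(i, m), him⟩ ⟨(l, j), hjl⟩ (.inl hil) (.inr ⟨rfl, hjm⟩)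
          (by simp only [pairOrder]; split_ifs <;> omega) (fun f => by ring)
        rw [hX, hX, altY_comm k l j] at h1
        convert S.smul_mem (-2) h1 using 1
        simp only [sg_of_lt _ him, sg_of_lt _ hil, sg_of_gt _ hjl, sg_of_lt _ hjm, hil.ne, him.ne,
          hjl.ne', hjm.ne, if_false, MvPolynomial.smul_eq_C_mul, C_neg, map_ofNat, add_zero,
          neg_zero, C_0]
        ring
      · convert zero_mem S using 1
        rw [altY_comm k l j]
        simp only [sg_of_lt _ him, sg_of_lt _ hil, sg_of_gt _ hjl, sg_self, hil.ne, him.ne,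
          hjl.ne', if_true, if_false, C_neg, C_add, C_0, C_1]
        ring
      · convert zero_mem S using 1
        simp only [sg_of_lt _ him, sg_of_lt _ hil, sg_of_gt _ hjl, sg_of_gt _ hjm, hil.ne, him.ne,
          hjl.ne', hjm.ne', if_false, add_zero, neg_zero, C_0]
        ring
  · convert zero_mem S using 1
    have him : i < m := hij'.trans hjm
    rw [altY_comm k j i]
    simp only [sg_of_lt _ him, sg_self, sg_of_gt _ hij', sg_of_lt _ hjm, him.ne, hjm.ne,
      hij'.ne', altY_self, if_true, if_false, C_neg, C_add, C_0, C_1]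
    ring

end Symmetric

end PoissonBracket

theorem theorem4p1 {k : Type*} [Field k] [CharZero k] (n : ℕ) :
    -- quantum affine spaces
    (∀ (q : Matrix (Fin n) (Fin n) k) (hq : q.transpose = -q),
      (PoissonBracket.quadratic k q hq).QuadraticGelfandKirillov q hq) ∧
    -- quantum matrices
    (∀ (lam : k) (p : Matrix (Fin n) (Fin n) k) (hp : p.transpose = -p),
      (PoissonBracket.matrices lam p hp).QuadraticGelfandKirillov
        (PoissonBracket.matricesField lam p) (PoissonBracket.matricesField_skew lam p)) ∧
    -- quantum symplectic and even-dimensional euclidean spaces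
    (∀ (Γ : Matrix (Fin n) (Fin n) k) (hΓ : Γ.transpose = -Γ) (p q : Fin n → k),
      (∀ i, p i ≠ q i) →
      (PoissonBracket.evenEuclidean Γ hΓ p q).QuadraticGelfandKirillov
        (PoissonBracket.evenField Γ p q) (PoissonBracket.evenField_skew hΓ p q)) ∧
    -- odd-dimensional quantum euclidean spaces
    (∀ (Γ : Matrix (Fin n) (Fin n) k) (hΓ : Γ.transpose = -Γ) (p q : Fin n → k) (lam : k),
      (∀ i, p i ≠ q i) →
      (PoissonBracket.oddEuclidean Γ hΓ p q lam).QuadraticGelfandKirillov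
        (PoissonBracket.oddField Γ p q) (PoissonBracket.oddField_skew hΓ p q)) ∧
    -- quantum symmetric matrices
    (PoissonBracket.symmetric k n).QuadraticGelfandKirillov
      (PoissonBracket.symmetricField k n) (PoissonBracket.symmetricField_skew k n) ∧
    -- quantum antisymmetric matrices
    (PoissonBracket.antisymmetric k n).QuadraticGelfandKirillov
      (PoissonBracket.antisymmetricField k n) (PoissonBracket.antisymmetricField_skew k n) := by
  refine ⟨fun q hq => ?_, fun lam p hp => ?_, fun Γ hΓ p q hpq => ?_,
    fun Γ hΓ p q lam hpq => ?_, ?_, ?_⟩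
  · exact (PoissonBracket.quadratic_hasLogCanonicalImages q hq).quadraticGelfandKirillov hq
  · exact ((PoissonBracket.matrices_isDeletable lam hp).hasLogCanonicalImages
      (PoissonBracket.matricesField_skew lam p)).quadraticGelfandKirillov _
  · exact ((PoissonBracket.even_isDeletable hΓ p q hpq).hasLogCanonicalImages
      (PoissonBracket.evenField_skew hΓ p q)).quadraticGelfandKirillov _
  · exact ((PoissonBracket.odd_isDeletable hΓ p q lam hpq).hasLogCanonicalImages
      (PoissonBracket.oddField_skew hΓ p q)).quadraticGelfandKirillov _
  · exact ((PoissonBracket.symmetric_isDeletable k n).hasLogCanonicalImages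
      (PoissonBracket.symmetricField_skew k n)).quadraticGelfandKirillov _
  · exact ((PoissonBracket.antisymmetric_isDeletable k n).hasLogCanonicalImages
      (PoissonBracket.antisymmetricField_skew k n)).quadraticGelfandKirillov _
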